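/- Let $S$ be a commutative ring and let $G$ be a finite group acting on $S$ by ring automorphisms, written $s\mapsto s^g$ (a right action). Let $R=S^G$ be the ring of invariants, $f:R\hookrightarrow S$ the inclusion, and assume that there is $x\in S$ with $\sum_{g\in G}x^g=1$ (equivalently, the trace map $S\to R$ is surjective). Let $K_0(f):K_0(R)\to K_0(S)$ and $\operatorname{Pic}(f):\operatorname{Pic}(R)\to\operatorname{Pic}(S)$ be induced by $S\otimes_R(\,\cdot\,)$. For a subgroup $H\le G$ let $J(H)$ be the intersection of all maximal ideals $\mathfrak M$ of $S$ such that $s^h-s\in\mathfrak M$ for all $h\in H$, $s\in S$, and put $S_H=S/J(H)$; the group $H$ acts trivially on $S_H$. Let $\mathcal C$ be the set of cyclic subgroups of $G$. For a group $X$ with an action of $G$, $H^1(G,X)$ is the set of maps $d:G\to X$ with $d(gg')=d(g)^{g'}d(g')$, modulo the relation $d\sim e$ iff $d(g)=x^g e(g)x^{-1}$ for some $x\in X$ and all $g\in G$. For abelian $X$ it is a group in the usual way. For $X=\operatorname{GL}(S)=\bigcup_n\operatorname{GL}_n(S)$ or $X=\operatorname{SL}(S)$ it is a commutative monoid under block sum: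 $[d]+[e]$ is the class of $g\mapsto\operatorname{diag}(d(g),e(g),1,1,\dots)$, where $d$ has values in $\operatorname{GL}_m(S)$ and $d(g)$ occupies the first $m$ rows and columns. The kernel of a map of such pointed sets is the preimage of the class of the unit cocycle. Then there is an isomorphism of groups $$\psi:\operatorname{Ker}\operatorname{Pic}(f)\;\cong\;\bigcap_{C\in\mathcal C}\operatorname{Ker}\bigl(H^1(G,S^\times)\to\operatorname{Hom}(C,S_C^\times)\bigr),$$ and $$\bigcap_{C\in\mathcal C}\operatorname{Ker}\bigl(H^1(G,S^\times)\to\operatorname{Hom}(C,S_C^\times)\bigr)=\bigcap_{H\le G}\operatorname{Ker}\bigl(H^1(G,S^\times)\to\operatorname{Hom}(H,S_H^\times)\bigr),$$ the maps being given by restriction to the subgroup and reduction modulo $J(C)$, respectively $J(H)$. Moreover, let $\rho:H^1(G,\operatorname{GL}(S))\to\prod_{C\in\mathcal C}H^1(C,\operatorname{GL}(S_C))$ and $\sigma:H^1(G,\operatorname{SL}(S))\to\prod_{C\in\mathcal C}H^1(C,\operatorname{SL}(S_C))$ be the maps given by restriction and reduction. There is an exact sequence of commutative monoids $$1\to\operatorname{Ker}\sigma\xrightarrow{\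 \iota\ }\operatorname{Ker}K_0(f)\xrightarrow{\ \pi\ }\operatorname{Ker}\operatorname{Pic}(f)\to1$$ (that is, $\iota$ and $\pi$ are homomorphisms, $\iota$ is injective, the image of $\iota$ is the kernel of $\pi$, and $\pi$ is surjective), and an isomorphism $\varphi:\operatorname{Ker}K_0(f)\cong\operatorname{Ker}\rho$ of commutative monoids such that $\varphi\circ\iota$ is induced by the inclusion $\operatorname{SL}(S)\subseteq\operatorname{GL}(S)$ and $\psi\circ\pi$ is the composite of $\varphi$ with the map $H^1(G,\operatorname{GL}(S))\to H^1(G,S^\times)$ induced by the determinant. -/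

import Mathlib

universe u v w

noncomputable section

namespace InvariantK0

/-! ## Nonabelian `H¹` with right actions -/

section H1

variable (G : Type*) (X : Type*) [Group G] [Group X] [MulDistribMulAction G X]

/-- `1`-cocycles `d(g g') = d(g)^{g'} d(g')`. Right actions are encoded by left actions through
`x ^ g = g⁻¹ • x`. -/
@[ext]
structure Cocycle where
  /-- the underlying map `G → X` -/
  toFun : G → X
  map_mul' : ∀ g h : G, toFun (g * h) = (h⁻¹ • toFun g) * toFun h

variable {G X}

instance : CoeFun (Cocycle G X) (fun _ => G → X) := ⟨Cocycle.toFun⟩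

/-- The unit cocycle. -/
instance : One (Cocycle G X) := ⟨⟨fun _ => 1, by simp⟩⟩

@[simp] theorem Cocycle.one_apply (g : G) : (1 : Cocycle G X) g = 1 := rfl

variable (G X)

/-- `d` and `e` are cohomologous if `d(g) = x^g e(g) x⁻¹` for some `x`. -/
def cohomologous : Setoid (Cocycle G X) where
  r d e := ∃ x : X, ∀ g : G, d g = (g⁻¹ • x) * e g * x⁻¹
  iseqv :=
    { refl := fun d => ⟨1, by simp⟩
      symm := by
        rintro d e ⟨x, hx⟩
        exact ⟨x⁻¹, fun g => by rw [hx g, smul_inv']; group⟩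
      trans := by
        rintro d e f ⟨x, hx⟩ ⟨y, hy⟩
        exact ⟨x * y, fun g => by rw [hx g, hy g, smul_mul']; group⟩ }

/-- The nonabelian cohomology set `H¹(G, X)`. -/
def H1 : Type _ := Quotient (cohomologous G X)

variable {G X}

/-- The class of a cocycle. -/
def H1.mk (d : Cocycle G X) : H1 G X := Quotient.mk (cohomologous G X) d

theorem H1.mk_eq_mk {d e : Cocycle G X} :
    H1.mk d = H1.mk e ↔ ∃ x : X, ∀ g : G, d g = (g⁻¹ • x) * e g * x⁻¹ :=
  Quotient.eq (r := cohomologous G X)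

theorem H1.ind {p : H1 G X → Prop} (h : ∀ d, p (H1.mk d)) (a : H1 G X) : p a :=
  Quotient.ind h a

variable {G' X' : Type*} [Group G'] [Group X'] [MulDistribMulAction G' X']

/-- Pull-back of cocycles along `α : G' → G` and a compatible `f : X → X'`. -/
def Cocycle.map (α : G' →* G) (f : X →* X') (hf : ∀ g x, f (α g • x) = g • f x)
    (d : Cocycle G X) : Cocycle G' X' where
  toFun g := f (d (α g))
  map_mul' g h := by
    rw [map_mul, d.map_mul', map_mul, ← map_inv, hf]

/-- The map `H¹(G, X) → H¹(G', X')` induced by `α : G' → G` and a compatible `f : X → X'`. -/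
def H1.map (α : G' →* G) (f : X →* X') (hf : ∀ g x, f (α g • x) = g • f x) :
    H1 G X → H1 G' X' :=
  Quotient.map (Cocycle.map α f hf) (by
    rintro d e ⟨x, hx⟩
    refine ⟨f x, fun g => ?_⟩
    simp only [Cocycle.map]
    rw [hx, map_mul, map_mul, map_inv, ← map_inv, hf])

@[simp] theorem H1.map_mk (α : G' →* G) (f : X →* X') (hf : ∀ g x, f (α g • x) = g • f x)
    (d : Cocycle G X) : H1.map α f hf (H1.mk d) = H1.mk (d.map α f hf) := rfl

end H1

section Abelian

variable {G : Type*} {X : Type*} [Group G] [CommGroup X] [MulDistribMulAction G X]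

instance : CommGroup (Cocycle G X) where
  mul d e := ⟨fun g => d g * e g, fun g h => by
    rw [d.map_mul', e.map_mul', smul_mul']; exact mul_mul_mul_comm _ _ _ _⟩
  inv d := ⟨fun g => (d g)⁻¹, fun g h => by rw [d.map_mul', mul_inv, smul_inv']⟩
  mul_assoc d e f := Cocycle.ext (funext fun g => mul_assoc _ _ _)
  one_mul d := Cocycle.ext (funext fun g => one_mul _)
  mul_one d := Cocycle.ext (funext fun g => mul_one _)
  inv_mul_cancel d := Cocycle.ext (funext fun g => inv_mul_cancel _)
  mul_comm d e := Cocycle.ext (funext fun g => mul_comm _ _)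

@[simp] theorem Cocycle.mul_apply (d e : Cocycle G X) (g : G) : (d * e) g = d g * e g := rfl
@[simp] theorem Cocycle.inv_apply (d : Cocycle G X) (g : G) : (d⁻¹) g = (d g)⁻¹ := rfl

/-- The usual abelian group structure on `H¹(G, X)` for abelian `X`. -/
instance : CommGroup (H1 G X) where
  mul := Quotient.map₂ (fun d e => d * e) (by
    rintro d d' ⟨x, hx⟩ e e' ⟨y, hy⟩
    refine ⟨x * y, fun g => ?_⟩
    simp only [Cocycle.mul_apply]
    rw [hx, hy, smul_mul', mul_inv, mul_mul_mul_comm, mul_mul_mul_comm (g⁻¹ • x)])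
  one := H1.mk 1
  inv := Quotient.map (fun d => d⁻¹) (by
    rintro d d' ⟨x, hx⟩
    refine ⟨x⁻¹, fun g => ?_⟩
    simp only [Cocycle.inv_apply]
    rw [hx, smul_inv', mul_inv, mul_inv])
  mul_assoc a b c := by
    induction a, b, c using Quotient.inductionOn₃ with
    | _ d e f => exact congrArg H1.mk (mul_assoc d e f)
  one_mul a := by
    induction a using Quotient.inductionOn with
    | _ d => exact congrArg H1.mk (one_mul d)
  mul_one a := by
    induction a using Quotient.inductionOn with
    | _ d => exact congrArg H1.mk (mul_one d)
  inv_mul_cancel a := by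
    induction a using Quotient.inductionOn with
    | _ d => exact congrArg H1.mk (inv_mul_cancel d)
  mul_comm a b := by
    induction a, b using Quotient.inductionOn₂ with
    | _ d e => exact congrArg H1.mk (mul_comm d e)

theorem H1.mk_mul (d e : Cocycle G X) : H1.mk (d * e) = H1.mk d * H1.mk e := rfl
theorem H1.mk_one : H1.mk (1 : Cocycle G X) = 1 := rfl

end Abelian

/-! ## The stable linear groups -/

section Ambient

variable (S : Type*) [CommRing S]

/-- The automorphism group of the free module `S^(ℕ)` with basis `e₀, e₁, …`, i.e. the invertible
column-finite `ℕ × ℕ`-matrices over `S`. It serves as the ambient group of `GL(S)`. -/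
def AutInf : Type _ := (Module.End S (ℕ →₀ S))ˣ

instance : Group (AutInf S) := inferInstanceAs (Group (Module.End S (ℕ →₀ S))ˣ)

variable {S}

/-- The underlying endomorphism. -/
def AutInf.toEnd : AutInf S →* Module.End S (ℕ →₀ S) := Units.coeHom _

theorem AutInf.toEnd_injective : Function.Injective (AutInf.toEnd (S := S)) :=
  fun _ _ h => Units.ext h

/-- The entry in row `i` and column `j` of the matrix of `u`. -/
def AutInf.entry (u : AutInf S) (i j : ℕ) : S := u.toEnd (Finsupp.single j 1) i

theorem AutInf.ext_entry {u v : AutInf S} (h : ∀ i j, u.entry i j = v.entry i j) : u = v := by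
  apply AutInf.toEnd_injective
  refine Finsupp.lhom_ext' fun j => LinearMap.ext_ring ?_
  ext i
  exact h i j

theorem AutInf.entry_one (i j : ℕ) : (1 : AutInf S).entry i j = if i = j then 1 else 0 := by
  simp [AutInf.entry, Finsupp.single_apply, eq_comm]

/-- All entries of `u` outside of the top left `n × n`-block are those of the identity matrix. -/
def AutInf.IsBlock (n : ℕ) (u : AutInf S) : Prop :=
  ∀ i j, n ≤ i ∨ n ≤ j → u.entry i j = if i = j then 1 else 0

theorem AutInf.IsBlock.mono {n m : ℕ} (h : n ≤ m) {u : AutInf S} (hu : u.IsBlock n) :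
    u.IsBlock m := fun i j hij => hu i j (by omega)

theorem AutInf.isBlock_one (n : ℕ) : (1 : AutInf S).IsBlock n :=
  fun i j _ => AutInf.entry_one i j

theorem AutInf.toEnd_apply (u : AutInf S) (x : ℕ →₀ S) (i : ℕ) :
    u.toEnd x i = x.sum fun j c => u.entry i j * c := by
  conv_lhs => rw [← Finsupp.sum_single x]
  rw [map_finsuppSum, Finsupp.sum, Finsupp.finsetSum_apply, Finsupp.sum]
  refine Finset.sum_congr rfl fun j _ => ?_
  have : Finsupp.single j (x j) = x j • Finsupp.single j (1 : S) := by simp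
  rw [this, map_smul, Finsupp.smul_apply, smul_eq_mul, mul_comm]; rfl

theorem AutInf.entry_mul (u v : AutInf S) (i j : ℕ) :
    (u * v).entry i j = (v.toEnd (Finsupp.single j 1)).sum fun k c => u.entry i k * c := by
  rw [← AutInf.toEnd_apply]; simp [AutInf.entry]

/-- Matrix multiplication, with the sum cut off at the block size. -/
theorem AutInf.IsBlock.entry_mul {n : ℕ} {v : AutInf S} (hv : v.IsBlock n) (u : AutInf S)
    {i j : ℕ} (hj : j < n) :
    (u * v).entry i j = ∑ k ∈ Finset.range n, u.entry i k * v.entry k j := by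
  rw [AutInf.entry_mul]
  refine Finsupp.sum_of_support_subset _ ?_ _ (by simp)
  intro k hk
  rw [Finset.mem_range]
  by_contra hkn
  rw [Finsupp.mem_support_iff] at hk
  apply hk
  have := hv k j (Or.inl (by omega))
  rw [if_neg (by omega)] at this
  exact this

theorem AutInf.IsBlock.apply_single {n : ℕ} {u : AutInf S} (hu : u.IsBlock n) {j : ℕ}
    (hj : n ≤ j) : u.toEnd (Finsupp.single j 1) = Finsupp.single j 1 := by
  ext i
  have := hu i j (Or.inr hj)
  rw [Finsupp.single_apply]
  simpa [AutInf.entry, eq_comm] using this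

theorem AutInf.IsBlock.mul {n : ℕ} {u v : AutInf S} (hu : u.IsBlock n) (hv : v.IsBlock n) :
    (u * v).IsBlock n := by
  intro i j hij
  by_cases hj : n ≤ j
  · have h1 := hv.apply_single hj
    have h2 := hu.apply_single hj
    simp [AutInf.entry, h1, h2, Finsupp.single_apply, eq_comm]
  · have hi : n ≤ i := by omega
    rw [hv.entry_mul u (by omega)]
    rw [if_neg (by omega)]
    refine Finset.sum_eq_zero fun k hk => ?_
    rw [Finset.mem_range] at hk
    rw [hu i k (Or.inl hi), if_neg (by omega), zero_mul]

variable (S)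

/-- `GL(S) = ⋃ₙ GLₙ(S)`, where `GLₙ(S)` is embedded by `a ↦ diag(a, 1, 1, …)`. -/
def GLInf : Subgroup (AutInf S) where
  carrier := {u | ∃ n, u.IsBlock n ∧ (u⁻¹).IsBlock n}
  one_mem' := ⟨0, AutInf.isBlock_one 0, by rw [inv_one]; exact AutInf.isBlock_one 0⟩
  mul_mem' := by
    rintro u v ⟨n, hn, hn'⟩ ⟨m, hm, hm'⟩
    refine ⟨max n m, (hn.mono (le_max_left _ _)).mul (hm.mono (le_max_right _ _)), ?_⟩
    rw [mul_inv_rev]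
    exact (hm'.mono (le_max_right _ _)).mul (hn'.mono (le_max_left _ _))
  inv_mem' := by
    rintro u ⟨n, hn, hn'⟩
    exact ⟨n, hn', by rwa [inv_inv]⟩

variable {S}

theorem GLInf.exists_isBlock (u : GLInf S) : ∃ n, (u : AutInf S).IsBlock n := by
  obtain ⟨n, hn, _⟩ := u.2
  exact ⟨n, hn⟩

/-- The top left `n × n`-block. -/
def AutInf.block (n : ℕ) (u : AutInf S) : Matrix (Fin n) (Fin n) S :=
  Matrix.of fun i j => u.entry i j

theorem AutInf.block_one (n : ℕ) : (1 : AutInf S).block n = 1 := by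
  ext i j
  simp [AutInf.block, AutInf.entry_one, Matrix.one_apply, Fin.ext_iff]

theorem AutInf.IsBlock.block_mul {n : ℕ} {v : AutInf S} (hv : v.IsBlock n) (u : AutInf S) :
    (u * v).block n = u.block n * v.block n := by
  ext i j
  rw [Matrix.mul_apply]
  simp only [AutInf.block, Matrix.of_apply]
  rw [hv.entry_mul u j.2, Finset.sum_range]

theorem AutInf.IsBlock.det_block_add {n : ℕ} {u : AutInf S} (hu : u.IsBlock n) (k : ℕ) :
    (u.block (n + k)).det = (u.block n).det := by
  rw [← Matrix.det_submatrix_equiv_self finSumFinEquiv]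
  have : (u.block (n + k)).submatrix finSumFinEquiv finSumFinEquiv
      = Matrix.fromBlocks (u.block n) 0 0 1 := by
    ext i j
    rcases i with i | i <;> rcases j with j | j <;>
      simp only [AutInf.block, Matrix.submatrix_apply, Matrix.of_apply, finSumFinEquiv_apply_left,
        finSumFinEquiv_apply_right, Matrix.fromBlocks_apply₁₁, Matrix.fromBlocks_apply₁₂,
        Matrix.fromBlocks_apply₂₁, Matrix.fromBlocks_apply₂₂, Matrix.zero_apply,
        Fin.val_castAdd, Fin.val_natAdd]
    · rw [hu _ _ (Or.inr (by omega)), if_neg (by omega)]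
    · rw [hu _ _ (Or.inl (by omega)), if_neg (by omega)]
    · rw [hu _ _ (Or.inr (by omega)), Matrix.one_apply]
      simp [Fin.ext_iff]
  rw [this, Matrix.det_fromBlocks_zero₂₁, Matrix.det_one, mul_one]

theorem AutInf.IsBlock.det_block_eq {n m : ℕ} {u : AutInf S} (hn : u.IsBlock n)
    (hm : u.IsBlock m) : (u.block n).det = (u.block m).det := by
  rcases le_total n m with h | h
  · obtain ⟨k, rfl⟩ := Nat.exists_eq_add_of_le h
    rw [hn.det_block_add]
  · obtain ⟨k, rfl⟩ := Nat.exists_eq_add_of_le h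
    rw [hm.det_block_add]

/-- The determinant on `GL(S)`, as a map to `S`: the determinant of a large enough block. -/
def detAux (u : GLInf S) : S :=
  ((u : AutInf S).block (Classical.choose (GLInf.exists_isBlock u))).det

theorem detAux_eq {n : ℕ} (u : GLInf S) (hu : (u : AutInf S).IsBlock n) :
    detAux u = ((u : AutInf S).block n).det :=
  (Classical.choose_spec (GLInf.exists_isBlock u)).det_block_eq hu

variable (S)

/-- The determinant `GL(S) → Sˣ`. -/
def detInf : GLInf S →* Sˣ :=
  MonoidHom.toHomUnits
    { toFun := detAux
      map_one' := by
        rw [detAux_eq (n := 0) 1 (AutInf.isBlock_one 0)]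
        simp
      map_mul' := by
        intro u v
        obtain ⟨n, hn⟩ := GLInf.exists_isBlock u
        obtain ⟨m, hm⟩ := GLInf.exists_isBlock v
        have hn := hn.mono (le_max_left n m)
        have hm := hm.mono (le_max_right n m)
        rw [detAux_eq u hn, detAux_eq v hm, detAux_eq (u * v) (hn.mul hm), Subgroup.coe_mul,
          hm.block_mul, Matrix.det_mul] }

variable {S}

theorem coe_detInf {n : ℕ} (u : GLInf S) (hu : (u : AutInf S).IsBlock n) :
    (detInf S u : S) = ((u : AutInf S).block n).det := detAux_eq u hu

variable (S)

/-- `SL(S)`, the matrices of determinant `1` in `GL(S)`. -/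
def SLInf : Subgroup (AutInf S) := (detInf S).ker.map (GLInf S).subtype

variable {S}

theorem mem_SLInf {u : AutInf S} : u ∈ SLInf S ↔ ∃ h : u ∈ GLInf S, detInf S ⟨u, h⟩ = 1 := by
  simp only [SLInf, Subgroup.mem_map, MonoidHom.mem_ker, Subgroup.subtype_apply]
  constructor
  · rintro ⟨x, hx, rfl⟩
    exact ⟨x.2, hx⟩
  · rintro ⟨h, hx⟩
    exact ⟨⟨u, h⟩, hx, rfl⟩

theorem SLInf_le_GLInf : SLInf S ≤ GLInf S := fun _ hu => (mem_SLInf.1 hu).1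

end Ambient

/-! ## Base change -/

section BaseChange

variable {S S' S'' : Type*} [CommRing S] [CommRing S'] [CommRing S'']

/-- Applying `φ` to all entries of an endomorphism of `S^(ℕ)`. -/
def endBaseChange (φ : S →+* S') (u : Module.End S (ℕ →₀ S)) : Module.End S' (ℕ →₀ S') :=
  Finsupp.linearCombination S' fun j =>
    Finsupp.mapRange φ φ.map_zero (u (Finsupp.single j 1))

theorem endBaseChange_mapRange (φ : S →+* S') (u : Module.End S (ℕ →₀ S)) (x : ℕ →₀ S) :
    endBaseChange φ u (Finsupp.mapRange φ φ.map_zero x)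
      = Finsupp.mapRange φ φ.map_zero (u x) := by
  induction x using Finsupp.induction_linear with
  | zero => simp
  | add x y hx hy =>
    rw [Finsupp.mapRange_add φ.map_add, map_add, map_add, Finsupp.mapRange_add φ.map_add, hx, hy]
  | single j c =>
    have hc : Finsupp.single j c = c • Finsupp.single j (1 : S) := by simp
    rw [Finsupp.mapRange_single, endBaseChange, Finsupp.linearCombination_single, hc, map_smul]
    ext i
    simp

theorem endBaseChange_unique (φ : S →+* S') {u : Module.End S (ℕ →₀ S)}
    {w : Module.End S' (ℕ →₀ S')}
    (h : ∀ j, w (Finsupp.single j 1) = Finsupp.mapRange φ φ.map_zero (u (Finsupp.single j 1))) :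
    endBaseChange φ u = w := by
  refine Finsupp.lhom_ext' fun j => LinearMap.ext_ring ?_
  simp [endBaseChange, h]

/-- Applying `φ` to all entries, as a monoid homomorphism. -/
def endBaseChangeHom (φ : S →+* S') : Module.End S (ℕ →₀ S) →* Module.End S' (ℕ →₀ S') where
  toFun := endBaseChange φ
  map_one' := endBaseChange_unique φ (by intro j; simp)
  map_mul' u v := endBaseChange_unique φ (by
    intro j
    rw [Module.End.mul_apply, Module.End.mul_apply, ← endBaseChange_mapRange,
      ← endBaseChange_mapRange, Finsupp.mapRange_single, map_one])

/-- Applying a ring homomorphism `φ` to all matrix entries. -/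
def AutInf.map (φ : S →+* S') : AutInf S →* AutInf S' := Units.map (endBaseChangeHom φ)

theorem AutInf.toEnd_map (φ : S →+* S') (u : AutInf S) :
    (AutInf.map φ u).toEnd = endBaseChange φ u.toEnd := rfl

@[simp] theorem AutInf.entry_map (φ : S →+* S') (u : AutInf S) (i j : ℕ) :
    (AutInf.map φ u).entry i j = φ (u.entry i j) := by
  simp [AutInf.entry, AutInf.toEnd_map, endBaseChange]

theorem AutInf.map_id (u : AutInf S) : AutInf.map (RingHom.id S) u = u :=
  AutInf.ext_entry (by simp)

theorem AutInf.map_map (φ : S →+* S') (ψ : S' →+* S'') (u : AutInf S) :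
    AutInf.map ψ (AutInf.map φ u) = AutInf.map (ψ.comp φ) u :=
  AutInf.ext_entry (by simp)

theorem AutInf.IsBlock.map {n : ℕ} {u : AutInf S} (hu : u.IsBlock n) (φ : S →+* S') :
    (AutInf.map φ u).IsBlock n := by
  intro i j hij
  rw [AutInf.entry_map, hu i j hij]
  split_ifs <;> simp

theorem GLInf.map_mem (φ : S →+* S') {u : AutInf S} (hu : u ∈ GLInf S) :
    AutInf.map φ u ∈ GLInf S' := by
  obtain ⟨n, hn, hn'⟩ := hu
  exact ⟨n, hn.map φ, by rw [← map_inv]; exact hn'.map φ⟩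

theorem detInf_map (φ : S →+* S') {u : AutInf S} (hu : u ∈ GLInf S) :
    detInf S' ⟨AutInf.map φ u, GLInf.map_mem φ hu⟩ = Units.map (φ : S →* S') (detInf S ⟨u, hu⟩) := by
  obtain ⟨n, hn⟩ := GLInf.exists_isBlock ⟨u, hu⟩
  ext
  rw [coe_detInf (n := n) _ (hn.map φ), Units.coe_map, coe_detInf (n := n) _ hn,
    MonoidHom.coe_coe, RingHom.map_det]
  congr 1
  ext i j
  simp [AutInf.block]

theorem SLInf.map_mem (φ : S →+* S') {u : AutInf S} (hu : u ∈ SLInf S) :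
    AutInf.map φ u ∈ SLInf S' := by
  obtain ⟨h, h1⟩ := mem_SLInf.1 hu
  exact mem_SLInf.2 ⟨GLInf.map_mem φ h, by rw [detInf_map φ h, h1, map_one]⟩

variable {G : Type*} [Group G] [MulSemiringAction G S]

/-- `G` acts on matrices through its action on the entries. -/
instance : MulDistribMulAction G (AutInf S) where
  smul g u := AutInf.map (MulSemiringAction.toRingHom G S g) u
  one_smul u := AutInf.ext_entry fun i j => by
    change (AutInf.map _ u).entry i j = _
    simp
  mul_smul g h u := AutInf.ext_entry fun i j => by
    change (AutInf.map _ u).entry i j = (AutInf.map _ (AutInf.map _ u)).entry i j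
    simp [mul_smul]
  smul_one g := map_one _
  smul_mul g u v := map_mul _ u v

theorem AutInf.smul_def (g : G) (u : AutInf S) :
    g • u = AutInf.map (MulSemiringAction.toRingHom G S g) u := rfl

@[simp] theorem AutInf.entry_smul (g : G) (u : AutInf S) (i j : ℕ) :
    (g • u).entry i j = g • u.entry i j := by
  simp [AutInf.smul_def]

/-- `G` acts on the unit group `Sˣ`. -/
instance unitsAction : MulDistribMulAction G Sˣ := Units.mulDistribMulActionRight

@[simp] theorem coe_unitsAction (g : G) (x : Sˣ) : ((g • x : Sˣ) : S) = g • (x : S) := rfl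

end BaseChange

/-! ## Placing a matrix along an injection of index sets -/

section Place

variable {S S' : Type*} [CommRing S] [CommRing S']

/-- The endomorphism of `S^(ℕ)` that is `u` on the basis vectors `e_{ι 0}, e_{ι 1}, …` and the
identity on the other basis vectors. -/
def endPlace (ι : ℕ ↪ ℕ) : Module.End S (ℕ →₀ S) →* Module.End S (ℕ →₀ S) where
  toFun u := 1 + Finsupp.lmapDomain S S ι ∘ₗ (u - 1) ∘ₗ Finsupp.lcomapDomain ι ι.injective
  map_one' := LinearMap.ext fun x => by simp [LinearMap.sub_apply]
  map_mul' u v := by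
    have h : ∀ x : ℕ →₀ S, Finsupp.lcomapDomain (R := S) ι ι.injective
        (Finsupp.lmapDomain S S ι x) = x := fun x =>
      Finsupp.leftInverse_lcomapDomain_mapDomain (R := S) ι ι.injective x
    refine LinearMap.ext fun x => ?_
    simp only [Module.End.mul_apply, LinearMap.add_apply, LinearMap.comp_apply,
      LinearMap.sub_apply, Module.End.one_apply, map_add, map_sub, h]
    abel

/-- Place the matrix `u` along the injection `ι`: the `(ι i, ι j)`-entry is the `(i, j)`-entry of
`u`, all other entries are those of the identity matrix. -/
def AutInf.place (ι : ℕ ↪ ℕ) : AutInf S →* AutInf S := Units.map (endPlace ι)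

theorem AutInf.toEnd_place (ι : ℕ ↪ ℕ) (u : AutInf S) (x : ℕ →₀ S) :
    (AutInf.place ι u).toEnd x = x + Finsupp.mapDomain ι
      (u.toEnd (Finsupp.comapDomain ι x ι.injective.injOn)
        - Finsupp.comapDomain ι x ι.injective.injOn) := rfl

theorem AutInf.place_single (ι : ℕ ↪ ℕ) (u : AutInf S) (j : ℕ) :
    (AutInf.place ι u).toEnd (Finsupp.single (ι j) 1)
      = Finsupp.mapDomain ι (u.toEnd (Finsupp.single j 1)) := by
  rw [AutInf.toEnd_place, Finsupp.comapDomain_single, sub_eq_add_neg, Finsupp.mapDomain_add,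
    ← sub_eq_zero]
  have : Finsupp.mapDomain ι (-Finsupp.single j (1 : S)) = -Finsupp.single (ι j) 1 := by
    rw [← Finsupp.single_neg, Finsupp.mapDomain_single, Finsupp.single_neg]
  rw [this]; abel

theorem AutInf.place_single_of_notMem (ι : ℕ ↪ ℕ) (u : AutInf S) {j : ℕ}
    (hj : j ∉ Set.range ι) :
    (AutInf.place ι u).toEnd (Finsupp.single j 1) = Finsupp.single j 1 := by
  have : Finsupp.comapDomain ι (Finsupp.single j (1 : S)) ι.injective.injOn = 0 := by
    ext i
    rw [Finsupp.comapDomain_apply, Finsupp.single_apply, if_neg (fun h => hj ⟨i, h.symm⟩)]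
    rfl
  rw [AutInf.toEnd_place, this]
  simp

theorem AutInf.entry_place (ι : ℕ ↪ ℕ) (u : AutInf S) (i j : ℕ) :
    (AutInf.place ι u).entry (ι i) (ι j) = u.entry i j := by
  rw [AutInf.entry, AutInf.place_single, Finsupp.mapDomain_apply ι.injective]; rfl

theorem AutInf.entry_place_of_notMem (ι : ℕ ↪ ℕ) (u : AutInf S) {i j : ℕ}
    (h : i ∉ Set.range ι ∨ j ∉ Set.range ι) :
    (AutInf.place ι u).entry i j = if i = j then 1 else 0 := by
  by_cases hj : j ∈ Set.range ι
  · have hi : i ∉ Set.range ι := by tauto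
    obtain ⟨j, rfl⟩ := hj
    rw [AutInf.entry, AutInf.place_single, Finsupp.mapDomain_of_notMem_range _ _ hi, if_neg]
    rintro rfl
    exact hi ⟨j, rfl⟩
  · rw [AutInf.entry, AutInf.place_single_of_notMem ι u hj, Finsupp.single_apply]
    simp [eq_comm]

/-- A matrix `w` with the entries of `place ι u` is `place ι u`. -/
theorem AutInf.place_eq (ι : ℕ ↪ ℕ) (u w : AutInf S)
    (h1 : ∀ i j, w.entry (ι i) (ι j) = u.entry i j)
    (h2 : ∀ i j, i ∉ Set.range ι ∨ j ∉ Set.range ι → w.entry i j = if i = j then 1 else 0) :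
    AutInf.place ι u = w := by
  refine AutInf.ext_entry fun i j => ?_
  by_cases h : i ∉ Set.range ι ∨ j ∉ Set.range ι
  · rw [AutInf.entry_place_of_notMem ι u h, h2 i j h]
  · push Not at h
    obtain ⟨⟨i, rfl⟩, ⟨j, rfl⟩⟩ := h
    rw [AutInf.entry_place, h1]

theorem AutInf.place_place (ι κ : ℕ ↪ ℕ) (u : AutInf S) :
    AutInf.place ι (AutInf.place κ u) = AutInf.place (κ.trans ι) u := by
  symm
  refine AutInf.place_eq _ _ _ (fun i j => ?_) (fun i j h => ?_)
  · simp only [Function.Embedding.trans_apply]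
    rw [AutInf.entry_place, AutInf.entry_place]
  · by_cases h' : i ∉ Set.range ι ∨ j ∉ Set.range ι
    · rw [AutInf.entry_place_of_notMem ι _ h']
    · push Not at h'
      obtain ⟨⟨i, rfl⟩, ⟨j, rfl⟩⟩ := h'
      rw [AutInf.entry_place, AutInf.entry_place_of_notMem κ u]
      · simp
      · refine h.imp (fun h => ?_) (fun h => ?_)
        · rintro ⟨a, rfl⟩; exact h ⟨a, rfl⟩
        · rintro ⟨a, rfl⟩; exact h ⟨a, rfl⟩

theorem AutInf.map_place (φ : S →+* S') (ι : ℕ ↪ ℕ) (u : AutInf S) :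
    AutInf.map φ (AutInf.place ι u) = AutInf.place ι (AutInf.map φ u) := by
  symm
  refine AutInf.place_eq _ _ _ (fun i j => ?_) (fun i j h => ?_)
  · rw [AutInf.entry_map, AutInf.entry_place, AutInf.entry_map]
  · rw [AutInf.entry_map, AutInf.entry_place_of_notMem ι u h]
    split_ifs <;> simp

theorem AutInf.smul_place {G : Type*} [Group G] [MulSemiringAction G S] (g : G) (ι : ℕ ↪ ℕ)
    (u : AutInf S) : g • AutInf.place ι u = AutInf.place ι (g • u) :=
  AutInf.map_place _ ι u

/-- Matrices placed along injections with disjoint images commute. -/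
theorem AutInf.place_commute {ι κ : ℕ ↪ ℕ} (h : ∀ i j, ι i ≠ κ j) (u v : AutInf S) :
    Commute (AutInf.place ι u) (AutInf.place κ v) := by
  apply AutInf.toEnd_injective
  have key : ∀ (ι κ : ℕ ↪ ℕ) (_ : ∀ i j, ι i ≠ κ j) (x : ℕ →₀ S),
      Finsupp.comapDomain κ (Finsupp.mapDomain ι x) κ.injective.injOn = 0 := by
    intro ι κ h x
    ext i
    rw [Finsupp.comapDomain_apply, Finsupp.mapDomain_of_notMem_range]
    · rfl
    · rintro ⟨a, ha⟩; exact h a i ha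
  have hadd : ∀ (κ : ℕ ↪ ℕ) (x y : ℕ →₀ S),
      Finsupp.comapDomain κ (x + y) κ.injective.injOn
        = Finsupp.comapDomain κ x κ.injective.injOn
          + Finsupp.comapDomain κ y κ.injective.injOn := by
    intro κ x y; ext; simp
  refine LinearMap.ext fun x => ?_
  simp only [map_mul, Module.End.mul_apply, AutInf.toEnd_place, hadd,
    key ι κ h, key κ ι (fun i j => (h j i).symm), add_zero]
  abel

theorem AutInf.place_congr {n : ℕ} {u : AutInf S} (hu : u.IsBlock n) {ι κ : ℕ ↪ ℕ}
    (h : ∀ i < n, ι i = κ i) : AutInf.place ι u = AutInf.place κ u := by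
  have key : ∀ {ι κ : ℕ ↪ ℕ} (_ : ∀ i < n, ι i = κ i) (i j : ℕ),
      (AutInf.place ι u).entry (κ i) (κ j) = u.entry i j := by
    intro ι κ h i j
    by_cases hij : n ≤ i ∨ n ≤ j
    · rw [hu i j hij]
      by_cases h1 : κ i ∈ Set.range ι ∧ κ j ∈ Set.range ι
      · obtain ⟨⟨a, ha⟩, ⟨b, hb⟩⟩ := h1
        rw [← ha, ← hb, AutInf.entry_place, hu a b]
        · have : a = b ↔ i = j := by
            rw [← ι.injective.eq_iff, ha, hb, κ.injective.eq_iff]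
          simp [this]
        · have : ∀ {a i : ℕ}, ι a = κ i → a < n → i < n := by
            intro a i hai han
            rw [h a han] at hai
            rwa [← κ.injective hai]
          rcases hij with hi | hj
          · exact Or.inl (by by_contra hc; exact absurd (this ha (by omega)) (by omega))
          · exact Or.inr (by by_contra hc; exact absurd (this hb (by omega)) (by omega))
      · rw [AutInf.entry_place_of_notMem ι u (by tauto)]
        simp
    · rw [← h i (by omega), ← h j (by omega), AutInf.entry_place]
  refine (AutInf.place_eq _ _ _ (key fun i hi => (h i hi)) ?_).symm
  intro i j hij
  by_cases h1 : i ∈ Set.range ι ∧ j ∈ Set.range ι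
  · obtain ⟨⟨a, rfl⟩, ⟨b, rfl⟩⟩ := h1
    rw [AutInf.entry_place, hu a b]
    · simp
    · refine hij.imp (fun hi => ?_) (fun hj => ?_)
      · by_contra hc; exact hi ⟨a, (h a (by omega)).symm⟩
      · by_contra hc; exact hj ⟨b, (h b (by omega)).symm⟩
  · rw [AutInf.entry_place_of_notMem ι u (by tauto)]

end Place

/-! ## Permutation matrices -/

section Perm

variable (S : Type*) [CommRing S]

/-- The permutation matrix `e_i ↦ e_{τ i}`. -/
def permMat : Equiv.Perm ℕ →* AutInf S :=
  MonoidHom.toHomUnits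
    { toFun := fun τ => Finsupp.lmapDomain S S τ
      map_one' := by
        refine Finsupp.lhom_ext' fun j => LinearMap.ext_ring ?_
        simp
      map_mul' := by
        intro σ τ
        refine Finsupp.lhom_ext' fun j => LinearMap.ext_ring ?_
        simp }

variable {S}

theorem permMat_single (τ : Equiv.Perm ℕ) (j : ℕ) :
    (permMat S τ).toEnd (Finsupp.single j 1) = Finsupp.single (τ j) 1 :=
  Finsupp.mapDomain_single

theorem entry_permMat (τ : Equiv.Perm ℕ) (i j : ℕ) :
    (permMat S τ).entry i j = if i = τ j then 1 else 0 := by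
  rw [AutInf.entry, permMat_single, Finsupp.single_apply]; simp [eq_comm]

/-- `τ` moves only finitely many points. -/
def FinSupp (τ : Equiv.Perm ℕ) : Prop := ∃ n, ∀ i, n ≤ i → τ i = i

theorem FinSupp.inv {τ : Equiv.Perm ℕ} (h : FinSupp τ) : FinSupp τ⁻¹ := by
  obtain ⟨n, hn⟩ := h
  exact ⟨n, fun i hi => by rw [Equiv.Perm.inv_eq_iff_eq, hn i hi]⟩

theorem permMat_isBlock {τ : Equiv.Perm ℕ} {n : ℕ} (hn : ∀ i, n ≤ i → τ i = i) :
    (permMat S τ).IsBlock n := by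
  intro i j hij
  rw [entry_permMat]
  congr 1
  rcases hij with hi | hj
  · rw [eq_iff_iff]
    constructor
    · intro h; exact τ.injective ((hn i hi).trans h)
    · rintro rfl; exact (hn i hi).symm
  · rw [hn j hj]

theorem permMat_mem_GLInf {τ : Equiv.Perm ℕ} (h : FinSupp τ) : permMat S τ ∈ GLInf S := by
  obtain ⟨n, hn⟩ := h
  refine ⟨n, permMat_isBlock hn, ?_⟩
  rw [← map_inv]
  exact permMat_isBlock fun i hi => by rw [Equiv.Perm.inv_eq_iff_eq, hn i hi]

theorem smul_permMat {G : Type*} [Group G] [MulSemiringAction G S] (g : G) (τ : Equiv.Perm ℕ) :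
    g • permMat S τ = permMat S τ := by
  refine AutInf.ext_entry fun i j => ?_
  rw [AutInf.entry_smul, entry_permMat]
  split_ifs <;> simp

/-- Conjugation by a permutation matrix permutes rows and columns. -/
theorem permMat_conj (τ : Equiv.Perm ℕ) (u : AutInf S) :
    permMat S τ * u * (permMat S τ)⁻¹ = AutInf.place τ.toEmbedding u := by
  rw [mul_inv_eq_iff_eq_mul]
  apply AutInf.toEnd_injective
  refine Finsupp.lhom_ext' fun j => LinearMap.ext_ring ?_
  have := AutInf.place_single τ.toEmbedding u j
  simp only [Equiv.coe_toEmbedding] at this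
  simp only [map_mul, LinearMap.comp_apply, Module.End.mul_apply, Finsupp.lsingle_apply,
    permMat_single, this]
  rfl

/-- Every injection agrees, on a given finite set, with a commutator of finitely supported
permutations. -/
theorem exists_commutator (ι : ℕ ↪ ℕ) (n : ℕ) :
    ∃ σ τ : Equiv.Perm ℕ, FinSupp σ ∧ FinSupp τ ∧ ∀ i < n, (σ * τ * σ⁻¹ * τ⁻¹) i = ι i := by
  obtain ⟨N, hN, hnN⟩ : ∃ N, (∀ i < n, ι i < N) ∧ n ≤ N := by
    refine ⟨n + (∑ i ∈ Finset.range n, ι i) + 1, fun i hi => ?_, by omega⟩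
    have := Finset.single_le_sum (f := fun i => ι i) (fun _ _ => Nat.zero_le _)
      (Finset.mem_range.2 hi)
    omega
  obtain ⟨ρ, hρ⟩ := Equiv.Perm.exists_extending_pair (β := Fin N)
    (fun i : Fin n => (⟨i, by omega⟩ : Fin N)) (fun i : Fin n => ⟨ι i, hN i i.2⟩)
    (fun i j h => by simpa [Fin.ext_iff] using h)
    (fun i j h => by simpa [Fin.ext_iff] using h)
  let σ : Equiv.Perm ℕ := ρ.extendDomain Fin.equivSubtype
  have hσ1 : ∀ i, N ≤ i → σ i = i := fun i hi =>
    Equiv.Perm.extendDomain_apply_not_subtype _ _ (by omega)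
  have hσ2 : ∀ i < n, σ i = ι i := by
    intro i hi
    have h1 := Equiv.Perm.extendDomain_apply_image ρ Fin.equivSubtype (⟨i, by omega⟩ : Fin N)
    have h2 := hρ ⟨i, hi⟩
    simp only at h2
    rw [h2] at h1
    exact h1
  have hinv : Function.Involutive
      (fun i => if i < N then i + N else if i < 2 * N then i - N else i) := by
    intro i
    dsimp only
    split_ifs <;> omega
  let τ : Equiv.Perm ℕ := hinv.toPerm
  have hτ : ∀ i, τ i = if i < N then i + N else if i < 2 * N then i - N else i := fun _ => rfl
  have hτ' : ∀ i, τ⁻¹ i = τ i := fun i => rfl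
  refine ⟨σ, τ, ⟨N, hσ1⟩, ⟨2 * N, fun i hi => ?_⟩, fun i hi => ?_⟩
  · rw [hτ, if_neg (by omega), if_neg (by omega)]
  · have hiN : i < N := by omega
    rw [Equiv.Perm.mul_apply, Equiv.Perm.mul_apply, Equiv.Perm.mul_apply,
      hτ', hτ i, if_pos hiN]
    have : σ⁻¹ (i + N) = i + N := by
      rw [Equiv.Perm.inv_eq_iff_eq, hσ1 _ (by omega)]
    rw [this, hτ, if_neg (by omega), if_pos (by omega), Nat.add_sub_cancel, hσ2 i hi]

end Perm

/-! ## The commutative monoid `H¹(G, X)` for suitable subgroups `X` of `GL(S)` -/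

section Monoid

variable {S : Type*} [CommRing S]

/-- The subgroups `X` of `GL(S)` for which `H¹(G, X)` is a monoid: `X` is stable under `G` and
contains the even permutation matrices (these are the products of commutators of finitely
supported permutation matrices). -/
class IsAdmissible (G : Type*) [Group G] [MulSemiringAction G S] (X : Subgroup (AutInf S)) :
    Prop where
  le_GLInf : X ≤ GLInf S
  smul_mem : ∀ (g : G) {u : AutInf S}, u ∈ X → g • u ∈ X
  perm_mem : ∀ {σ τ : Equiv.Perm ℕ}, FinSupp σ → FinSupp τ → permMat S (σ * τ * σ⁻¹ * τ⁻¹) ∈ X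

variable {G : Type*} [Group G] [MulSemiringAction G S]

instance : IsAdmissible G (GLInf S) where
  le_GLInf := le_rfl
  smul_mem g _ hu := GLInf.map_mem _ hu
  perm_mem hσ hτ := by
    simp only [map_mul, map_inv]
    exact mul_mem (mul_mem (mul_mem (permMat_mem_GLInf hσ) (permMat_mem_GLInf hτ))
      (inv_mem (permMat_mem_GLInf hσ))) (inv_mem (permMat_mem_GLInf hτ))

instance : IsAdmissible G (SLInf S) where
  le_GLInf := SLInf_le_GLInf
  smul_mem g _ hu := SLInf.map_mem _ hu
  perm_mem {σ τ} hσ hτ := by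
    let a : GLInf S := ⟨_, permMat_mem_GLInf hσ⟩
    let b : GLInf S := ⟨_, permMat_mem_GLInf hτ⟩
    have h1 : permMat S (σ * τ * σ⁻¹ * τ⁻¹) = ((a * b * a⁻¹ * b⁻¹ : GLInf S) : AutInf S) := by
      simp only [map_mul, map_inv]; rfl
    rw [h1, mem_SLInf]
    refine ⟨Subtype.property _, ?_⟩
    change detInf S (a * b * a⁻¹ * b⁻¹) = 1
    rw [map_mul, map_mul, map_mul, map_inv, map_inv, mul_comm (detInf S a), mul_inv_cancel_right,
      mul_inv_cancel]

variable {X : Subgroup (AutInf S)} [IsAdmissible G X]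

instance : MulDistribMulAction G X where
  smul g u := ⟨g • (u : AutInf S), IsAdmissible.smul_mem g u.2⟩
  one_smul _ := Subtype.ext (one_smul _ _)
  mul_smul _ _ _ := Subtype.ext (mul_smul _ _ _)
  smul_one _ := Subtype.ext (smul_one _)
  smul_mul _ _ _ := Subtype.ext (smul_mul' _ _ _)

@[simp] theorem coe_smul_subgroup (g : G) (u : X) :
    ((g • u : X) : AutInf S) = g • (u : AutInf S) := rfl

theorem place_mem (G : Type*) [Group G] [MulSemiringAction G S] [IsAdmissible G X]
    (ι : ℕ ↪ ℕ) {u : AutInf S} (hu : u ∈ X) : AutInf.place ι u ∈ X := by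
  obtain ⟨n, hn, _⟩ := IsAdmissible.le_GLInf (G := G) hu
  obtain ⟨σ, τ, hσ, hτ, h⟩ := exists_commutator ι n
  have hP : permMat S (σ * τ * σ⁻¹ * τ⁻¹) ∈ X := IsAdmissible.perm_mem (G := G) hσ hτ
  rw [AutInf.place_congr hn (κ := Equiv.toEmbedding (σ * τ * σ⁻¹ * τ⁻¹)) (fun i hi => (h i hi).symm),
    ← permMat_conj]
  exact mul_mem (mul_mem hP hu) (inv_mem hP)

/-- The cocycle `g ↦ place ι (d g)`. -/
def Cocycle.place (ι : ℕ ↪ ℕ) (d : Cocycle G X) : Cocycle G X where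
  toFun g := ⟨AutInf.place ι (d g), place_mem G ι (d g).2⟩
  map_mul' g h := Subtype.ext (by
    simp only [d.map_mul', Subgroup.coe_mul, coe_smul_subgroup, map_mul, AutInf.smul_place])

@[simp] theorem Cocycle.coe_place (ι : ℕ ↪ ℕ) (d : Cocycle G X) (g : G) :
    ((d.place ι g : X) : AutInf S) = AutInf.place ι (d g : AutInf S) := rfl

/-- A cocycle of a finite group takes values in a fixed `GLₙ(S)`. -/
theorem Cocycle.exists_isBlock [Finite G] (d : Cocycle G X) :
    ∃ n, ∀ g, (d g : AutInf S).IsBlock n := by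
  have h : ∀ g, ∃ n, (d g : AutInf S).IsBlock n := fun g =>
    GLInf.exists_isBlock ⟨_, IsAdmissible.le_GLInf (G := G) (d g).2⟩
  choose n hn using h
  obtain ⟨N, hN⟩ := (Set.finite_range n).bddAbove
  exact ⟨N, fun g => (hn g).mono (hN ⟨g, rfl⟩)⟩

theorem H1.mk_place [Finite G] (ι : ℕ ↪ ℕ) (d : Cocycle G X) :
    H1.mk (d.place ι) = H1.mk d := by
  obtain ⟨n, hn⟩ := d.exists_isBlock
  obtain ⟨σ, τ, hσ, hτ, h⟩ := exists_commutator ι n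
  refine H1.mk_eq_mk.2 ⟨⟨permMat S (σ * τ * σ⁻¹ * τ⁻¹), IsAdmissible.perm_mem (G := G) hσ hτ⟩, fun g => ?_⟩
  apply Subtype.ext
  simp only [Cocycle.coe_place, Subgroup.coe_mul, coe_smul_subgroup, smul_permMat,
    Subgroup.coe_inv]
  rw [permMat_conj]
  exact AutInf.place_congr (hn g) fun i hi => (h i hi).symm

/-- For injections `ι`, `κ` with disjoint images, the cocycle that is `d` along `ι` and `e`
along `κ`. -/
def Cocycle.blockSum (ι κ : ℕ ↪ ℕ) (h : ∀ i j, ι i ≠ κ j) (d e : Cocycle G X) : Cocycle G X where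
  toFun g := d.place ι g * e.place κ g
  map_mul' g k := by
    rw [(d.place ι).map_mul', (e.place κ).map_mul', smul_mul']
    have := AutInf.place_commute h (d k : AutInf S) ((k⁻¹ • e g : X) : AutInf S)
    apply Subtype.ext
    simp only [Subgroup.coe_mul, coe_smul_subgroup, Cocycle.coe_place, AutInf.smul_place] at this ⊢
    rw [mul_assoc, ← mul_assoc (AutInf.place ι (d k : AutInf S)), this.eq]
    simp only [mul_assoc]

@[simp] theorem Cocycle.coe_blockSum (ι κ : ℕ ↪ ℕ) (h : ∀ i j, ι i ≠ κ j) (d e : Cocycle G X)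
    (g : G) : ((d.blockSum ι κ h e g : X) : AutInf S)
      = AutInf.place ι (d g : AutInf S) * AutInf.place κ (e g : AutInf S) := rfl

/-- `i ↦ 2 i` -/
def evenEmb : ℕ ↪ ℕ := ⟨fun i => 2 * i, fun i j h => by simp only at h; omega⟩
/-- `i ↦ 2 i + 1` -/
def oddEmb : ℕ ↪ ℕ := ⟨fun i => 2 * i + 1, fun i j h => by simp only at h; omega⟩
/-- `i ↦ m + i` -/
def shiftEmb (m : ℕ) : ℕ ↪ ℕ := ⟨fun i => m + i, fun i j h => by simp only at h; omega⟩

@[simp] theorem evenEmb_apply (i : ℕ) : evenEmb i = 2 * i := rfl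
@[simp] theorem oddEmb_apply (i : ℕ) : oddEmb i = 2 * i + 1 := rfl
@[simp] theorem shiftEmb_apply (m i : ℕ) : shiftEmb m i = m + i := rfl

theorem even_ne_odd (i j : ℕ) : evenEmb i ≠ oddEmb j := by
  rw [evenEmb_apply, oddEmb_apply]; omega

/-- The block sum of two cocycles, with the first on the even and the second on the odd basis
vectors. Up to cohomology this is `d(g) ⊕ e(g) = diag(d(g), e(g), 1, 1, …)`, see `H1.mk_add_mk`. -/
def Cocycle.sum (d e : Cocycle G X) : Cocycle G X := d.blockSum evenEmb oddEmb even_ne_odd e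

theorem Cocycle.coe_sum (d e : Cocycle G X) (g : G) : ((d.sum e g : X) : AutInf S)
      = AutInf.place evenEmb (d g : AutInf S) * AutInf.place oddEmb (e g : AutInf S) := rfl

/-- The addition of `H¹(G, X)`, induced by the block sum of matrices. -/
instance : Add (H1 G X) where
  add := Quotient.map₂ Cocycle.sum (by
    rintro d d' ⟨x, hx⟩ e e' ⟨y, hy⟩
    refine ⟨⟨AutInf.place evenEmb x, place_mem G _ x.2⟩ * ⟨AutInf.place oddEmb y,
      place_mem G _ y.2⟩, fun g => ?_⟩
    have c1 := AutInf.place_commute even_ne_odd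
      ((d' g : AutInf S) * (x : AutInf S)⁻¹) (g⁻¹ • (y : AutInf S))
    have c2 := AutInf.place_commute even_ne_odd
      ((x : AutInf S)⁻¹) ((e' g : AutInf S) * (y : AutInf S)⁻¹)
    apply Subtype.ext
    simp only [Cocycle.coe_sum, hx, hy, Subgroup.coe_mul, coe_smul_subgroup, Subgroup.coe_inv,
      smul_mul', AutInf.smul_place, mul_inv_rev]
    rw [mul_assoc (g⁻¹ • (x : AutInf S)), map_mul _ (g⁻¹ • (x : AutInf S)),
      mul_assoc (g⁻¹ • (y : AutInf S)), map_mul _ (g⁻¹ • (y : AutInf S)), mul_assoc,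
      ← mul_assoc (AutInf.place evenEmb (_ * _)), c1.eq]
    rw [map_mul _ (d' g : AutInf S), mul_assoc, mul_assoc, c2.eq]
    simp only [map_mul, map_inv, mul_assoc])

theorem H1.mk_sum (d e : Cocycle G X) : H1.mk (d.sum e) = H1.mk d + H1.mk e := rfl

/-- The neutral element is the class of the unit cocycle. -/
instance : Zero (H1 G X) := ⟨H1.mk 1⟩

theorem H1.zero_def : (0 : H1 G X) = H1.mk 1 := rfl

/-- If `place ι` carries the block sum of `d` and `e` to `f`, then `[d] + [e] = [f]`. -/
theorem H1.add_eq_of_place [Finite G] (ι : ℕ ↪ ℕ) {d e f : Cocycle G X}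
    (h : ∀ g, AutInf.place (evenEmb.trans ι) (d g : AutInf S)
      * AutInf.place (oddEmb.trans ι) (e g : AutInf S) = f g) :
    H1.mk d + H1.mk e = H1.mk f := by
  rw [← H1.mk_sum, ← H1.mk_place ι (d.sum e)]
  congr 1
  ext g : 2
  apply Subtype.ext
  rw [Cocycle.coe_place, Cocycle.coe_sum, map_mul, AutInf.place_place, AutInf.place_place, h]

/-- If `d` has values in `GLₘ(S)`, then `[d] + [e]` is the class of
`g ↦ diag(d(g), e(g), 1, 1, …)`, where `d(g)` fills the first `m` rows and columns. -/
theorem H1.mk_add_mk [Finite G] (m : ℕ) (d e f : Cocycle G X)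
    (hd : ∀ g, (d g : AutInf S).IsBlock m)
    (hf : ∀ g, (f g : AutInf S) = (d g : AutInf S) * AutInf.place (shiftEmb m) (e g : AutInf S)) :
    H1.mk d + H1.mk e = H1.mk f := by
  obtain ⟨n, hn⟩ := e.exists_isBlock
  have hinj : Function.Injective (fun k : ℕ =>
      if k % 2 = 0 then (if k / 2 < m then k / 2 else k + m + n)
      else (if k / 2 < n then m + k / 2 else k + m + n)) := by
    intro a b hab
    simp only at hab
    split_ifs at hab <;> omega
  refine H1.add_eq_of_place ⟨_, hinj⟩ fun g => ?_
  rw [hf]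
  congr 1
  · have hid : AutInf.place (Function.Embedding.refl ℕ) (d g : AutInf S) = d g :=
      AutInf.place_eq _ _ _ (fun _ _ => rfl) (fun i j h => by simp at h)
    conv_rhs => rw [← hid]
    refine AutInf.place_congr (hd g) fun i hi => ?_
    simp [hi]
  · refine AutInf.place_congr (hn g) fun i hi => ?_
    have h1 : (2 * i + 1) % 2 ≠ 0 := by omega
    have h2 : (2 * i + 1) / 2 = i := by omega
    simp only [oddEmb_apply, shiftEmb_apply, Function.Embedding.trans_apply, Function.Embedding.coeFn_mk,
      if_neg h1, h2, if_pos hi]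

theorem H1.add_comm' [Finite G] (a b : H1 G X) : a + b = b + a := by
  induction a using H1.ind with | _ d =>
  induction b using H1.ind with | _ e =>
  have hinj : Function.Injective (fun k : ℕ => if k % 2 = 0 then k + 1 else k - 1) := by
    intro a b hab
    simp only at hab
    split_ifs at hab <;> omega
  have h1 : evenEmb.trans ⟨_, hinj⟩ = oddEmb := by
    ext i
    simp only [evenEmb_apply, oddEmb_apply, Function.Embedding.trans_apply, Function.Embedding.coeFn_mk]
    split_ifs <;> omega
  have h2 : oddEmb.trans ⟨_, hinj⟩ = evenEmb := by
    ext i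
    simp only [evenEmb_apply, oddEmb_apply, Function.Embedding.trans_apply, Function.Embedding.coeFn_mk]
    split_ifs <;> omega
  rw [← H1.mk_sum e d]
  refine H1.add_eq_of_place ⟨_, hinj⟩ fun g => ?_
  rw [h1, h2, Cocycle.coe_sum]
  exact (AutInf.place_commute even_ne_odd _ _).eq.symm

theorem H1.add_assoc' [Finite G] (a b c : H1 G X) : a + b + c = a + (b + c) := by
  induction a using H1.ind with | _ d =>
  induction b using H1.ind with | _ e =>
  induction c using H1.ind with | _ f =>
  have hinj : Function.Injective (fun k : ℕ =>
      if k % 4 = 0 then k / 2 else if k % 4 = 2 then k - 1 else 2 * k + 1) := by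
    intro a b hab
    simp only at hab
    split_ifs at hab <;> omega
  have h1 : evenEmb.trans (evenEmb.trans ⟨_, hinj⟩) = evenEmb := by
    ext i
    simp only [evenEmb_apply, Function.Embedding.trans_apply, Function.Embedding.coeFn_mk]
    split_ifs <;> omega
  have h2 : oddEmb.trans (evenEmb.trans ⟨_, hinj⟩) = evenEmb.trans oddEmb := by
    ext i
    simp only [evenEmb_apply, oddEmb_apply, Function.Embedding.trans_apply, Function.Embedding.coeFn_mk]
    split_ifs <;> omega
  have h3 : oddEmb.trans ⟨_, hinj⟩ = oddEmb.trans oddEmb := by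
    ext i
    simp only [oddEmb_apply, Function.Embedding.trans_apply, Function.Embedding.coeFn_mk]
    split_ifs <;> omega
  rw [← H1.mk_sum d e, ← H1.mk_sum e f, ← H1.mk_sum d]
  refine H1.add_eq_of_place ⟨_, hinj⟩ fun g => ?_
  simp only [Cocycle.coe_sum, map_mul, AutInf.place_place, h1, h2, h3, mul_assoc]

theorem H1.add_zero' [Finite G] (a : H1 G X) : a + 0 = a := by
  induction a using H1.ind with | _ d =>
  rw [H1.zero_def, ← H1.mk_sum]
  conv_rhs => rw [← H1.mk_place evenEmb d]
  congr 1
  ext g : 2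
  apply Subtype.ext
  rw [Cocycle.coe_sum, Cocycle.coe_place, Cocycle.one_apply, Subgroup.coe_one, map_one, mul_one]

/-- The commutative monoid `H¹(G, X)`, for a finite group `G`. -/
instance [Finite G] : AddCommMonoid (H1 G X) where
  add_assoc := H1.add_assoc'
  zero_add a := by rw [H1.add_comm', H1.add_zero']
  add_zero := H1.add_zero'
  add_comm := H1.add_comm'
  nsmul := nsmulRec

variable {S' G' : Type*} [CommRing S'] [Group G'] [MulSemiringAction G' S']
  {X' : Subgroup (AutInf S')} [IsAdmissible G' X']

/-- The monoid homomorphism `H¹(G, X) → H¹(G', X')` induced by a group homomorphism `α : G' → G`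
and a ring homomorphism `φ : S → S'` that is compatible with the actions and whose application to
matrix entries maps `X` to `X'`. -/
def H1.mapHom [Finite G] [Finite G'] (α : G' →* G) (φ : S →+* S')
    (hφ : ∀ (g : G') (s : S), φ (α g • s) = g • φ s)
    (hX : ∀ u ∈ X, AutInf.map φ u ∈ X') : H1 G X →+ H1 G' X' where
  toFun := H1.map α (((AutInf.map φ).comp X.subtype).codRestrict X' (fun u => hX _ u.2)) (by
    intro g u
    apply Subtype.ext
    refine AutInf.ext_entry fun i j => ?_
    simp [hφ])
  map_zero' := by
    rw [H1.zero_def, H1.map_mk, H1.zero_def]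
    congr 1
    ext g : 2
    exact map_one _
  map_add' a b := by
    induction a using H1.ind with | _ d =>
    induction b using H1.ind with | _ e =>
    rw [← H1.mk_sum, H1.map_mk, H1.map_mk, H1.map_mk, ← H1.mk_sum]
    congr 1
    ext g : 2
    apply Subtype.ext
    simp [Cocycle.map, Cocycle.coe_sum, AutInf.map_place]

end Monoid

/-! ## The determinant on cohomology -/

section Det

variable {S : Type*} [CommRing S] {G : Type*} [Group G] [MulSemiringAction G S]

theorem detInf_smul (g : G) (u : GLInf S) : detInf S (g • u) = g • detInf S u := by
  have := detInf_map (MulSemiringAction.toRingHom G S g) u.2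
  ext
  exact congrArg Units.val this

/-- The map `H¹(G, GL(S)) → H¹(G, Sˣ)` induced by the determinant. -/
def detH1 : H1 G (GLInf S) → H1 G Sˣ := H1.map (MonoidHom.id G) (detInf S) detInf_smul

/-- The map `H¹(G, SL(S)) → H¹(G, GL(S))` induced by the inclusion. -/
def inclH1 : H1 G (SLInf S) → H1 G (GLInf S) :=
  H1.map (MonoidHom.id G) (Subgroup.inclusion SLInf_le_GLInf) (fun _ _ => rfl)

end Det

/-! ## The factor rings `S_H` -/

section Factor

variable {G : Type*} [Group G] (S : Type*) [CommRing S] [MulSemiringAction G S]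

/-- `J(H)`: the intersection of all maximal ideals of `S` whose inertia group contains `H`. -/
def inertiaRadical (H : Subgroup G) : Ideal S :=
  ⨅ (M : MaximalSpectrum S) (_ : H ≤ M.asIdeal.inertia G), M.asIdeal

variable {S}

theorem mem_inertiaRadical {H : Subgroup G} {s : S} :
    s ∈ inertiaRadical S H ↔
      ∀ M : MaximalSpectrum S, H ≤ M.asIdeal.inertia G → s ∈ M.asIdeal := by
  simp [inertiaRadical, Submodule.mem_iInf]

theorem smul_sub_mem_inertiaRadical {H : Subgroup G} (h : H) (s : S) :
    (h : G) • s - s ∈ inertiaRadical S H :=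
  mem_inertiaRadical.2 fun _ hM => hM h.2 s

variable (S)

/-- `S_H = S / J(H)`. -/
def FactorRing (H : Subgroup G) : Type _ := S ⧸ inertiaRadical S H

instance (H : Subgroup G) : CommRing (FactorRing S H) :=
  inferInstanceAs (CommRing (S ⧸ inertiaRadical S H))

/-- The canonical map `S → S_H`. -/
def toFactor (H : Subgroup G) : S →+* FactorRing S H := Ideal.Quotient.mk _

theorem toFactor_surjective (H : Subgroup G) : Function.Surjective (toFactor S H) :=
  Ideal.Quotient.mk_surjective

theorem toFactor_smul (H : Subgroup G) (h : H) (s : S) :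
    toFactor S H ((h : G) • s) = toFactor S H s :=
  Ideal.Quotient.eq.2 (smul_sub_mem_inertiaRadical h s)

/-- The action of `h ∈ H` on `S_H` that is induced by its action on `S`. -/
def factorAct (H : Subgroup G) (h : H) : FactorRing S H →+* FactorRing S H :=
  Ideal.Quotient.lift (inertiaRadical S H)
    ((toFactor S H).comp (MulSemiringAction.toRingHom G S (h : G))) (by
      intro s hs
      change toFactor S H ((h : G) • s) = 0
      rw [toFactor_smul]
      exact Ideal.Quotient.eq_zero_iff_mem.2 hs)

theorem factorAct_toFactor (H : Subgroup G) (h : H) (s : S) :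
    factorAct S H h (toFactor S H s) = toFactor S H ((h : G) • s) := rfl

/-- `H` acts on `S_H` through its action on `S` (as it turns out, trivially). -/
instance (H : Subgroup G) : MulSemiringAction H (FactorRing S H) where
  smul h x := factorAct S H h x
  one_smul x := by
    obtain ⟨s, rfl⟩ := toFactor_surjective S H x
    change factorAct S H _ _ = _
    rw [factorAct_toFactor, Subgroup.coe_one, one_smul]
  mul_smul h k x := by
    obtain ⟨s, rfl⟩ := toFactor_surjective S H x
    change factorAct S H _ _ = factorAct S H _ (factorAct S H _ _)
    rw [factorAct_toFactor, factorAct_toFactor, factorAct_toFactor, Subgroup.coe_mul, mul_smul]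
  smul_zero h := map_zero (factorAct S H h)
  smul_add h := map_add (factorAct S H h)
  smul_one h := map_one (factorAct S H h)
  smul_mul h := map_mul (factorAct S H h)

theorem smul_toFactor (H : Subgroup G) (h : H) (s : S) :
    h • toFactor S H s = toFactor S H ((h : G) • s) := rfl

/-- The restriction-reduction map `H¹(G, Sˣ) → Hom(H, S_Hˣ)`. -/
def resRedUnits (H : Subgroup G) : H1 G Sˣ →* (H →* (FactorRing S H)ˣ) where
  toFun := Quotient.lift
    (fun d : Cocycle G Sˣ =>
      { toFun := fun h : H => Units.map (toFactor S H : S →* FactorRing S H) (d h)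
        map_one' := by
          have h1 : d 1 = 1 := by simpa using d.map_mul' 1 1
          rw [Subgroup.coe_one, h1, map_one]
        map_mul' := by
          intro h k
          rw [Subgroup.coe_mul, d.map_mul', map_mul]
          congr 1
          ext
          exact toFactor_smul S H k⁻¹ _ })
    (by
      rintro d e ⟨x, hx⟩
      ext h
      have := toFactor_smul S H h⁻¹ (x : S)
      have hu : Units.map (toFactor S H : S →* FactorRing S H) ((h : G)⁻¹ • x)
          = Units.map (toFactor S H : S →* FactorRing S H) x := Units.ext this
      change ((Units.map (toFactor S H : S →* FactorRing S H) (d h) : (FactorRing S H)ˣ) :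
        FactorRing S H) = (Units.map (toFactor S H : S →* FactorRing S H) (e h) : (FactorRing S H)ˣ)
      rw [hx, map_mul, map_mul, map_inv, hu, mul_comm (Units.map _ x), mul_inv_cancel_right])
  map_one' := by
    ext h
    exact map_one (toFactor S H)
  map_mul' a b := by
    induction a using H1.ind with | _ d =>
    induction b using H1.ind with | _ e =>
    ext h
    exact map_mul (toFactor S H) _ _

variable [Finite G]

/-- The restriction-reduction map `H¹(G, GL(S)) → H¹(H, GL(S_H))`. -/
def resRedGL (H : Subgroup G) : H1 G (GLInf S) →+ H1 H (GLInf (FactorRing S H)) :=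
  H1.mapHom H.subtype (toFactor S H) (fun _ _ => rfl) (fun _ hu => GLInf.map_mem _ hu)

/-- The restriction-reduction map `H¹(G, SL(S)) → H¹(H, SL(S_H))`. -/
def resRedSL (H : Subgroup G) : H1 G (SLInf S) →+ H1 H (SLInf (FactorRing S H)) :=
  H1.mapHom H.subtype (toFactor S H) (fun _ _ => rfl) (fun _ hu => SLInf.map_mem _ hu)

variable (G)

/-- The set `𝒞` of cyclic subgroups of `G`. -/
def CyclicSubgroups : Type _ := {C : Subgroup G // IsCyclic C}

/-- `ρ : H¹(G, GL(S)) → ∏_C H¹(C, GL(S_C))`, `C` running over the cyclic subgroups of `G`. -/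
def rho : H1 G (GLInf S) →+
    ((C : CyclicSubgroups G) → H1 C.1 (GLInf (FactorRing S C.1))) :=
  AddMonoidHom.pi fun C => resRedGL S C.1

/-- `σ : H¹(G, SL(S)) → ∏_C H¹(C, SL(S_C))`, `C` running over the cyclic subgroups of `G`. -/
def sigma : H1 G (SLInf S) →+
    ((C : CyclicSubgroups G) → H1 C.1 (SLInf (FactorRing S C.1))) :=
  AddMonoidHom.pi fun C => resRedSL S C.1

end Factor

/-! ## The Grothendieck group `K₀` -/

section KZero

open TensorProduct

/-- Finitely generated projective modules. -/
structure FGProj (R : Type u) [CommRing R] : Type (u + 1) where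
  /-- the underlying module -/
  carrier : Type u
  [addCommGroup : AddCommGroup carrier]
  [module : Module R carrier]
  [finite : Module.Finite R carrier]
  [projective : Module.Projective R carrier]

attribute [instance] FGProj.addCommGroup FGProj.module FGProj.finite FGProj.projective

variable (R : Type u) [CommRing R]

/-- Isomorphism of modules. -/
instance FGProj.setoid : Setoid (FGProj R) where
  r P Q := Nonempty (P.carrier ≃ₗ[R] Q.carrier)
  iseqv :=
    { refl := fun _ => ⟨LinearEquiv.refl _ _⟩
      symm := fun ⟨e⟩ => ⟨e.symm⟩
      trans := fun ⟨e⟩ ⟨f⟩ => ⟨e.trans f⟩ }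

/-- Isomorphism classes of finitely generated projective modules. -/
def IsoClass : Type (u + 1) := Quotient (FGProj.setoid R)

variable {R}

/-- The isomorphism class of a module. -/
def IsoClass.mk (P : Type u) [AddCommGroup P] [Module R P] [Module.Finite R P]
    [Module.Projective R P] : IsoClass R := Quotient.mk (FGProj.setoid R) ⟨P⟩

variable (R)

/-- Addition is induced by the direct sum. -/
instance : Add (IsoClass R) where
  add := Quotient.map₂ (fun P Q => ⟨P.carrier × Q.carrier⟩)
    (fun _ _ ⟨e⟩ _ _ ⟨f⟩ => ⟨LinearEquiv.prodCongr e f⟩)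

instance : Zero (IsoClass R) := ⟨IsoClass.mk PUnit⟩

/-- The monoid structure given by direct sums. -/
instance : AddCommMonoid (IsoClass R) where
  add_assoc a b c := by
    induction a, b, c using Quotient.inductionOn₃ with
    | _ P Q L => exact Quotient.sound ⟨LinearEquiv.prodAssoc R _ _ _⟩
  zero_add a := by
    induction a using Quotient.inductionOn with
    | _ P => exact Quotient.sound ⟨LinearEquiv.uniqueProd⟩
  add_zero a := by
    induction a using Quotient.inductionOn with
    | _ P => exact Quotient.sound ⟨LinearEquiv.prodUnique⟩
  add_comm a b := by
    induction a, b using Quotient.inductionOn₂ with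
    | _ P Q => exact Quotient.sound ⟨LinearEquiv.prodComm R _ _⟩
  nsmul := nsmulRec

/-- The Grothendieck group `K₀(R)` of finitely generated projective `R`-modules. -/
abbrev KZero : Type (u + 1) := Algebra.GrothendieckAddGroup (IsoClass R)

variable (S : Type u) [CommRing S] [Algebra R S]

/-- `P ↦ S ⊗_R P` on isomorphism classes. -/
def IsoClass.baseChange : IsoClass R →+ IsoClass S where
  toFun := Quotient.map (fun P => ⟨S ⊗[R] P.carrier⟩)
    (fun _ _ ⟨e⟩ => ⟨e.baseChange R S _ _⟩)
  map_zero' := Quotient.sound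
    ⟨LinearEquiv.ofSubsingleton (S ⊗[R] PUnit.{u + 1}) PUnit.{u + 1}⟩
  map_add' a b := by
    induction a, b using Quotient.inductionOn₂ with
    | _ P Q => exact Quotient.sound ⟨TensorProduct.prodRight R S S _ _⟩

/-- The induction map `K₀(R) → K₀(S)`, `[P] ↦ [S ⊗_R P]`. -/
def KZero.map : KZero R →+ KZero S :=
  Algebra.GrothendieckAddGroup.lift
    (Algebra.GrothendieckAddGroup.of.comp (IsoClass.baseChange R S))

end KZero

end InvariantK0

end

open InvariantK0

/-!
Let `R = S^G`. The proof is Galois descent for modules on which the inertia groups act trivially.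

Let `N` be a finitely generated projective `S`-module with a semilinear action of `G` such that, for
every maximal ideal `M` of `S`, the inertia group of `M` acts trivially on `N / M N`. Then the
`G`-invariants of `N` span `N` (`SemilinearAction.span_invariants_eq_top`): a nonzero functional
`N → S / M` that vanishes on the invariants kills every trace `∑ g (s v)`, while the characters
`s ↦ g s mod M` are linearly independent (Dedekind), and the order of the inertia group is
invertible modulo `M` since `S` has an element `x` of trace `1`. Averaging with `x` makes a dual
basis of `N` invariant (`SemilinearAction.exists_dualBasis`), so that the invariants `P` form a
finitely generated projective `R`-module with `S ⊗ P ≅ N`. Conversely, the action on `S ⊗ P` has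
trivial inertia for every `R`-module `P`, and finitely generated projective `P` are recovered as its
invariants. Hence the `P` with `S ⊗ P` free of rank `n` are the forms
`{v ∈ Sⁿ | d(g) v = v ^ g for all g}` of the cocycles `d` with values in `GLₙ(S)` that become
trivial modulo `M` on the inertia group of `M`, for all `M`; isomorphic forms belong to cohomologous
cocycles. As every element of a group generates a cyclic subgroup, and `H` acts trivially on `S_H`,
the classes of these cocycles are exactly the elements of `Ker ρ` (`mk_mem_mker_rho_iff`).

An element of `Ker K₀(f)` can be written as `[P] - [Rⁿ]` with `S ⊗ P` free of rank `n`. The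
isomorphism between `Ker K₀(f)` and `Ker ρ` (`kernelEquiv`) matches it with the class of the cocycle
of which `P` is the form: stabilisation of cocycles corresponds to the addition of free modules, and
block sums to direct sums.

In rank one the form of `d` is a submodule of `S`, and it is invertible, with the form of `d⁻¹` as
its inverse (`UnitsInertiallyTrivial.unitsForm_mul_inv`). All invertible submodules of `S` arise in
this way (`exists_unitsForm_eq`), the free ones from coboundaries, so that Mathlib's exact sequence
`Sˣ → {invertible submodules} → Pic(R) → Pic(S)` identifies `Ker Pic(f)` with the kernel of
restriction and reduction on `H¹(G, Sˣ)` (`picKernelEquiv`).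

Through these isomorphisms, the exact sequence becomes the one of `Ker σ → Ker ρ` and of the
determinant. There, cocycles and the elements relating them are corrected by a diagonal matrix with
one nontrivial entry; when this entry is placed outside of the block in which a cocycle lives, the
matrix commutes with the cocycle (`inclH1_injective`, `exists_inclH1_eq`).
-/

noncomputable section

namespace InvariantK0

/-! ### Semilinear actions and descent -/

section Descent

variable {G : Type*} [Group G] {S : Type*} [CommRing S] [MulSemiringAction G S]

/-- An action of `G` on the `S`-module `N` by additive maps with `g (s v) = (g s) (g v)`. It is
bundled, not a type class, since the same module carries a different action for every cocycle. -/
structure SemilinearAction (G : Type*) [Group G] (S : Type*) [CommRing S] [MulSemiringAction G S]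
    (N : Type*) [AddCommGroup N] [Module S N] where
  /-- the underlying homomorphism -/
  toEnd : G →* AddMonoid.End N
  map_smul' : ∀ (g : G) (s : S) (v : N), toEnd g (s • v) = (g • s) • toEnd g v

namespace SemilinearAction

variable {N : Type*} [AddCommGroup N] [Module S N]

instance : CoeFun (SemilinearAction G S N) (fun _ => G → AddMonoid.End N) := ⟨fun τ => τ.toEnd⟩

theorem apply_smul (τ : SemilinearAction G S N) (g : G) (s : S) (v : N) :
    τ g (s • v) = (g • s) • τ g v := τ.map_smul' g s v

theorem apply_mul (τ : SemilinearAction G S N) (g h : G) (v : N) : τ (g * h) v = τ g (τ h v) := by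
  rw [map_mul]; rfl

theorem apply_one (τ : SemilinearAction G S N) (v : N) : τ 1 v = v := by
  rw [map_one]; rfl

theorem apply_inv_apply (τ : SemilinearAction G S N) (g : G) (v : N) : τ g (τ g⁻¹ v) = v := by
  rw [← apply_mul, mul_inv_cancel, apply_one]

theorem inv_apply_apply (τ : SemilinearAction G S N) (g : G) (v : N) : τ g⁻¹ (τ g v) = v := by
  rw [← apply_mul, inv_mul_cancel, apply_one]

/-- The `S^G`-module of invariant elements. -/
def invariants (τ : SemilinearAction G S N) : Submodule (FixedPoints.subring S G) N where
  carrier := {v | ∀ g, τ g v = v}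
  zero_mem' g := map_zero _
  add_mem' hv hw g := by rw [map_add, hv, hw]
  smul_mem' r v hv g := by
    rw [Subring.smul_def, τ.apply_smul, hv, r.2 g]

/-- For every maximal ideal `M` of `S`, the inertia group of `M` acts trivially on `N / M N`. -/
def InertiallyTrivial (τ : SemilinearAction G S N) : Prop :=
  ∀ M : Ideal S, M.IsMaximal → ∀ g ∈ M.inertia G, ∀ v, τ g v - v ∈ M • (⊤ : Submodule S N)

variable [Fintype G]

/-- The trace `∑ g, g s` of `s`, an element of the ring of invariants. -/
def trace (s : S) : FixedPoints.subring S G :=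
  ⟨∑ g : G, g • s, fun h => by
    rw [Finset.smul_sum]
    exact Fintype.sum_equiv (Equiv.mulLeft h) _ _ fun g => (mul_smul h g s).symm⟩

theorem sum_apply_mem_invariants (τ : SemilinearAction G S N) (v : N) :
    ∑ g, τ g v ∈ τ.invariants := fun h => by
  rw [map_sum]
  exact Fintype.sum_equiv (Equiv.mulLeft h) _ _ fun g => (τ.apply_mul h g v).symm

end SemilinearAction

open SemilinearAction

/-- The homomorphism `s ↦ g s mod M`, as a map of multiplicative monoids. -/
def residueChar (M : Ideal S) (g : G) : S →* S ⧸ M :=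
  ((Ideal.Quotient.mk M).comp (MulSemiringAction.toRingHom G S g) : S →+* S ⧸ M)

theorem residueChar_apply (M : Ideal S) (g : G) (s : S) :
    residueChar M g s = Ideal.Quotient.mk M (g • s) := rfl

theorem residueChar_eq_iff (M : Ideal S) (g h : G) :
    residueChar M g = residueChar M h ↔ g * h⁻¹ ∈ M.inertia G := by
  constructor
  · intro H s
    have := DFunLike.congr_fun H (h⁻¹ • s)
    rw [residueChar_apply, residueChar_apply, Ideal.Quotient.eq, smul_inv_smul, ← mul_smul] at this
    exact this
  · intro H
    ext s
    rw [residueChar_apply, residueChar_apply, Ideal.Quotient.eq]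
    have := H (h • s)
    rwa [← mul_smul, inv_mul_cancel_right] at this

variable [Fintype G]

/-- Dedekind independence of the characters `s ↦ g s mod M`, for coefficients that are constant
on the cosets of the inertia group; the existence of an element of trace `1` makes the order of
the inertia group invertible modulo `M`. -/
theorem eq_zero_of_sum_residueChar (htr : ∃ x : S, ∑ g : G, g • x = 1) (M : Ideal S)
    [M.IsMaximal] (c : G → S ⧸ M) (hc : ∀ i ∈ M.inertia G, ∀ g, c (i * g) = c g)
    (h : ∀ s, ∑ g : G, residueChar M g s * c g = 0) : c 1 = 0 := by
  classical
  obtain ⟨x, hx⟩ := htr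
  have fiber : ∀ (b : G → S ⧸ M) (s : S), ∑ g : G, residueChar M g s * b g =
      ∑ χ ∈ Finset.univ.image (residueChar (S := S) (G := G) M),
        (∑ g with residueChar (G := G) M g = χ, b g) * χ s := by
    intro b s
    rw [← Finset.sum_fiberwise_of_maps_to (g := residueChar (G := G) M)
      (t := Finset.univ.image (residueChar (G := G) M))
      (fun (g : G) _ => Finset.mem_image_of_mem _ (Finset.mem_univ g))]
    refine Finset.sum_congr rfl fun χ _ => ?_
    rw [Finset.sum_mul]
    refine Finset.sum_congr rfl fun g hg => ?_
    rw [(Finset.mem_filter.1 hg).2, mul_comm]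
  have hcard : ∀ g : G, (Finset.univ.filter fun k : G => residueChar M k = residueChar M g).card =
      (Finset.univ.filter fun k : G => k ∈ M.inertia G).card := by
    intro g
    refine Finset.card_bij (fun k _ => k * g⁻¹) ?_ ?_ ?_
    · intro k hk
      simpa [residueChar_eq_iff] using hk
    · intro a _ b _ hab
      exact mul_right_cancel hab
    · intro k hk
      refine ⟨k * g, ?_, by group⟩
      simpa [residueChar_eq_iff] using hk
  by_contra hne
  have hli := linearIndependent_iff'.1 (linearIndependent_monoidHom S (S ⧸ M))
    (Finset.univ.image (residueChar (G := G) M))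
    (fun χ => ∑ g : G with residueChar M g = χ, c g) (by
      ext s
      simpa [Finset.sum_apply] using (fiber c s).symm.trans (h s))
    (residueChar M 1) (Finset.mem_image_of_mem _ (Finset.mem_univ 1))
  have hconst : ∑ g : G with residueChar M g = residueChar M (1 : G), c g =
      ((Finset.univ.filter fun k : G => k ∈ M.inertia G).card : S ⧸ M) * c 1 := by
    rw [← hcard 1, ← nsmul_eq_mul, ← Finset.sum_const]
    refine Finset.sum_congr rfl fun g hg => ?_
    have := hc _ ((residueChar_eq_iff M g 1).1 (Finset.mem_filter.1 hg).2) 1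
    simpa using this
  have hzero : ((Finset.univ.filter fun k : G => k ∈ M.inertia G).card : S ⧸ M) = 0 :=
    (mul_eq_zero.1 (hconst.symm.trans hli)).resolve_right hne
  have h1 := fiber (fun _ => 1) x
  rw [Finset.sum_eq_zero (s := Finset.image _ _)] at h1
  · simp only [mul_one, residueChar_apply] at h1
    rw [← map_sum, hx, map_one] at h1
    exact one_ne_zero h1
  · intro χ hχ
    obtain ⟨g, -, rfl⟩ := Finset.mem_image.1 hχ
    rw [Finset.sum_const, hcard g, nsmul_one, hzero, zero_mul]

namespace SemilinearAction

variable {N : Type*} [AddCommGroup N] [Module S N]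

/-- The invariants span. Otherwise they are contained in the kernel of a nonzero functional
`N → S / M`, which then kills all traces `∑ g, g (s v)`. -/
theorem span_invariants_eq_top [Module.Finite S N] (htr : ∃ x : S, ∑ g : G, g • x = 1)
    {τ : SemilinearAction G S N} (hτ : τ.InertiallyTrivial) :
    Submodule.span S (τ.invariants : Set N) = ⊤ := by
  refine (eq_top_or_exists_le_coatom _).resolve_right ?_
  rintro ⟨W, hW, hle⟩
  obtain ⟨M, hM, ⟨e⟩⟩ := isSimpleModule_iff_quot_maximal.1 (isSimpleModule_iff_isCoatom.2 hW)
  let l : N →ₗ[S] S ⧸ M := e.toLinearMap ∘ₗ W.mkQ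
  have hl : ∀ v, l v = 0 ↔ v ∈ W := fun v => by simp [l]
  have hlM : ∀ v ∈ M • (⊤ : Submodule S N), l v = 0 := by
    intro v hv
    refine Submodule.smul_induction_on hv (fun s hs v _ => ?_) (fun v w hv hw => ?_)
    · rw [map_smul, Algebra.smul_def, Ideal.Quotient.algebraMap_eq,
        Ideal.Quotient.eq_zero_iff_mem.2 hs, zero_mul]
    · rw [map_add, hv, hw, add_zero]
  refine hW.1 (eq_top_iff.2 fun v _ => (hl v).1 ?_)
  have := eq_zero_of_sum_residueChar htr M (fun g => l (τ g v)) (fun i hi g => ?_) (fun s => ?_)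
  · simpa [τ.apply_one] using this
  · rw [τ.apply_mul, ← sub_eq_zero, ← map_sub]
    exact hlM _ (hτ M hM i hi _)
  · have h0 : l (∑ g, τ g (s • v)) = 0 :=
      (hl _).2 (hle (Submodule.subset_span (τ.sum_apply_mem_invariants _)))
    rw [map_sum] at h0
    rw [← h0]
    refine Finset.sum_congr rfl fun g _ => ?_
    rw [τ.apply_smul, map_smul, Algebra.smul_def, residueChar_apply, Ideal.Quotient.algebraMap_eq]

/-- A dual basis of `N` that consists of invariant elements and of functionals with invariant
values on invariant elements. The functionals are the averages of `x ℓ`, where `x` has trace `1`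
and the functionals `ℓ` express `N` in terms of finitely many invariant generators. -/
theorem exists_dualBasis [Module.Finite S N] [Module.Projective S N]
    (htr : ∃ x : S, ∑ g : G, g • x = 1) {τ : SemilinearAction G S N} (hτ : τ.InertiallyTrivial) :
    ∃ (m : ℕ) (p : Fin m → τ.invariants) (l : Fin m → N →ₗ[S] S),
      (∀ v, ∑ i, l i v • (p i : N) = v) ∧
      ∀ i, ∀ v ∈ τ.invariants, l i v ∈ FixedPoints.subring S G := by
  have hspan := span_invariants_eq_top htr hτ
  obtain ⟨x, hx⟩ := htr
  obtain ⟨T, hT, hT'⟩ := (Submodule.fg_span_iff_fg_span_finset_subset (R := S)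
    (τ.invariants : Set N)).1 (by rw [hspan]; exact Module.Finite.fg_top)
  let p : Fin T.card → τ.invariants := fun i => ⟨T.equivFin.symm i, hT (T.equivFin.symm i).2⟩
  have hp : Function.Surjective (Fintype.linearCombination S (fun i => (p i : N))) := by
    rw [← LinearMap.range_eq_top, Fintype.range_linearCombination, ← hspan, hT']
    congr 1
    ext v
    constructor
    · rintro ⟨i, rfl⟩
      exact (T.equivFin.symm i).2
    · intro hv
      exact ⟨T.equivFin ⟨v, hv⟩, by simp [p]⟩
  obtain ⟨s, hs⟩ := Module.projective_lifting_property _ LinearMap.id hp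
  have hs' : ∀ v, ∑ i, s v i • (p i : N) = v := fun v => by
    simpa [Fintype.linearCombination_apply] using DFunLike.congr_fun hs v
  let l : Fin T.card → N →ₗ[S] S := fun i =>
    { toFun := fun v => ∑ g : G, g • (x * s (τ g⁻¹ v) i)
      map_add' := fun v w => by
        simp only [map_add, Pi.add_apply, mul_add, smul_add, Finset.sum_add_distrib]
      map_smul' := fun a v => by
        rw [RingHom.id_apply, smul_eq_mul, Finset.mul_sum]
        refine Finset.sum_congr rfl fun g _ => ?_
        rw [τ.apply_smul, LinearMap.map_smul, Pi.smul_apply, smul_eq_mul, mul_left_comm, smul_mul',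
          smul_inv_smul] }
  refine ⟨T.card, p, l, fun v => ?_, fun i v hv => ?_⟩
  · calc ∑ i, l i v • (p i : N)
        = ∑ i, ∑ g : G, (g • x) • τ g (s (τ g⁻¹ v) i • (p i : N)) := by
          refine Finset.sum_congr rfl fun i _ => ?_
          change (∑ g : G, g • (x * s (τ g⁻¹ v) i)) • _ = _
          rw [Finset.sum_smul]
          refine Finset.sum_congr rfl fun g _ => ?_
          rw [τ.apply_smul, (p i).2 g, smul_mul', mul_smul]
      _ = ∑ g : G, (g • x) • τ g (∑ i, s (τ g⁻¹ v) i • (p i : N)) := by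
          rw [Finset.sum_comm]
          refine Finset.sum_congr rfl fun g _ => ?_
          rw [map_sum, Finset.smul_sum]
      _ = v := by
          simp only [hs', τ.apply_inv_apply]
          rw [← Finset.sum_smul, hx, one_smul]
  · have : l i v = trace (G := G) (x * s v i) := by
      refine Finset.sum_congr rfl fun g _ => ?_
      rw [hv]
    rw [this]
    exact Subtype.property _

end SemilinearAction
end Descent

section DescentConsequences

open SemilinearAction TensorProduct

variable {G : Type*} [Group G] {S : Type*} [CommRing S] [MulSemiringAction G S]

namespace SemilinearAction

variable {N N' : Type*} [AddCommGroup N] [Module S N] [AddCommGroup N'] [Module S N']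

/-- An action whose invariants span is inertially trivial. This is the converse of
`span_invariants_eq_top`. -/
theorem inertiallyTrivial_of_span {τ : SemilinearAction G S N}
    (h : Submodule.span S (τ.invariants : Set N) = ⊤) : τ.InertiallyTrivial := by
  intro M _ g hg v
  have hv : v ∈ Submodule.span S (τ.invariants : Set N) := h ▸ Submodule.mem_top
  induction hv using Submodule.span_induction with
  | mem v hv => rw [hv g, sub_self]; exact zero_mem _
  | zero => rw [map_zero, sub_self]; exact zero_mem _
  | add v w _ _ hv hw => rw [map_add, add_sub_add_comm]; exact add_mem hv hw
  | smul s v _ hv =>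
    have : τ g (s • v) - s • v = (g • s - s) • τ g v + s • (τ g v - v) := by
      rw [τ.apply_smul, sub_smul, smul_sub]; abel
    rw [this]
    exact add_mem (Submodule.smul_mem_smul (hg s) Submodule.mem_top) (Submodule.smul_mem _ s hv)

/-- The semilinear action that corresponds to `τ` under an isomorphism of modules. -/
def transport (τ : SemilinearAction G S N) (e : N ≃ₗ[S] N') : SemilinearAction G S N' where
  toEnd :=
    { toFun := fun g => (e.toAddMonoidHom.comp (τ g)).comp e.symm.toAddMonoidHom
      map_one' := AddMonoidHom.ext fun v => by
        change e (τ 1 (e.symm v)) = v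
        rw [τ.apply_one, e.apply_symm_apply]
      map_mul' := fun g h => AddMonoidHom.ext fun v => by
        change e (τ (g * h) (e.symm v)) = e (τ g (e.symm (e (τ h (e.symm v)))))
        rw [τ.apply_mul, e.symm_apply_apply] }
  map_smul' g s v := by
    change e (τ g (e.symm (s • v))) = (g • s) • e (τ g (e.symm v))
    rw [map_smul, τ.apply_smul, map_smul]

theorem transport_apply (τ : SemilinearAction G S N) (e : N ≃ₗ[S] N') (g : G) (v : N') :
    τ.transport e g v = e (τ g (e.symm v)) := rfl

theorem mem_invariants_transport {τ : SemilinearAction G S N} {e : N ≃ₗ[S] N'} {v : N'} :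
    v ∈ (τ.transport e).invariants ↔ e.symm v ∈ τ.invariants := by
  refine forall_congr' fun g => ?_
  rw [transport_apply, ← e.eq_symm_apply]

/-- The induced isomorphism of the modules of invariants. -/
def invariantsTransport (τ : SemilinearAction G S N) (e : N ≃ₗ[S] N') :
    τ.invariants ≃ₗ[FixedPoints.subring S G] (τ.transport e).invariants where
  toFun v := ⟨e v.1, by rw [mem_invariants_transport, e.symm_apply_apply]; exact v.2⟩
  invFun v := ⟨e.symm v.1, mem_invariants_transport.1 v.2⟩
  map_add' v w := Subtype.ext (map_add e _ _)
  map_smul' r v := Subtype.ext (e.map_smul (r : S) v.1)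
  left_inv v := Subtype.ext (e.symm_apply_apply _)
  right_inv v := Subtype.ext (e.apply_symm_apply _)

theorem InertiallyTrivial.transport {τ : SemilinearAction G S N} (hτ : τ.InertiallyTrivial)
    (e : N ≃ₗ[S] N') : (τ.transport e).InertiallyTrivial := by
  intro M hM g hg v
  have := Submodule.mem_map_of_mem (f := e.toLinearMap) (hτ M hM g hg (e.symm v))
  rw [Submodule.map_smul'', LinearEquiv.coe_coe, map_sub, e.apply_symm_apply] at this
  exact Submodule.smul_mono le_rfl le_top this

section

variable [Fintype G] [Module.Finite S N] [Module.Projective S N]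

theorem finite_projective_invariants (htr : ∃ x : S, ∑ g : G, g • x = 1)
    {τ : SemilinearAction G S N} (hτ : τ.InertiallyTrivial) :
    Module.Finite (FixedPoints.subring S G) τ.invariants ∧
      Module.Projective (FixedPoints.subring S G) τ.invariants := by
  obtain ⟨m, p, l, hp, hl⟩ := exists_dualBasis htr hτ
  let f : (Fin m → FixedPoints.subring S G) →ₗ[FixedPoints.subring S G] τ.invariants :=
    Fintype.linearCombination _ p
  let i : τ.invariants →ₗ[FixedPoints.subring S G] (Fin m → FixedPoints.subring S G) :=
    { toFun := fun v j => ⟨l j v, hl j v v.2⟩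
      map_add' := fun v w => funext fun j => Subtype.ext (map_add (l j) _ _)
      map_smul' := fun r v => funext fun j => Subtype.ext ((l j).map_smul (r : S) (v : N)) }
  have hfi : f ∘ₗ i = LinearMap.id := by
    ext v
    simp only [LinearMap.comp_apply, f, i, Fintype.linearCombination_apply, LinearMap.id_apply,
      Submodule.coe_sum, Submodule.coe_smul]
    exact hp v
  have hsurj : Function.Surjective f := fun v => ⟨i v, DFunLike.congr_fun hfi v⟩
  exact ⟨Module.Finite.of_surjective f hsurj, Module.Projective.of_split i f hfi⟩

/-- Galois descent: `S ⊗ N^G ≅ N`. -/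
theorem nonempty_baseChange_invariants_equiv (htr : ∃ x : S, ∑ g : G, g • x = 1)
    {τ : SemilinearAction G S N} (hτ : τ.InertiallyTrivial) :
    Nonempty (S ⊗[FixedPoints.subring S G] τ.invariants ≃ₗ[S] N) := by
  obtain ⟨m, p, l, hp, hl⟩ := exists_dualBasis htr hτ
  let f : S ⊗[FixedPoints.subring S G] τ.invariants →ₗ[S] N :=
    AlgebraTensorModule.lift
      { toFun := fun s => s • τ.invariants.subtype
        map_add' := fun s t => add_smul s t _
        map_smul' := fun s t => mul_smul s t _ }
  have hf : ∀ (s : S) (v : τ.invariants), f (s ⊗ₜ v) = s • (v : N) := fun s v => rfl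
  let i : N →ₗ[S] S ⊗[FixedPoints.subring S G] τ.invariants :=
    ∑ j, (l j).smulRight (1 ⊗ₜ p j)
  have hi : ∀ v, i v = ∑ j, l j v • ((1 : S) ⊗ₜ p j) := fun v => by
    simp only [i, LinearMap.sum_apply, LinearMap.smulRight_apply]
  refine ⟨LinearEquiv.ofLinearMap f i (LinearMap.ext fun v => ?_) ?_⟩
  · rw [LinearMap.comp_apply, hi, map_sum, LinearMap.id_apply]
    conv_rhs => rw [← hp v]
    refine Finset.sum_congr rfl fun j _ => ?_
    rw [map_smul, hf, one_smul]
  · refine AlgebraTensorModule.curry_injective (LinearMap.ext_ring (LinearMap.ext fun v => ?_))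
    change i (f (1 ⊗ₜ v)) = 1 ⊗ₜ v
    rw [hf, one_smul, hi]
    conv_rhs => rw [show v = ∑ j, (⟨l j v, hl j v v.2⟩ : FixedPoints.subring S G) • p j from
      Subtype.ext (by rw [Submodule.coe_sum]; exact (hp v).symm)]
    rw [tmul_sum]
    refine Finset.sum_congr rfl fun j _ => ?_
    rw [tmul_smul]; rfl

variable [Module.Finite S N'] [Module.Projective S N']

/-- An isomorphism between the invariants of `N` and `N'` extends to an equivariant isomorphism
of `N` with `N'`. -/
theorem exists_equivariant_equiv (htr : ∃ x : S, ∑ g : G, g • x = 1)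
    {τ : SemilinearAction G S N} (hτ : τ.InertiallyTrivial)
    {τ' : SemilinearAction G S N'} (hτ' : τ'.InertiallyTrivial)
    (θ : τ.invariants ≃ₗ[FixedPoints.subring S G] τ'.invariants) :
    ∃ e : N ≃ₗ[S] N', ∀ g v, e (τ g v) = τ' g (e v) := by
  obtain ⟨m, p, l, hp, hl⟩ := exists_dualBasis htr hτ
  obtain ⟨m', p', l', hp', hl'⟩ := exists_dualBasis htr hτ'
  let f : N →ₗ[S] N' := ∑ j, (l j).smulRight (θ (p j) : N')
  let f' : N' →ₗ[S] N := ∑ j, (l' j).smulRight (θ.symm (p' j) : N)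
  have hf : ∀ v : τ.invariants, f v = θ v := by
    intro v
    have hv : v = ∑ j, (⟨l j v, hl j v v.2⟩ : FixedPoints.subring S G) • p j :=
      Subtype.ext (by rw [Submodule.coe_sum]; exact (hp v).symm)
    conv_rhs => rw [hv]
    simp only [f, LinearMap.sum_apply, LinearMap.smulRight_apply, map_sum, Submodule.coe_sum,
      map_smul, Submodule.coe_smul]
    rfl
  have hf' : ∀ v : τ'.invariants, f' v = θ.symm v := by
    intro v
    have hv : v = ∑ j, (⟨l' j v, hl' j v v.2⟩ : FixedPoints.subring S G) • p' j :=
      Subtype.ext (by rw [Submodule.coe_sum]; exact (hp' v).symm)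
    conv_rhs => rw [hv]
    simp only [f', LinearMap.sum_apply, LinearMap.smulRight_apply, map_sum, Submodule.coe_sum,
      map_smul, Submodule.coe_smul]
    rfl
  refine ⟨LinearEquiv.ofLinearMap f f' (LinearMap.ext fun v => ?_) (LinearMap.ext fun v => ?_),
    fun g v => ?_⟩
  · rw [LinearMap.comp_apply, LinearMap.id_apply, ← hp' v, map_sum, map_sum]
    refine Finset.sum_congr rfl fun j _ => ?_
    rw [map_smul, map_smul, hf', hf, θ.apply_symm_apply]
  · rw [LinearMap.comp_apply, LinearMap.id_apply, ← hp v, map_sum, map_sum]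
    refine Finset.sum_congr rfl fun j _ => ?_
    rw [map_smul, map_smul, hf, hf', θ.symm_apply_apply]
  · change f (τ g v) = τ' g (f v)
    conv_lhs => rw [← hp v]
    conv_rhs => rw [← hp v]
    simp only [map_sum, τ.apply_smul, τ'.apply_smul, map_smul, hf, (θ (p _)).2 g, (p _).2 g]

end

section BaseChange

variable (P : Type*) [AddCommGroup P] [Module (FixedPoints.subring S G) P]

/-- The automorphism `s ↦ g s`, as a map of `S^G`-modules. -/
def smulLinear (g : G) : S →ₗ[FixedPoints.subring S G] S where
  toFun s := g • s
  map_add' := smul_add g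
  map_smul' r s := by
    rw [Subring.smul_def, smul_eq_mul, smul_mul', r.2 g]; rfl

/-- The action of `G` on `S ⊗ P` through the first factor. -/
def baseChange : SemilinearAction G S (S ⊗[FixedPoints.subring S G] P) where
  toEnd :=
    { toFun := fun g => ((smulLinear g).rTensor P).toAddMonoidHom
      map_one' := AddMonoidHom.ext fun v => by
        change (smulLinear 1).rTensor P v = v
        rw [show smulLinear (1 : G) = (LinearMap.id : S →ₗ[FixedPoints.subring S G] S) from
          LinearMap.ext (one_smul G), LinearMap.rTensor_id_apply]
      map_mul' := fun g h => AddMonoidHom.ext fun v => by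
        change (smulLinear (g * h)).rTensor P v =
          (smulLinear g).rTensor P ((smulLinear h).rTensor P v)
        rw [← LinearMap.rTensor_comp_apply]
        congr 2
        exact LinearMap.ext (mul_smul g h) }
  map_smul' g s v := by
    change (smulLinear g).rTensor P (s • v) = (g • s) • (smulLinear g).rTensor P v
    induction v using TensorProduct.induction_on with
    | zero => simp
    | add v w hv hw => rw [smul_add, map_add, map_add, smul_add, hv, hw]
    | tmul t p =>
      rw [smul_tmul', LinearMap.rTensor_tmul, LinearMap.rTensor_tmul, smul_tmul', smul_eq_mul,
        smul_eq_mul]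
      exact congrArg (· ⊗ₜ p) (smul_mul' g s t)

variable {P}

theorem baseChange_tmul (g : G) (s : S) (p : P) :
    baseChange P g (s ⊗ₜ[FixedPoints.subring S G] p) = (g • s) ⊗ₜ p := rfl

theorem one_tmul_mem_invariants (p : P) :
    (1 : S) ⊗ₜ[FixedPoints.subring S G] p ∈ (baseChange P).invariants := fun g => by
  rw [baseChange_tmul, smul_one]

variable (P)

theorem baseChange_inertiallyTrivial : (baseChange (G := G) (S := S) P).InertiallyTrivial := by
  refine inertiallyTrivial_of_span (eq_top_iff.2 fun v _ => ?_)
  induction v using TensorProduct.induction_on with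
  | zero => exact zero_mem _
  | add v w hv hw => exact add_mem (hv trivial) (hw trivial)
  | tmul s p =>
    have := Submodule.smul_mem _ s (Submodule.subset_span (R := S) (one_tmul_mem_invariants
      (G := G) (S := S) p))
    rwa [smul_tmul', smul_eq_mul, mul_one] at this

/-- `P ≅ (S ⊗ P)^G`, the inverse being induced by `s ↦ tr(x s)` for an element `x` of
trace `1`. -/
theorem nonempty_equiv_invariants_baseChange [Fintype G]
    (htr : ∃ x : S, ∑ g : G, g • x = 1) :
    Nonempty (P ≃ₗ[FixedPoints.subring S G] (baseChange (G := G) (S := S) P).invariants) := by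
  obtain ⟨x, hx⟩ := htr
  let t : S →ₗ[FixedPoints.subring S G] FixedPoints.subring S G :=
    { toFun := fun s => trace (x * s)
      map_add' := fun s s' => Subtype.ext (by
        simp only [trace, mul_add, smul_add, Finset.sum_add_distrib, Subring.coe_add])
      map_smul' := fun r s => Subtype.ext (by
        simp only [trace, RingHom.id_apply, smul_eq_mul, Subring.coe_mul, Finset.mul_sum]
        refine Finset.sum_congr rfl fun g _ => ?_
        rw [Subring.smul_def, smul_eq_mul, mul_left_comm, smul_mul', r.2 g]) }
  let j : P →ₗ[FixedPoints.subring S G] (baseChange (G := G) (S := S) P).invariants :=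
    (TensorProduct.mk _ S P 1).codRestrict _ one_tmul_mem_invariants
  let q : S ⊗[FixedPoints.subring S G] P →ₗ[FixedPoints.subring S G] P :=
    (TensorProduct.lid _ P).toLinearMap ∘ₗ t.rTensor P
  have hq : ∀ v, (1 : S) ⊗ₜ[FixedPoints.subring S G] q v = ∑ g : G, baseChange P g (x • v) := by
    intro v
    induction v using TensorProduct.induction_on with
    | zero => simp
    | add v w hv hw =>
      rw [map_add, tmul_add, hv, hw, ← Finset.sum_add_distrib]
      simp only [smul_add, map_add]
    | tmul s p =>
      have : q (s ⊗ₜ p) = t s • p := rfl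
      rw [this, tmul_smul, smul_tmul', Subring.smul_def, smul_eq_mul, mul_one]
      change (∑ g : G, g • (x * s)) ⊗ₜ p = _
      rw [sum_tmul]
      refine Finset.sum_congr rfl fun g _ => ?_
      rw [smul_tmul', baseChange_tmul, smul_eq_mul]
  refine ⟨LinearEquiv.ofLinearMap j (q ∘ₗ Submodule.subtype _) ?_ ?_⟩
  · refine LinearMap.ext fun v => Subtype.ext ?_
    change (1 : S) ⊗ₜ q v = (v : S ⊗[FixedPoints.subring S G] P)
    rw [hq]
    simp only [apply_smul, v.2 _]
    rw [← Finset.sum_smul, hx, one_smul]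
  · refine LinearMap.ext fun p => ?_
    change t 1 • p = p
    have : t 1 = 1 := Subtype.ext (by simpa [t, trace] using hx)
    rw [this, one_smul]

end BaseChange
end SemilinearAction
end DescentConsequences

/-! ### Cocycles with values in `GLₙ(S)` and semilinear actions on `Sⁿ` -/

section Blocks

variable {S : Type*} [CommRing S]

variable (S) in
/-- The span `Sⁿ` of the first `n` basis vectors of `S^(ℕ)`. -/
abbrev blockMod (n : ℕ) : Submodule S (ℕ →₀ S) := Finsupp.supported S S (Set.Iio n)

theorem mem_blockMod {n : ℕ} {v : ℕ →₀ S} : v ∈ blockMod S n ↔ ∀ i, n ≤ i → v i = 0 := by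
  rw [Finsupp.mem_supported']
  exact forall_congr' fun i => by rw [Set.mem_Iio, not_lt]

/-- `Sⁿ` as the set of functions on `Fin n`. -/
def blockModEquiv (n : ℕ) : blockMod S n ≃ₗ[S] (Fin n → S) :=
  (Finsupp.supportedEquivFinsupp (Set.Iio n)).trans
    ((Finsupp.domLCongr (Equiv.subtypeEquivRight fun i => by simp)).trans
      ((Finsupp.domLCongr (Fin.equivSubtype (n := n)).symm).trans
        (Finsupp.linearEquivFunOnFinite S S (Fin n))))

instance (n : ℕ) : Module.Finite S (blockMod S n) := Module.Finite.equiv (blockModEquiv n).symm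

instance (n : ℕ) : Module.Projective S (blockMod S n) :=
  Module.Projective.of_equiv (blockModEquiv n).symm

theorem AutInf.toEnd_inv_apply (u : AutInf S) (v : ℕ →₀ S) : u⁻¹.toEnd (u.toEnd v) = v := by
  rw [← Module.End.mul_apply, ← map_mul, inv_mul_cancel, map_one, Module.End.one_apply]

theorem AutInf.toEnd_apply_inv (u : AutInf S) (v : ℕ →₀ S) : u.toEnd (u⁻¹.toEnd v) = v := by
  rw [← Module.End.mul_apply, ← map_mul, mul_inv_cancel, map_one, Module.End.one_apply]

theorem AutInf.IsBlock.apply_mem {n : ℕ} {u : AutInf S} (hu : u.IsBlock n) {v : ℕ →₀ S}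
    (hv : v ∈ blockMod S n) : u.toEnd v ∈ blockMod S n := by
  rw [mem_blockMod] at hv ⊢
  intro i hi
  rw [AutInf.toEnd_apply]
  refine Finset.sum_eq_zero fun j _ => ?_
  dsimp only
  rw [hu i j (Or.inl hi)]
  split_ifs with h
  · rw [hv j (h ▸ hi), mul_zero]
  · rw [zero_mul]

theorem AutInf.IsBlock.apply_eq {n : ℕ} {u : AutInf S} (hu : u.IsBlock n) {v : ℕ →₀ S}
    (hv : ∀ i < n, v i = 0) : u.toEnd v = v := by
  rw [← Finsupp.sum_single v, map_finsuppSum]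
  refine Finset.sum_congr rfl fun j hj => ?_
  have hnj : n ≤ j := by
    by_contra h
    exact Finsupp.mem_support_iff.1 hj (hv j (not_le.1 h))
  have : Finsupp.single j (v j) = v j • Finsupp.single j (1 : S) := by simp
  dsimp only
  rw [this, map_smul, hu.apply_single hnj]

theorem AutInf.IsBlock.inv {n : ℕ} {u : AutInf S} (hu : u.IsBlock n) : (u⁻¹).IsBlock n := by
  -- The coordinates with index at least `n` are preserved by `u`, hence by `u⁻¹`.
  have key : ∀ (v : ℕ →₀ S) (i : ℕ), n ≤ i → u.toEnd v i = v i := by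
    intro v i hi
    rw [AutInf.toEnd_apply, Finsupp.sum, Finset.sum_congr rfl fun j _ => by
      rw [hu i j (Or.inl hi), ite_mul, one_mul, zero_mul], Finset.sum_ite_eq]
    split_ifs with h
    · rfl
    · exact (Finsupp.notMem_support_iff.1 h).symm
  intro i j hij
  rcases hij with hi | hj
  · rw [AutInf.entry, ← key _ i hi, AutInf.toEnd_apply_inv, Finsupp.single_apply]
    simp [eq_comm]
  · rw [AutInf.entry]
    conv_lhs => rw [← hu.apply_single hj]
    rw [AutInf.toEnd_inv_apply, Finsupp.single_apply]
    simp [eq_comm]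

theorem AutInf.IsBlock.ext {n : ℕ} {u w : AutInf S} (hu : u.IsBlock n) (hw : w.IsBlock n)
    (h : ∀ v ∈ blockMod S n, u.toEnd v = w.toEnd v) : u = w := by
  refine AutInf.ext_entry fun i j => ?_
  by_cases hj : n ≤ j
  · rw [hu i j (Or.inr hj), hw i j (Or.inr hj)]
  · rw [AutInf.entry, AutInf.entry, h]
    exact Finsupp.single_mem_supported S 1 (not_le.1 hj)

theorem mem_GLInf_of_isBlock {n : ℕ} {u : AutInf S} (hu : u.IsBlock n) : u ∈ GLInf S :=
  ⟨n, hu, hu.inv⟩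

/-- The endomorphism of `S^(ℕ)` that is `A` on the first `n` basis vectors and the identity on
the others. -/
def blockExtend (n : ℕ) (A : Module.End S (blockMod S n)) : Module.End S (ℕ →₀ S) :=
  1 - (blockMod S n).subtype ∘ₗ Finsupp.restrictDom S S (Set.Iio n)
    + (blockMod S n).subtype ∘ₗ A ∘ₗ Finsupp.restrictDom S S (Set.Iio n)

theorem blockExtend_apply {n : ℕ} (A : Module.End S (blockMod S n)) (v : blockMod S n) :
    blockExtend n A v = A v := by
  have h : Finsupp.restrictDom S S (Set.Iio n) (v : ℕ →₀ S) = v := by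
    refine Subtype.ext ?_
    rw [Finsupp.restrictDom_apply]
    exact Finsupp.filter_eq_self_iff _ _ |>.2 fun i hi => by
      by_contra hc
      exact hi (mem_blockMod.1 v.2 i (not_lt.1 hc))
  simp [blockExtend, h]

theorem blockExtend_single {n : ℕ} (A : Module.End S (blockMod S n)) {j : ℕ} (hj : n ≤ j) :
    blockExtend n A (Finsupp.single j 1) = Finsupp.single j 1 := by
  have h : Finsupp.restrictDom S S (Set.Iio n) (Finsupp.single j (1 : S)) = 0 := by
    refine Subtype.ext ?_
    rw [Finsupp.restrictDom_apply]
    exact Finsupp.filter_single_of_neg _ (not_lt.2 hj)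
  simp [blockExtend, h]

theorem blockExtend_comp {n : ℕ} {A B : Module.End S (blockMod S n)} (h : A * B = 1) :
    blockExtend n A * blockExtend n B = 1 := by
  refine Finsupp.lhom_ext' fun j => LinearMap.ext_ring ?_
  change blockExtend n A (blockExtend n B (Finsupp.single j 1)) = Finsupp.single j 1
  by_cases hj : n ≤ j
  · rw [blockExtend_single B hj, blockExtend_single A hj]
  · have := blockExtend_apply B ⟨_, Finsupp.single_mem_supported S 1 (not_le.1 hj)⟩
    rw [this, blockExtend_apply]
    exact congrArg Subtype.val (DFunLike.congr_fun h _)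

/-- The element of `GLₙ(S)` given by an automorphism of `Sⁿ`. -/
def blockAut {n : ℕ} (e : blockMod S n ≃ₗ[S] blockMod S n) : AutInf S where
  val := blockExtend n e
  inv := blockExtend n e.symm
  val_inv := blockExtend_comp (LinearMap.ext e.apply_symm_apply)
  inv_val := blockExtend_comp (LinearMap.ext e.symm_apply_apply)

theorem blockAut_apply {n : ℕ} (e : blockMod S n ≃ₗ[S] blockMod S n) (v : blockMod S n) :
    (blockAut e).toEnd v = e v := blockExtend_apply _ v

theorem blockAut_single {n : ℕ} (e : blockMod S n ≃ₗ[S] blockMod S n) {j : ℕ} (hj : n ≤ j) :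
    (blockAut e).toEnd (Finsupp.single j 1) = Finsupp.single j 1 := blockExtend_single _ hj

theorem blockAut_isBlock {n : ℕ} (e : blockMod S n ≃ₗ[S] blockMod S n) :
    (blockAut e).IsBlock n := by
  intro i j hij
  by_cases hj : n ≤ j
  · rw [AutInf.entry, blockAut_single e hj, Finsupp.single_apply]
    simp [eq_comm]
  · have hi : n ≤ i := hij.resolve_right hj
    have := blockAut_apply e ⟨_, Finsupp.single_mem_supported S 1 (not_le.1 hj)⟩
    rw [AutInf.entry, this, mem_blockMod.1 (Subtype.property _) i hi, if_neg (by omega)]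

theorem mem_smul_blockMod {n : ℕ} {M : Ideal S} {v : blockMod S n} :
    v ∈ M • (⊤ : Submodule S (blockMod S n)) ↔ ∀ i, (v : ℕ →₀ S) i ∈ M := by
  constructor
  · intro hv i
    refine Submodule.smul_induction_on hv (fun s hs v _ => ?_) (fun v w hv hw => ?_)
    · exact M.mul_mem_right _ hs
    · exact add_mem hv hw
  · intro h
    have hv : v = ∑ i ∈ (v : ℕ →₀ S).support.attach, (v : ℕ →₀ S) i •
        (⟨Finsupp.single (i : ℕ) 1, Finsupp.single_mem_supported S 1
          (v.2 i.2)⟩ : blockMod S n) := by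
      refine Subtype.ext ?_
      rw [Submodule.coe_sum]
      conv_lhs => rw [← Finsupp.sum_single (v : ℕ →₀ S), Finsupp.sum, ← Finset.sum_attach]
      refine Finset.sum_congr rfl fun i _ => ?_
      simp
    rw [hv]
    exact sum_mem fun i _ => Submodule.smul_mem_smul (h i) Submodule.mem_top

variable {G : Type*} [Group G] [MulSemiringAction G S]

theorem AutInf.smul_toEnd_smul (g : G) (u : AutInf S) (v : ℕ →₀ S) :
    (g • u).toEnd (g • v) = g • u.toEnd v := by
  have h : ∀ w : ℕ →₀ S, g • w = Finsupp.mapRange (MulSemiringAction.toRingHom G S g)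
      (map_zero _) w := fun w => Finsupp.ext fun i => rfl
  rw [h v, h (u.toEnd v), AutInf.smul_def, AutInf.toEnd_map, endBaseChange_mapRange]

theorem smul_mem_blockMod {n : ℕ} (g : G) {v : ℕ →₀ S} (hv : v ∈ blockMod S n) :
    g • v ∈ blockMod S n := mem_blockMod.2 fun i hi => by
  rw [Finsupp.smul_apply, mem_blockMod.1 hv i hi, smul_zero]

theorem Cocycle.apply_one {X : Type*} [Group X] [MulDistribMulAction G X] (d : Cocycle G X) :
    d 1 = 1 := by
  simpa using d.map_mul' 1 1

/-- All values of the cocycle `d` are in `GLₙ(S)`. -/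
def Cocycle.IsBlock (n : ℕ) (d : Cocycle G (GLInf S)) : Prop :=
  ∀ g, (d g : AutInf S).IsBlock n

theorem Cocycle.IsBlock.mono {n m : ℕ} (h : n ≤ m) {d : Cocycle G (GLInf S)} (hd : d.IsBlock n) :
    d.IsBlock m := fun g => (hd g).mono h

theorem Cocycle.toEnd_mul (d : Cocycle G (GLInf S)) (g h : G) (v : ℕ →₀ S) :
    (d (g * h) : AutInf S).toEnd v =
      (h⁻¹ • (d g : AutInf S)).toEnd ((d h : AutInf S).toEnd v) := by
  rw [d.map_mul', Subgroup.coe_mul, map_mul]; rfl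

open SemilinearAction

/-- The action `v ↦ g (d(g) v)` of `G` on `Sⁿ` that is given by a cocycle `d` with values in
`GLₙ(S)`. -/
def blockAction {n : ℕ} {d : Cocycle G (GLInf S)} (hd : d.IsBlock n) :
    SemilinearAction G S (blockMod S n) where
  toEnd :=
    { toFun := fun g =>
        { toFun := fun v => ⟨g • (d g : AutInf S).toEnd v,
            smul_mem_blockMod g ((hd g).apply_mem v.2)⟩
          map_zero' := Subtype.ext (by simp)
          map_add' := fun v w => Subtype.ext (by simp) }
      map_one' := AddMonoidHom.ext fun v => Subtype.ext (by
        change (1 : G) • (d 1 : AutInf S).toEnd v = v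
        rw [d.apply_one, one_smul, Subgroup.coe_one, map_one]; rfl)
      map_mul' := fun g h => AddMonoidHom.ext fun v => Subtype.ext (by
        change (g * h) • (d (g * h) : AutInf S).toEnd v =
          g • (d g : AutInf S).toEnd (h • (d h : AutInf S).toEnd v)
        rw [d.toEnd_mul, mul_smul, ← AutInf.smul_toEnd_smul, smul_inv_smul]) }
  map_smul' g s v := Subtype.ext (by
    change g • (d g : AutInf S).toEnd (s • (v : ℕ →₀ S)) = (g • s) • g • (d g : AutInf S).toEnd v
    rw [map_smul]
    ext i
    simp [smul_mul'])

theorem coe_blockAction {n : ℕ} {d : Cocycle G (GLInf S)} (hd : d.IsBlock n) (g : G)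
    (v : blockMod S n) : (blockAction hd g v : ℕ →₀ S) = g • (d g : AutInf S).toEnd v := rfl

/-- The invariants are the solutions of `d(g) v = v ^ g`. -/
theorem mem_invariants_blockAction {n : ℕ} {d : Cocycle G (GLInf S)} (hd : d.IsBlock n)
    {v : blockMod S n} :
    v ∈ (blockAction hd).invariants ↔ ∀ g, (d g : AutInf S).toEnd v = g⁻¹ • (v : ℕ →₀ S) :=
  forall_congr' fun g => by rw [Subtype.ext_iff, coe_blockAction, ← eq_inv_smul_iff]

/-- The values of `d` on the inertia group of any maximal ideal `M` are trivial modulo `M`. -/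
def Cocycle.InertiallyTrivial (d : Cocycle G (GLInf S)) : Prop :=
  ∀ M : Ideal S, M.IsMaximal → ∀ g ∈ M.inertia G,
    AutInf.map (Ideal.Quotient.mk M) (d g : AutInf S) = 1

theorem inertiallyTrivial_blockAction {n : ℕ} {d : Cocycle G (GLInf S)} (hd : d.IsBlock n) :
    (blockAction hd).InertiallyTrivial ↔ d.InertiallyTrivial := by
  have key : ∀ (M : Ideal S), ∀ g ∈ M.inertia G, ∀ s t : S, g • s - t ∈ M ↔ s - t ∈ M := by
    intro M g hg s t
    rw [← sub_add_sub_cancel (g • s) s t]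
    exact M.add_mem_iff_right (hg s)
  constructor
  · intro h M hM g hg
    refine ((hd g).map _).ext (AutInf.isBlock_one n) fun v hv => ?_
    rw [← Finsupp.sum_single v, map_finsuppSum, map_finsuppSum]
    refine Finset.sum_congr rfl fun j hj => ?_
    have hs : Finsupp.single j (v j) = v j • Finsupp.mapRange (Ideal.Quotient.mk M) (map_zero _)
        (Finsupp.single j (1 : S)) := by simp
    dsimp only
    rw [hs, map_smul, map_smul, AutInf.toEnd_map, endBaseChange_mapRange]
    congr 1
    ext i
    have := mem_smul_blockMod.1 (h M hM g hg ⟨Finsupp.single j 1,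
      Finsupp.single_mem_supported S 1 (hv hj)⟩) i
    rw [AddSubgroupClass.coe_sub, coe_blockAction, Finsupp.sub_apply, Finsupp.smul_apply,
      key M g hg] at this
    rw [Finsupp.mapRange_apply, map_one, Module.End.one_apply, Finsupp.mapRange_apply]
    exact Ideal.Quotient.eq.2 this
  · intro h M hM g hg v
    refine mem_smul_blockMod.2 fun i => ?_
    rw [AddSubgroupClass.coe_sub, coe_blockAction, Finsupp.sub_apply, Finsupp.smul_apply,
      key M g hg, ← Ideal.Quotient.eq]
    have := endBaseChange_mapRange (Ideal.Quotient.mk M) (d g : AutInf S).toEnd v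
    rw [← AutInf.toEnd_map, h M hM g hg, map_one, Module.End.one_apply] at this
    simpa using (DFunLike.congr_fun this i).symm

/-- Every semilinear action on `Sⁿ` comes from a cocycle with values in `GLₙ(S)`. -/
theorem exists_blockAction_eq {n : ℕ} (τ : SemilinearAction G S (blockMod S n)) :
    ∃ (d : Cocycle G (GLInf S)) (hd : d.IsBlock n), blockAction hd = τ := by
  have hsmul : ∀ (g : G) (s : S) (v : ℕ →₀ S), g • s • v = (g • s) • g • v := by
    intro g s v; ext i; simp [smul_mul']
  let A : G → (blockMod S n ≃ₗ[S] blockMod S n) := fun g =>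
    { toFun := fun v => ⟨g⁻¹ • (τ g v : ℕ →₀ S), smul_mem_blockMod _ (Subtype.property _)⟩
      invFun := fun v => τ g⁻¹ ⟨g • (v : ℕ →₀ S), smul_mem_blockMod _ v.2⟩
      map_add' := fun v w => Subtype.ext (by simp)
      map_smul' := fun s v => Subtype.ext (by
        rw [τ.apply_smul]
        change g⁻¹ • (g • s) • (τ g v : ℕ →₀ S) = s • g⁻¹ • (τ g v : ℕ →₀ S)
        rw [hsmul, inv_smul_smul])
      left_inv := fun v => by
        simp only [smul_inv_smul, Subtype.coe_eta, τ.inv_apply_apply]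
      right_inv := fun v => by
        simp only [τ.apply_inv_apply, inv_smul_smul, Subtype.coe_eta] }
  have hA : ∀ g (v : blockMod S n), (blockAut (A g)).toEnd v = g⁻¹ • (τ g v : ℕ →₀ S) :=
    fun g v => blockAut_apply (A g) v
  let d : Cocycle G (GLInf S) :=
    { toFun := fun g => ⟨blockAut (A g), mem_GLInf_of_isBlock (blockAut_isBlock (A g))⟩
      map_mul' := fun g h => Subtype.ext (by
        refine (blockAut_isBlock (A (g * h))).ext
          (((blockAut_isBlock (A g)).map _).mul (blockAut_isBlock (A h))) fun v hv => ?_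
        change (blockAut (A (g * h))).toEnd v =
          ((h⁻¹ • blockAut (A g)) * blockAut (A h)).toEnd v
        lift v to blockMod S n using hv
        rw [map_mul, Module.End.mul_apply, hA, hA, AutInf.smul_toEnd_smul, hA, τ.apply_mul,
          mul_inv_rev, mul_smul]) }
  refine ⟨d, fun g => blockAut_isBlock (A g), ?_⟩
  have : (blockAction (d := d) fun g => blockAut_isBlock (A g)).toEnd = τ.toEnd := by
    refine MonoidHom.ext fun g => AddMonoidHom.ext fun v => Subtype.ext ?_
    change g • (blockAut (A g)).toEnd v = _
    rw [hA, smul_inv_smul]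
    rfl
  cases τ
  cases h : blockAction (d := d) fun g => blockAut_isBlock (A g)
  rw [h] at this
  congr

/-- Cocycles whose actions on `Sⁿ` are isomorphic are cohomologous. -/
theorem mk_eq_of_equiv {n : ℕ} {d e : Cocycle G (GLInf S)} (hd : d.IsBlock n) (he : e.IsBlock n)
    (x : blockMod S n ≃ₗ[S] blockMod S n)
    (hx : ∀ g v, x (blockAction he g v) = blockAction hd g (x v)) : H1.mk d = H1.mk e := by
  refine H1.mk_eq_mk.2 ⟨⟨blockAut x, mem_GLInf_of_isBlock (blockAut_isBlock x)⟩, fun g => ?_⟩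
  rw [eq_mul_inv_iff_mul_eq]
  refine Subtype.ext (((hd g).mul (blockAut_isBlock x)).ext
    (((blockAut_isBlock x).map _).mul (he g)) fun v hv => ?_)
  lift v to blockMod S n using hv
  have h := congrArg Subtype.val (hx g v)
  rw [← blockAut_apply, coe_blockAction, coe_blockAction, ← inv_smul_eq_iff,
    ← AutInf.smul_toEnd_smul, inv_smul_smul, ← blockAut_apply] at h
  rw [map_mul, Module.End.mul_apply, ← h, Subgroup.coe_mul, map_mul, Module.End.mul_apply]
  rfl

end Blocks

/-! ### The module attached to a cocycle -/

section Forms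

open SemilinearAction

variable {S : Type*} [CommRing S] {G : Type*} [Group G] [MulSemiringAction G S]

/-- The `S^G`-module `{v ∈ Sⁿ | d(g) v = v ^ g}` of a cocycle `d` with values in `GLₙ(S)`. -/
abbrev formMod {n : ℕ} {d : Cocycle G (GLInf S)} (hd : d.IsBlock n) :
    Submodule (FixedPoints.subring S G) (blockMod S n) := (blockAction hd).invariants

section

variable {n : ℕ} {d : Cocycle G (GLInf S)} (hd : d.IsBlock n)

/-- The element of `formMod hd` given by a solution of its defining equations. -/
def formMk (v : ℕ →₀ S) (hv : v ∈ blockMod S n)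
    (h : ∀ g, (d g : AutInf S).toEnd v = g⁻¹ • v) : formMod hd :=
  ⟨⟨v, hv⟩, (mem_invariants_blockAction hd).2 h⟩

@[simp] theorem coe_formMk (v : ℕ →₀ S) (hv : v ∈ blockMod S n)
    (h : ∀ g, (d g : AutInf S).toEnd v = g⁻¹ • v) : (formMk hd v hv h : blockMod S n).1 = v := rfl

theorem formMod_ext {v w : formMod hd} (h : v.1.1 = w.1.1) : v = w :=
  Subtype.ext (Subtype.ext h)

theorem toEnd_formMod (v : formMod hd) (g : G) : (d g : AutInf S).toEnd v.1.1 = g⁻¹ • v.1.1 :=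
  (mem_invariants_blockAction hd).1 v.2 g

end

/-- Cohomologous cocycles have isomorphic modules. -/
theorem nonempty_formMod_equiv_of_cohomologous {n : ℕ} {d e : Cocycle G (GLInf S)}
    (hd : d.IsBlock n) (he : e.IsBlock n) {x : GLInf S} (hx : (x : AutInf S).IsBlock n)
    (h : ∀ g, d g = (g⁻¹ • x) * e g * x⁻¹) :
    Nonempty (formMod he ≃ₗ[FixedPoints.subring S G] formMod hd) := by
  have h1 : ∀ g (v : ℕ →₀ S), (d g : AutInf S).toEnd ((x : AutInf S).toEnd v) =
      (g⁻¹ • (x : AutInf S)).toEnd ((e g : AutInf S).toEnd v) := by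
    intro g v
    have hg : d g * x = (g⁻¹ • x) * e g := by rw [h g, inv_mul_cancel_right]
    have := congrArg (fun u : GLInf S => (u : AutInf S).toEnd v) hg
    simpa only [Subgroup.coe_mul, coe_smul_subgroup, map_mul, Module.End.mul_apply] using this
  have hr : ∀ (u : AutInf S) (r : FixedPoints.subring S G) (v : ℕ →₀ S),
      u.toEnd (r • v) = r • u.toEnd v := fun u r v => map_smul u.toEnd (r : S) v
  refine ⟨LinearEquiv.ofBijective
    { toFun := fun v => formMk hd ((x : AutInf S).toEnd v.1.1) (hx.apply_mem v.1.2) fun g => by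
        rw [h1, toEnd_formMod he, AutInf.smul_toEnd_smul]
      map_add' := fun v w => formMod_ext hd (map_add _ _ _)
      map_smul' := fun r v => formMod_ext hd (by exact hr (x : AutInf S) r v.1.1) } ⟨?_, ?_⟩⟩
  · intro v w hvw
    have := congrArg (fun u : formMod hd => (x : AutInf S)⁻¹.toEnd u.1.1) hvw
    simp only [LinearMap.coe_mk, AddHom.coe_mk, coe_formMk, AutInf.toEnd_inv_apply] at this
    exact formMod_ext he this
  · intro v
    refine ⟨formMk he ((x : AutInf S)⁻¹.toEnd v.1.1) (hx.inv.apply_mem v.1.2) fun g => ?_,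
      formMod_ext hd (AutInf.toEnd_apply_inv _ _)⟩
    have h2 := h1 g ((x : AutInf S)⁻¹.toEnd v.1.1)
    rw [AutInf.toEnd_apply_inv, toEnd_formMod hd] at h2
    have h3 := congrArg (g⁻¹ • (x : AutInf S))⁻¹.toEnd h2
    rw [AutInf.toEnd_inv_apply, ← smul_inv', AutInf.smul_toEnd_smul] at h3
    exact h3.symm

/-- Enlarging the block size adds a free summand. -/
theorem nonempty_formMod_add_equiv {n k : ℕ} {d : Cocycle G (GLInf S)} (hd : d.IsBlock n)
    (hd' : d.IsBlock (n + k)) :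
    Nonempty (formMod hd' ≃ₗ[FixedPoints.subring S G]
      formMod hd × (Fin k → FixedPoints.subring S G)) := by
  let t : (Fin k → FixedPoints.subring S G) → (ℕ →₀ S) := fun r =>
    Finsupp.onFinset (Finset.range (n + k))
      (fun i => if h : n ≤ i ∧ i < n + k then (r ⟨i - n, by omega⟩ : S) else 0) (fun i hi => by
        by_contra hc
        rw [Finset.mem_range] at hc
        exact hi (dif_neg (by omega)))
  have ht : ∀ r i, t r i =
      if h : n ≤ i ∧ i < n + k then (r ⟨i - n, by omega⟩ : S) else 0 := fun r i => rfl
  have ht0 : ∀ r, ∀ i < n, t r i = 0 := fun r i hi => by rw [ht, dif_neg (by omega)]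
  have ht1 : ∀ r (i : Fin k), t r (n + i) = r i := fun r i => by
    rw [ht, dif_pos (by omega)]
    congr
    omega
  have htg : ∀ r (g : G), g • t r = t r := by
    intro r g
    ext i
    rw [Finsupp.smul_apply, ht]
    split_ifs with h
    · exact (r _).2 g
    · exact smul_zero g
  refine ⟨(LinearEquiv.ofBijective
    { toFun := fun v => formMk hd' (v.1.1.1 + t v.2)
        (mem_blockMod.2 fun i hi => by
          rw [Finsupp.add_apply, mem_blockMod.1 v.1.1.2 i (by omega), ht, dif_neg (by omega),
            add_zero])
        (fun g => by
          rw [map_add, toEnd_formMod hd, (hd g).apply_eq (ht0 _), smul_add, htg])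
      map_add' := fun v w => formMod_ext hd' (by
        have : t (v.2 + w.2) = t v.2 + t w.2 := by
          ext i
          rw [Finsupp.add_apply, ht, ht, ht]
          split_ifs
          · rfl
          · rw [add_zero]
        change v.1.1.1 + w.1.1.1 + t (v.2 + w.2) = (v.1.1.1 + t v.2) + (w.1.1.1 + t w.2)
        rw [this]; abel)
      map_smul' := fun r v => formMod_ext hd' (by
        have : t (r • v.2) = r • t v.2 := by
          ext i
          rw [Finsupp.smul_apply, ht, ht]
          split_ifs
          · rfl
          · rw [smul_zero]
        change r • v.1.1.1 + t (r • v.2) = r • (v.1.1.1 + t v.2)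
        rw [this, smul_add]) } ⟨?_, ?_⟩).symm⟩
  · rintro ⟨v, r⟩ ⟨w, s⟩ h
    have h := congrArg (fun u : formMod hd' => u.1.1) h
    simp only [LinearMap.coe_mk, AddHom.coe_mk, coe_formMk] at h
    refine Prod.ext (formMod_ext hd (Finsupp.ext fun i => ?_))
      (funext fun i => Subtype.ext ?_)
    · by_cases hi : i < n
      · simpa [ht0 _ i hi] using DFunLike.congr_fun h i
      · rw [mem_blockMod.1 v.1.2 i (not_lt.1 hi), mem_blockMod.1 w.1.2 i (not_lt.1 hi)]
    · have h2 := DFunLike.congr_fun h (n + i)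
      rwa [Finsupp.add_apply, Finsupp.add_apply, mem_blockMod.1 v.1.2 _ (by omega),
        mem_blockMod.1 w.1.2 _ (by omega), zero_add, zero_add, ht1, ht1] at h2
  · intro v
    -- `v` is split into its first `n` coordinates `p` and the remaining ones `q`
    let p : ℕ →₀ S := v.1.1.filter (· < n)
    let q : ℕ →₀ S := v.1.1.filter (fun i => ¬ i < n)
    have hpq : v.1.1 = p + q := (Finsupp.filter_add_filter_not _ _).symm
    have hp : p ∈ blockMod S n := mem_blockMod.2 fun i hi =>
      Finsupp.filter_apply_neg _ _ (not_lt.2 hi)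
    have hq : ∀ i < n, q i = 0 := fun i hi => Finsupp.filter_apply_neg _ _ (not_not.2 hi)
    have hfix : ∀ g, (d g : AutInf S).toEnd p = g⁻¹ • p ∧ g⁻¹ • q = q := by
      intro g
      have h := toEnd_formMod hd' v g
      rw [hpq, map_add, (hd g).apply_eq hq, smul_add] at h
      have h1 := (hd g).apply_mem hp
      have h2 := smul_mem_blockMod g⁻¹ hp
      constructor
      · ext i
        by_cases hi : i < n
        · simpa [hq i hi] using DFunLike.congr_fun h i
        · rw [mem_blockMod.1 h1 i (not_lt.1 hi), mem_blockMod.1 h2 i (not_lt.1 hi)]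
      · ext i
        by_cases hi : i < n
        · rw [Finsupp.smul_apply, hq i hi, smul_zero]
        · have := DFunLike.congr_fun h i
          rw [Finsupp.add_apply, Finsupp.add_apply, mem_blockMod.1 h1 i (not_lt.1 hi),
            mem_blockMod.1 h2 i (not_lt.1 hi), zero_add, zero_add] at this
          exact this.symm
    have hq2 : ∀ i (g : G), g • q i = q i := fun i g => by
      have := DFunLike.congr_fun (hfix g⁻¹).2 i
      rwa [inv_inv, Finsupp.smul_apply] at this
    refine ⟨(formMk hd p hp fun g => (hfix g).1, fun i => ⟨q (n + i), hq2 _⟩),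
      formMod_ext hd' ?_⟩
    change p + t _ = _
    rw [hpq]
    congr 1
    ext i
    rw [ht]
    split_ifs with h
    · change q (n + (i - n)) = q i
      rw [Nat.add_sub_cancel' h.1]
    · by_cases hi : i < n
      · rw [hq i hi]
      · exact (by rw [← mem_blockMod.1 v.1.2 i (by omega), hpq, Finsupp.add_apply,
          mem_blockMod.1 hp i (by omega), zero_add])

section Sum

theorem AutInf.place_mapDomain (ι : ℕ ↪ ℕ) (u : AutInf S) (v : ℕ →₀ S) :
    (AutInf.place ι u).toEnd (Finsupp.mapDomain ι v) = Finsupp.mapDomain ι (u.toEnd v) := by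
  have h : Finsupp.comapDomain ι (Finsupp.mapDomain ι v) ι.injective.injOn = v :=
    Finsupp.comapDomain_mapDomain _ ι.injective _
  have h2 : ∀ w : ℕ →₀ S, Finsupp.mapDomain ι w = Finsupp.lmapDomain S S ι w := fun _ => rfl
  rw [AutInf.toEnd_place, h, h2, h2, h2, map_sub]
  abel

theorem AutInf.place_mapDomain_of_disjoint {ι κ : ℕ ↪ ℕ} (h : ∀ i j, ι i ≠ κ j) (u : AutInf S)
    (v : ℕ →₀ S) :
    (AutInf.place ι u).toEnd (Finsupp.mapDomain κ v) = Finsupp.mapDomain κ v := by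
  have h0 : Finsupp.comapDomain ι (Finsupp.mapDomain κ v) ι.injective.injOn = 0 := by
    ext i
    rw [Finsupp.comapDomain_apply, Finsupp.mapDomain_of_notMem_range]
    · rfl
    · rintro ⟨a, ha⟩; exact h i a ha.symm
  rw [AutInf.toEnd_place, h0, map_zero, sub_zero, Finsupp.mapDomain_zero, add_zero]

theorem AutInf.IsBlock.place {n m : ℕ} {u : AutInf S} (hu : u.IsBlock n) (ι : ℕ ↪ ℕ)
    (h : ∀ i, ι i < m ∨ n ≤ i) : (AutInf.place ι u).IsBlock m := by
  intro i j hij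
  by_cases hr : i ∉ Set.range ι ∨ j ∉ Set.range ι
  · exact AutInf.entry_place_of_notMem ι u hr
  · push Not at hr
    obtain ⟨⟨i, rfl⟩, ⟨j, rfl⟩⟩ := hr
    rw [AutInf.entry_place, hu i j]
    · simp
    · rcases hij with hi | hj
      · exact Or.inl ((h i).resolve_left (by omega))
      · exact Or.inr ((h j).resolve_left (by omega))

theorem Cocycle.IsBlock.sum {n : ℕ} {d e : Cocycle G (GLInf S)} (hd : d.IsBlock n)
    (he : e.IsBlock n) : (d.sum e).IsBlock (n + n) := fun g => by
  rw [Cocycle.coe_sum]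
  refine ((hd g).place _ fun i => ?_).mul ((he g).place _ fun i => ?_)
  · rw [evenEmb_apply]; omega
  · rw [oddEmb_apply]; omega

theorem Cocycle.InertiallyTrivial.sum {d e : Cocycle G (GLInf S)} (ht : d.InertiallyTrivial)
    (ht' : e.InertiallyTrivial) :
    (d.sum e).InertiallyTrivial := fun M hM g hg => by
  rw [Cocycle.coe_sum, map_mul, AutInf.map_place, AutInf.map_place, ht M hM g hg,
    ht' M hM g hg, map_one, map_one, mul_one]

theorem exists_mapDomain_even_add_odd (z : ℕ →₀ S) : ∃ v w : ℕ →₀ S,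
    Finsupp.mapDomain evenEmb v + Finsupp.mapDomain oddEmb w = z ∧
      (∀ i, v i = z (2 * i)) ∧ ∀ i, w i = z (2 * i + 1) := by
  refine ⟨Finsupp.comapDomain evenEmb z evenEmb.injective.injOn,
    Finsupp.comapDomain oddEmb z oddEmb.injective.injOn, ?_, fun i => ?_, fun i => ?_⟩
  · ext i
    rw [Finsupp.add_apply]
    rcases Nat.even_or_odd' i with ⟨a, rfl | rfl⟩
    · rw [← evenEmb_apply, Finsupp.mapDomain_apply evenEmb.injective,
        Finsupp.mapDomain_of_notMem_range, Finsupp.comapDomain_apply, add_zero]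
      rintro ⟨b, hb⟩; exact even_ne_odd a b hb.symm
    · rw [← oddEmb_apply, Finsupp.mapDomain_apply oddEmb.injective,
        Finsupp.mapDomain_of_notMem_range, Finsupp.comapDomain_apply, zero_add]
      rintro ⟨b, hb⟩; exact even_ne_odd b a hb
  · rw [Finsupp.comapDomain_apply, evenEmb_apply]
  · rw [Finsupp.comapDomain_apply, oddEmb_apply]

theorem mapDomain_even_add_odd_injective {v w v' w' : ℕ →₀ S}
    (h : Finsupp.mapDomain evenEmb v + Finsupp.mapDomain oddEmb w =
      Finsupp.mapDomain evenEmb v' + Finsupp.mapDomain oddEmb w') : v = v' ∧ w = w' := by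
  have hne : ∀ i, evenEmb i ∉ Set.range oddEmb := fun i ⟨b, hb⟩ => even_ne_odd i b hb.symm
  have hno : ∀ i, oddEmb i ∉ Set.range evenEmb := fun i ⟨b, hb⟩ => even_ne_odd b i hb
  constructor
  · ext i
    have := DFunLike.congr_fun h (evenEmb i)
    simpa only [Finsupp.add_apply, Finsupp.mapDomain_apply evenEmb.injective,
      Finsupp.mapDomain_of_notMem_range _ _ (hne i), add_zero] using this
  · ext i
    have := DFunLike.congr_fun h (oddEmb i)
    simpa only [Finsupp.add_apply, Finsupp.mapDomain_apply oddEmb.injective,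
      Finsupp.mapDomain_of_notMem_range _ _ (hno i), zero_add] using this

theorem smul_mapDomain {M : Type*} [DistribSMul M S] (r : M) (ι : ℕ ↪ ℕ) (v : ℕ →₀ S) :
    Finsupp.mapDomain ι (r • v) = r • Finsupp.mapDomain ι v := Finsupp.mapDomain_smul r v

theorem Cocycle.toEnd_sum (d e : Cocycle G (GLInf S)) (g : G) (v w : ℕ →₀ S) :
    (d.sum e g : AutInf S).toEnd (Finsupp.mapDomain evenEmb v + Finsupp.mapDomain oddEmb w) =
      Finsupp.mapDomain evenEmb ((d g : AutInf S).toEnd v) +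
        Finsupp.mapDomain oddEmb ((e g : AutInf S).toEnd w) := by
  rw [Cocycle.coe_sum, map_mul, Module.End.mul_apply, map_add, map_add,
    AutInf.place_mapDomain_of_disjoint fun i j => (even_ne_odd j i).symm,
    AutInf.place_mapDomain, AutInf.place_mapDomain,
    AutInf.place_mapDomain_of_disjoint even_ne_odd]

theorem mapDomain_even_add_odd_mem {n : ℕ} {v w : ℕ →₀ S} (hv : v ∈ blockMod S n)
    (hw : w ∈ blockMod S n) :
    Finsupp.mapDomain evenEmb v + Finsupp.mapDomain oddEmb w ∈ blockMod S (n + n) :=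
  mem_blockMod.2 fun i hi => by
    rw [Finsupp.add_apply]
    rcases Nat.even_or_odd' i with ⟨a, rfl | rfl⟩
    · rw [← evenEmb_apply, Finsupp.mapDomain_apply evenEmb.injective,
        Finsupp.mapDomain_of_notMem_range, mem_blockMod.1 hv a (by omega), add_zero]
      rintro ⟨b, hb⟩; exact even_ne_odd a b hb.symm
    · rw [← oddEmb_apply, Finsupp.mapDomain_apply oddEmb.injective,
        Finsupp.mapDomain_of_notMem_range, mem_blockMod.1 hw a (by omega), zero_add]
      rintro ⟨b, hb⟩; exact even_ne_odd b a hb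

/-- The map `(v, w) ↦ v ⊕ w` to the module of a block sum. -/
def formSum {n : ℕ} {d e : Cocycle G (GLInf S)} (hd : d.IsBlock n) (he : e.IsBlock n) :
    formMod hd × formMod he →ₗ[FixedPoints.subring S G] formMod (hd.sum he) where
  toFun v := formMk (hd.sum he)
    (Finsupp.mapDomain evenEmb v.1.1.1 + Finsupp.mapDomain oddEmb v.2.1.1)
    (mapDomain_even_add_odd_mem v.1.1.2 v.2.1.2)
    (fun g => by
      rw [Cocycle.toEnd_sum, toEnd_formMod hd, toEnd_formMod he, smul_add, smul_mapDomain,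
        smul_mapDomain])
  map_add' v w := formMod_ext _ (by
    change Finsupp.mapDomain evenEmb (v.1.1.1 + w.1.1.1) +
        Finsupp.mapDomain oddEmb (v.2.1.1 + w.2.1.1) =
      (Finsupp.mapDomain evenEmb v.1.1.1 + Finsupp.mapDomain oddEmb v.2.1.1) +
        (Finsupp.mapDomain evenEmb w.1.1.1 + Finsupp.mapDomain oddEmb w.2.1.1)
    rw [Finsupp.mapDomain_add, Finsupp.mapDomain_add]; abel)
  map_smul' r v := formMod_ext _ (by
    change Finsupp.mapDomain evenEmb (r • v.1.1.1) + Finsupp.mapDomain oddEmb (r • v.2.1.1) =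
      r • (Finsupp.mapDomain evenEmb v.1.1.1 + Finsupp.mapDomain oddEmb v.2.1.1)
    rw [smul_mapDomain, smul_mapDomain, smul_add])

theorem formSum_bijective {n : ℕ} {d e : Cocycle G (GLInf S)} (hd : d.IsBlock n)
    (he : e.IsBlock n) : Function.Bijective (formSum hd he) := by
  constructor
  · rintro ⟨v, w⟩ ⟨v', w'⟩ h
    have h := mapDomain_even_add_odd_injective
      (congrArg (fun u : formMod (hd.sum he) => u.1.1) h)
    exact Prod.ext (formMod_ext hd h.1) (formMod_ext he h.2)
  · intro z
    have key : ∃ (v : formMod hd) (w : formMod he),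
        Finsupp.mapDomain evenEmb v.1.1 + Finsupp.mapDomain oddEmb w.1.1 = z.1.1 := by
      obtain ⟨v, w, hz, hv, hw⟩ := exists_mapDomain_even_add_odd z.1.1
      have hfix : ∀ g, (d g : AutInf S).toEnd v = g⁻¹ • v ∧
          (e g : AutInf S).toEnd w = g⁻¹ • w := fun g =>
        mapDomain_even_add_odd_injective (by
          rw [← Cocycle.toEnd_sum, hz, toEnd_formMod, smul_mapDomain, smul_mapDomain,
            ← smul_add, hz])
      have hvn : v ∈ blockMod S n := mem_blockMod.2 fun i hi => by
        rw [hv, mem_blockMod.1 z.1.2 _ (by omega)]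
      have hwn : w ∈ blockMod S n := mem_blockMod.2 fun i hi => by
        rw [hw, mem_blockMod.1 z.1.2 _ (by omega)]
      exact ⟨formMk hd v hvn fun g => (hfix g).1, formMk he w hwn fun g => (hfix g).2, hz⟩
    obtain ⟨v, w, h⟩ := key
    exact ⟨(v, w), formMod_ext _ h⟩

/-- The module of a block sum is the direct sum of the modules. -/
theorem nonempty_formMod_sum_equiv {n : ℕ} {d e : Cocycle G (GLInf S)} (hd : d.IsBlock n)
    (he : e.IsBlock n) :
    Nonempty (formMod (hd.sum he) ≃ₗ[FixedPoints.subring S G] formMod hd × formMod he) :=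
  ⟨(LinearEquiv.ofBijective _ (formSum_bijective hd he)).symm⟩

end Sum
end Forms

/-! ### The kernels of restriction and reduction -/

section Kernels

variable {S : Type*} [CommRing S]

theorem AutInf.map_eq_one_iff {S' : Type*} [CommRing S'] (φ : S →+* S') (u : AutInf S) :
    AutInf.map φ u = 1 ↔ ∀ i j, u.entry i j - (1 : AutInf S).entry i j ∈ RingHom.ker φ := by
  constructor
  · intro h i j
    rw [RingHom.mem_ker, map_sub, ← AutInf.entry_map, ← AutInf.entry_map, h, map_one, sub_self]
  · intro h
    refine AutInf.ext_entry fun i j => ?_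
    have := h i j
    rw [RingHom.mem_ker, map_sub, sub_eq_zero, ← AutInf.entry_map, ← AutInf.entry_map,
      map_one] at this
    exact this

variable {G : Type*} [Group G] [MulSemiringAction G S]

theorem toFactor_eq_zero_iff {H : Subgroup G} {s : S} :
    s ∈ RingHom.ker (toFactor S H) ↔ s ∈ inertiaRadical S H :=
  (RingHom.mem_ker).trans Ideal.Quotient.eq_zero_iff_mem

theorem AutInf.map_toFactor_eq_one_iff {H : Subgroup G} {u : AutInf S} :
    AutInf.map (toFactor S H) u = 1 ↔
      ∀ M : Ideal S, M.IsMaximal → H ≤ M.inertia G → AutInf.map (Ideal.Quotient.mk M) u = 1 := by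
  simp only [AutInf.map_eq_one_iff, toFactor_eq_zero_iff, mem_inertiaRadical, Ideal.mk_ker]
  exact ⟨fun h M hM hH i j => h i j ⟨M, hM⟩ hH, fun h i j M hH => h M.1 M.2 hH i j⟩

theorem smul_factor (H : Subgroup G) (h : H) (x : FactorRing S H) : h • x = x := by
  obtain ⟨s, rfl⟩ := toFactor_surjective S H x
  rw [smul_toFactor, toFactor_smul]

/-- The values of `d` on the inertia group of any maximal ideal `M` are trivial modulo `M`. -/
def UnitsInertiallyTrivial (d : Cocycle G Sˣ) : Prop :=
  ∀ M : Ideal S, M.IsMaximal → ∀ g ∈ M.inertia G, ((d g : Sˣ) : S) - 1 ∈ M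

theorem mk_mem_ker_resRedUnits_iff {H : Subgroup G} {d : Cocycle G Sˣ} :
    H1.mk d ∈ (resRedUnits S H).ker ↔
      ∀ h : H, ∀ M : Ideal S, M.IsMaximal → H ≤ M.inertia G → ((d h : Sˣ) : S) - 1 ∈ M := by
  rw [MonoidHom.mem_ker, DFunLike.ext_iff]
  refine forall_congr' fun h => ?_
  rw [Units.ext_iff]
  change toFactor S H (d h : Sˣ) = 1 ↔ _
  rw [← sub_eq_zero, ← map_one (toFactor S H), ← map_sub, ← RingHom.mem_ker,
    toFactor_eq_zero_iff, mem_inertiaRadical]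
  exact ⟨fun k M hM => k ⟨M, hM⟩, fun k M => k M.1 M.2⟩

theorem mk_mem_iInf_ker_cyclic_iff {d : Cocycle G Sˣ} :
    H1.mk d ∈ (⨅ C : CyclicSubgroups G, (resRedUnits S C.1).ker : Subgroup (H1 G Sˣ)) ↔
      UnitsInertiallyTrivial d := by
  simp only [Subgroup.mem_iInf, mk_mem_ker_resRedUnits_iff]
  constructor
  · intro h M hM g hg
    exact h ⟨Subgroup.zpowers g, inferInstance⟩ ⟨g, Subgroup.mem_zpowers g⟩ M hM
      (Subgroup.zpowers_le.2 hg)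
  · intro h C k M hM hC
    exact h M hM k (hC k.2)

theorem iInf_ker_cyclic_eq :
    (⨅ C : CyclicSubgroups G, (resRedUnits S C.1).ker : Subgroup (H1 G Sˣ)) =
      ⨅ H : Subgroup G, (resRedUnits S H).ker := by
  ext a
  induction a using H1.ind with | _ d =>
  rw [mk_mem_iInf_ker_cyclic_iff]
  simp only [Subgroup.mem_iInf, mk_mem_ker_resRedUnits_iff]
  constructor
  · intro h H k M hM hH
    exact h M hM k (hH k.2)
  · intro h M hM g hg
    exact h (M.inertia G) ⟨g, hg⟩ M hM le_rfl

theorem forall_cyclic_map_toFactor_eq_one_iff {d : G → AutInf S} :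
    (∀ C : CyclicSubgroups G, ∀ h : C.1, AutInf.map (toFactor S C.1) (d h) = 1) ↔
      ∀ M : Ideal S, M.IsMaximal → ∀ g ∈ M.inertia G,
        AutInf.map (Ideal.Quotient.mk M) (d g) = 1 := by
  simp only [AutInf.map_toFactor_eq_one_iff]
  constructor
  · intro h M hM g hg
    exact h ⟨Subgroup.zpowers g, inferInstance⟩ ⟨g, Subgroup.mem_zpowers g⟩ M hM
      (Subgroup.zpowers_le.2 hg)
  · intro h C k M hM hC
    exact h M hM k (hC k.2)

variable [Finite G]

/-- As `H` acts trivially on `S_H`, the restriction and reduction of a class is trivial if and only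
if the cocycle itself becomes trivial. -/
theorem mapHom_toFactor_eq_zero_iff {X : Subgroup (AutInf S)} [IsAdmissible G X] (H : Subgroup G)
    {X' : Subgroup (AutInf (FactorRing S H))} [IsAdmissible H X']
    (hφ : ∀ (g : H) (s : S), toFactor S H (H.subtype g • s) = g • toFactor S H s)
    (hX : ∀ u ∈ X, AutInf.map (toFactor S H) u ∈ X') (d : Cocycle G X) :
    H1.mapHom (X := X) (X' := X') H.subtype (toFactor S H) hφ hX (H1.mk d) = 0 ↔
      ∀ h : H, AutInf.map (toFactor S H) (d h : AutInf S) = 1 := by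
  have htriv : ∀ (h : H) (x : X'), h • x = x := fun h x =>
    Subtype.ext (AutInf.ext_entry fun i j => by
      rw [coe_smul_subgroup, AutInf.entry_smul, smul_factor])
  constructor
  · intro h k
    obtain ⟨x, hx⟩ := H1.mk_eq_mk.1 h
    have := hx k
    rw [htriv, Cocycle.one_apply, mul_one, mul_inv_cancel] at this
    exact congrArg Subtype.val this
  · intro h
    refine H1.mk_eq_mk.2 ⟨1, fun k => Subtype.ext ?_⟩
    rw [smul_one, Cocycle.one_apply, mul_one, inv_one, mul_one]
    exact h k

theorem mk_mem_mker_rho_iff {d : Cocycle G (GLInf S)} :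
    H1.mk d ∈ AddMonoidHom.mker (rho G S) ↔ d.InertiallyTrivial := by
  rw [AddMonoidHom.mem_mker, funext_iff]
  refine Iff.trans (forall_congr' fun C => ?_) forall_cyclic_map_toFactor_eq_one_iff
  exact mapHom_toFactor_eq_zero_iff C.1 (fun _ _ => rfl) (fun _ hu => GLInf.map_mem _ hu) d

theorem mk_mem_mker_sigma_iff {d : Cocycle G (SLInf S)} :
    H1.mk d ∈ AddMonoidHom.mker (sigma G S) ↔
      ∀ M : Ideal S, M.IsMaximal → ∀ g ∈ M.inertia G,
        AutInf.map (Ideal.Quotient.mk M) (d g : AutInf S) = 1 := by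
  rw [AddMonoidHom.mem_mker, funext_iff]
  refine Iff.trans (forall_congr' fun C => ?_) forall_cyclic_map_toFactor_eq_one_iff
  exact mapHom_toFactor_eq_zero_iff C.1 (fun _ _ => rfl) (fun _ hu => SLInf.map_mem _ hu) d

end Kernels

/-! ### Classes of projective modules -/

section Classes

open TensorProduct Algebra

variable (R : Type u) [CommRing R]

/-- The class of the free module of rank `n`. -/
def freeClass (n : ℕ) : IsoClass R := IsoClass.mk (Fin n → R)

variable {R}

theorem IsoClass.mk_eq_mk {P Q : Type u} [AddCommGroup P] [Module R P] [Module.Finite R P]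
    [Module.Projective R P] [AddCommGroup Q] [Module R Q] [Module.Finite R Q]
    [Module.Projective R Q] :
    (IsoClass.mk P : IsoClass R) = IsoClass.mk Q ↔ Nonempty (P ≃ₗ[R] Q) :=
  Quotient.eq (r := FGProj.setoid R)

theorem IsoClass.mk_add_mk (P Q : Type u) [AddCommGroup P] [Module R P] [Module.Finite R P]
    [Module.Projective R P] [AddCommGroup Q] [Module R Q] [Module.Finite R Q]
    [Module.Projective R Q] :
    (IsoClass.mk P + IsoClass.mk Q : IsoClass R) = IsoClass.mk (P × Q) := rfl

theorem freeClass_add (n m : ℕ) : freeClass R (n + m) = freeClass R n + freeClass R m := by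
  rw [freeClass, freeClass, freeClass, IsoClass.mk_add_mk, IsoClass.mk_eq_mk]
  exact ⟨(LinearEquiv.funCongrLeft R R finSumFinEquiv).trans
    (LinearEquiv.sumArrowLequivProdArrow _ _ R R)⟩

theorem IsoClass.exists_rep (a : IsoClass R) : ∃ P : FGProj R, IsoClass.mk P.carrier = a := by
  induction a using Quotient.inductionOn with | _ P => exact ⟨P, rfl⟩

/-- Every finitely generated projective module is a direct summand of a free module. -/
theorem IsoClass.exists_add_eq_freeClass (a : IsoClass R) : ∃ b k, a + b = freeClass R k := by
  obtain ⟨P, rfl⟩ := a.exists_rep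
  obtain ⟨k, f, i, hf, -, hfi⟩ := Module.Finite.exists_comp_eq_id_of_projective R P.carrier
  have hfi' : ∀ x, f (i x) = x := fun x => DFunLike.congr_fun hfi x
  let q : (Fin k → R) →ₗ[R] LinearMap.ker f :=
    (LinearMap.id - i ∘ₗ f).codRestrict _ fun v => by simp [hfi']
  have hq : q ∘ₗ (LinearMap.ker f).subtype = LinearMap.id := by
    ext1 v
    refine Subtype.ext ?_
    have hv : f v = 0 := v.2
    simp [q, hv]
  have hqs : Function.Surjective q := fun v => ⟨v, DFunLike.congr_fun hq v⟩
  have := Module.Finite.of_surjective q hqs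
  have := Module.Projective.of_split _ q hq
  refine ⟨IsoClass.mk (LinearMap.ker f), k, ?_⟩
  rw [IsoClass.mk_add_mk, freeClass, IsoClass.mk_eq_mk]
  refine ⟨LinearEquiv.ofLinearMap (i.coprod (LinearMap.ker f).subtype) (f.prod q) ?_ ?_⟩
  · ext1 v
    simp [q]
  · refine LinearMap.ext fun ⟨x, v⟩ => Prod.ext ?_ (Subtype.ext ?_)
    · have hv : f v = 0 := v.2
      simp [hfi', hv]
    · have hv : f v = 0 := v.2
      simp [q, hfi', hv]

/-- Classes agree in `K₀` if and only if they agree after adding a free module. -/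
theorem of_eq_of_iff {a b : IsoClass R} :
    (GrothendieckAddGroup.of a = GrothendieckAddGroup.of b) ↔
      ∃ k, a + freeClass R k = b + freeClass R k := by
  constructor
  · intro h
    obtain ⟨c, hc⟩ := (AddSubmonoid.LocalizationMap.eq_iff_exists _).1 h
    obtain ⟨c', k, hk⟩ := (c : IsoClass R).exists_add_eq_freeClass
    refine ⟨k, ?_⟩
    rw [← hk, ← add_assoc, ← add_assoc, add_comm a, add_comm b, hc]
  · rintro ⟨k, hk⟩
    have := congrArg GrothendieckAddGroup.of hk
    rw [map_add, map_add] at this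
    exact add_right_cancel this

/-- Every element of `K₀` is the difference of a class and the class of a free module. -/
theorem exists_eq_of_sub_freeClass (y : KZero R) : ∃ a n,
    y = GrothendieckAddGroup.of a - GrothendieckAddGroup.of (freeClass R n) := by
  obtain ⟨⟨a, b⟩, h⟩ := (AddLocalization.addMonoidOf (⊤ : AddSubmonoid (IsoClass R))).surj y
  obtain ⟨c, k, hk⟩ := (b : IsoClass R).exists_add_eq_freeClass
  refine ⟨a + c, k, ?_⟩
  rw [← hk, map_add, map_add, eq_sub_iff_add_eq, ← add_assoc]
  exact congrArg (· + _) h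

variable (S : Type u) [CommRing S] [Algebra R S]

theorem IsoClass.baseChange_mk (P : Type u) [AddCommGroup P] [Module R P] [Module.Finite R P]
    [Module.Projective R P] :
    IsoClass.baseChange R S (IsoClass.mk P) = IsoClass.mk (S ⊗[R] P) := rfl

theorem IsoClass.baseChange_freeClass (n : ℕ) :
    IsoClass.baseChange R S (freeClass R n) = freeClass S n := by
  rw [freeClass, IsoClass.baseChange_mk, freeClass, IsoClass.mk_eq_mk]
  exact ⟨TensorProduct.piScalarRight R S S (Fin n)⟩

theorem KZero.map_of (a : IsoClass R) : KZero.map R S (GrothendieckAddGroup.of a) =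
    GrothendieckAddGroup.of (IsoClass.baseChange R S a) := by
  rw [KZero.map]
  exact AddSubmonoid.LocalizationMap.lift_eq _ _ _

end Classes

/-! ### The kernel of `K₀(f)` -/

section KernelKZero

open SemilinearAction TensorProduct Algebra

variable {S : Type u} [CommRing S] {G : Type v} [Group G] [Fintype G] [MulSemiringAction G S]

/-- An `S^G`-module `P` with `S ⊗ P ≅ Sⁿ` comes from a cocycle. -/
theorem exists_formMod_equiv (htr : ∃ x : S, ∑ g : G, g • x = 1) {P : Type*} [AddCommGroup P]
    [Module (FixedPoints.subring S G) P] {n : ℕ}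
    (f : S ⊗[FixedPoints.subring S G] P ≃ₗ[S] blockMod S n) :
    ∃ (d : Cocycle G (GLInf S)) (hd : d.IsBlock n), d.InertiallyTrivial ∧
      Nonempty (P ≃ₗ[FixedPoints.subring S G] formMod hd) := by
  obtain ⟨j⟩ := nonempty_equiv_invariants_baseChange (G := G) (S := S) P htr
  have h1 := InertiallyTrivial.transport (N' := blockMod S n)
    (baseChange_inertiallyTrivial (G := G) (S := S) P) f
  have h2 := invariantsTransport (N' := blockMod S n) (baseChange (G := G) (S := S) P) f
  obtain ⟨d, hd, hdτ⟩ := exists_blockAction_eq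
    (transport (N' := blockMod S n) (baseChange (G := G) (S := S) P) f)
  refine ⟨d, hd, ?_, ?_⟩
  · rw [← inertiallyTrivial_blockAction hd, hdτ]
    exact h1
  · rw [formMod, hdτ]
    exact ⟨j.trans h2⟩

variable (htr : ∃ x : S, ∑ g : G, g • x = 1)

/-- The isomorphism class of the module attached to a cocycle. -/
def formClass {n : ℕ} {d : Cocycle G (GLInf S)} (hd : d.IsBlock n) (ht : d.InertiallyTrivial) :
    IsoClass (FixedPoints.subring S G) :=
  have h := finite_projective_invariants htr ((inertiallyTrivial_blockAction hd).2 ht)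
  haveI := h.1
  haveI := h.2
  IsoClass.mk (formMod hd)

variable {n m k : ℕ} {d e : Cocycle G (GLInf S)}

theorem formClass_eq_formClass_iff (hd : d.IsBlock n) (ht : d.InertiallyTrivial)
    (he : e.IsBlock m) (ht' : e.InertiallyTrivial) :
    formClass htr hd ht = formClass htr he ht' ↔
      Nonempty (formMod hd ≃ₗ[FixedPoints.subring S G] formMod he) := by
  have h := finite_projective_invariants htr ((inertiallyTrivial_blockAction hd).2 ht)
  have h' := finite_projective_invariants htr ((inertiallyTrivial_blockAction he).2 ht')
  have := h.1
  have := h.2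
  have := h'.1
  have := h'.2
  exact IsoClass.mk_eq_mk

theorem baseChange_formClass (hd : d.IsBlock n) (ht : d.InertiallyTrivial) :
    IsoClass.baseChange (FixedPoints.subring S G) S (formClass htr hd ht) = freeClass S n := by
  have h := finite_projective_invariants htr ((inertiallyTrivial_blockAction hd).2 ht)
  have := h.1
  have := h.2
  obtain ⟨f⟩ := nonempty_baseChange_invariants_equiv htr ((inertiallyTrivial_blockAction hd).2 ht)
  refine (IsoClass.baseChange_mk S (formMod hd)).trans ?_
  rw [freeClass, IsoClass.mk_eq_mk]
  exact ⟨f.trans (blockModEquiv n)⟩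

theorem formClass_add (hd : d.IsBlock n) (ht : d.InertiallyTrivial) (hm : m = n + k)
    (hd' : d.IsBlock m) :
    formClass htr hd' ht = formClass htr hd ht + freeClass (FixedPoints.subring S G) k := by
  subst hm
  have h := finite_projective_invariants htr ((inertiallyTrivial_blockAction hd).2 ht)
  have h' := finite_projective_invariants htr ((inertiallyTrivial_blockAction hd').2 ht)
  have := h.1
  have := h.2
  have := h'.1
  have := h'.2
  exact IsoClass.mk_eq_mk.2 (nonempty_formMod_add_equiv hd hd')

theorem formClass_sum (hd : d.IsBlock n) (ht : d.InertiallyTrivial) (he : e.IsBlock n)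
    (ht' : e.InertiallyTrivial) :
    formClass htr (hd.sum he) (ht.sum ht') = formClass htr hd ht + formClass htr he ht' := by
  have h := finite_projective_invariants htr ((inertiallyTrivial_blockAction hd).2 ht)
  have h' := finite_projective_invariants htr ((inertiallyTrivial_blockAction he).2 ht')
  have h'' := finite_projective_invariants htr
    ((inertiallyTrivial_blockAction (hd.sum he)).2 (ht.sum ht'))
  have := h.1
  have := h.2
  have := h'.1
  have := h'.2
  have := h''.1
  have := h''.2
  exact IsoClass.mk_eq_mk.2 (nonempty_formMod_sum_equiv hd he)

theorem mk_eq_mk_of_formClass_eq (hd : d.IsBlock n) (ht : d.InertiallyTrivial)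
    (he : e.IsBlock n) (ht' : e.InertiallyTrivial)
    (h : formClass htr hd ht = formClass htr he ht') : H1.mk d = H1.mk e := by
  obtain ⟨θ⟩ := (formClass_eq_formClass_iff htr hd ht he ht').1 h
  obtain ⟨x, hx⟩ := exists_equivariant_equiv htr ((inertiallyTrivial_blockAction he).2 ht')
    ((inertiallyTrivial_blockAction hd).2 ht) θ.symm
  exact mk_eq_of_equiv hd he x hx

theorem exists_formClass_eq {a : IsoClass (FixedPoints.subring S G)}
    (ha : IsoClass.baseChange (FixedPoints.subring S G) S a = freeClass S n) :
    ∃ (d : Cocycle G (GLInf S)) (hd : d.IsBlock n) (ht : d.InertiallyTrivial),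
      formClass htr hd ht = a := by
  obtain ⟨P, rfl⟩ := a.exists_rep
  rw [IsoClass.baseChange_mk, freeClass, IsoClass.mk_eq_mk] at ha
  obtain ⟨α⟩ := ha
  obtain ⟨d, hd, ht, ⟨q⟩⟩ := exists_formMod_equiv htr (α.trans (blockModEquiv n).symm)
  have h := finite_projective_invariants htr ((inertiallyTrivial_blockAction hd).2 ht)
  have := h.1
  have := h.2
  exact ⟨d, hd, ht, IsoClass.mk_eq_mk.2 ⟨q.symm⟩⟩

/-- The element `[P] - [Rⁿ]` of `K₀(R)`, `R = S^G`, for the module `P` attached to a cocycle with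
values in `GLₙ(S)`. -/
def formDiff (hd : d.IsBlock n) (ht : d.InertiallyTrivial) : KZero (FixedPoints.subring S G) :=
  GrothendieckAddGroup.of (formClass htr hd ht) -
    GrothendieckAddGroup.of (freeClass (FixedPoints.subring S G) n)

theorem map_formDiff (hd : d.IsBlock n) (ht : d.InertiallyTrivial) :
    KZero.map (FixedPoints.subring S G) S (formDiff htr hd ht) = 0 := by
  rw [formDiff, map_sub, KZero.map_of, KZero.map_of, baseChange_formClass,
    IsoClass.baseChange_freeClass, sub_self]

theorem formDiff_of_isBlock (hd : d.IsBlock n) (hd' : d.IsBlock m) (hnm : n ≤ m)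
    (ht : d.InertiallyTrivial) : formDiff htr hd' ht = formDiff htr hd ht := by
  obtain ⟨k, rfl⟩ := Nat.exists_eq_add_of_le hnm
  rw [formDiff, formDiff, formClass_add htr hd ht rfl hd', freeClass_add, map_add, map_add,
    add_sub_add_right_eq_sub]

/-- Equal elements of `K₀` give isomorphic modules after the addition of free modules, that is,
after enlarging the common block size, and isomorphic modules of the same block size come from
cohomologous cocycles. -/
theorem formDiff_eq_formDiff_iff (hd : d.IsBlock n) (ht : d.InertiallyTrivial)
    (he : e.IsBlock m) (ht' : e.InertiallyTrivial) :
    formDiff htr hd ht = formDiff htr he ht' ↔ H1.mk d = H1.mk e := by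
  constructor
  · intro h
    rw [formDiff, formDiff, sub_eq_sub_iff_add_eq_add, ← map_add, ← map_add, of_eq_of_iff] at h
    obtain ⟨k, hk⟩ := h
    rw [add_assoc, add_assoc, ← freeClass_add, ← freeClass_add,
      ← formClass_add htr hd ht (m := n + m + k) (by omega) (hd.mono (by omega)),
      ← formClass_add htr he ht' (m := n + m + k) (by omega) (he.mono (by omega))] at hk
    exact mk_eq_mk_of_formClass_eq htr _ ht _ ht' hk
  · intro h
    obtain ⟨x, hx⟩ := H1.mk_eq_mk.1 h
    obtain ⟨l, hl⟩ := GLInf.exists_isBlock x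
    have hd' : d.IsBlock (n + m + l) := hd.mono (by omega)
    have he' : e.IsBlock (n + m + l) := he.mono (by omega)
    have hl' : (x : AutInf S).IsBlock (n + m + l) := hl.mono (by omega)
    rw [← formDiff_of_isBlock htr hd hd' (by omega), ← formDiff_of_isBlock htr he he' (by omega),
      formDiff, formDiff, (formClass_eq_formClass_iff htr hd' ht he' ht').2]
    obtain ⟨f⟩ := nonempty_formMod_equiv_of_cohomologous hd' he' hl' hx
    exact ⟨f.symm⟩

theorem formDiff_sum (hd : d.IsBlock n) (ht : d.InertiallyTrivial) (he : e.IsBlock n)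
    (ht' : e.InertiallyTrivial) :
    formDiff htr (hd.sum he) (ht.sum ht') = formDiff htr hd ht + formDiff htr he ht' := by
  rw [formDiff, formDiff, formDiff, formClass_sum htr hd ht he ht', freeClass_add, map_add,
    map_add]
  abel

theorem exists_formDiff_eq {y : KZero (FixedPoints.subring S G)}
    (hy : KZero.map (FixedPoints.subring S G) S y = 0) :
    ∃ (n : ℕ) (d : Cocycle G (GLInf S)) (hd : d.IsBlock n) (ht : d.InertiallyTrivial),
      formDiff htr hd ht = y := by
  obtain ⟨a, n, rfl⟩ := exists_eq_of_sub_freeClass y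
  rw [map_sub, KZero.map_of, KZero.map_of, IsoClass.baseChange_freeClass, sub_eq_zero,
    of_eq_of_iff] at hy
  obtain ⟨k, hk⟩ := hy
  rw [← freeClass_add, ← IsoClass.baseChange_freeClass (R := FixedPoints.subring S G) S k,
    ← map_add] at hk
  obtain ⟨d, hd, ht, h⟩ := exists_formClass_eq htr hk
  refine ⟨n + k, d, hd, ht, ?_⟩
  rw [formDiff, h, freeClass_add, map_add, map_add, add_sub_add_right_eq_sub]

theorem exists_formDiff (a : AddMonoidHom.mker (rho G S)) :
    ∃ y : KZero (FixedPoints.subring S G), ∃ (n : ℕ) (d : Cocycle G (GLInf S))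
      (hd : d.IsBlock n) (ht : d.InertiallyTrivial),
      H1.mk d = a ∧ formDiff htr hd ht = y := by
  obtain ⟨a, ha⟩ := a
  induction a using H1.ind with | _ d =>
  obtain ⟨n, hn⟩ := d.exists_isBlock
  exact ⟨_, n, d, hn, mk_mem_mker_rho_iff.1 ha, rfl, rfl⟩

/-- The map `Ker ρ → K₀(S^G)` that is induced by `formDiff`. -/
def formDiffClass (a : AddMonoidHom.mker (rho G S)) : KZero (FixedPoints.subring S G) :=
  (exists_formDiff htr a).choose

theorem formDiffClass_eq {a : AddMonoidHom.mker (rho G S)} (hd : d.IsBlock n)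
    (ht : d.InertiallyTrivial) (h : H1.mk d = a) : formDiffClass htr a = formDiff htr hd ht := by
  obtain ⟨m, e, he, ht', h1, h2⟩ := (exists_formDiff htr a).choose_spec
  rw [formDiffClass, ← h2, formDiff_eq_formDiff_iff, h1, h]

/-- The homomorphism `Ker ρ → Ker K₀(f)` that maps the class of a cocycle `d` with values in
`GLₙ(S)` to `[P] - [Rⁿ]`, where `P = {v ∈ Sⁿ | d(g) v = v ^ g}` and `R = S^G`. -/
def kernelHom : AddMonoidHom.mker (rho G S) →+ (KZero.map (FixedPoints.subring S G) S).ker :=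
  AddMonoidHom.mk' (fun a => ⟨formDiffClass htr a, by
    obtain ⟨y, n, d, hd, ht, h, -⟩ := exists_formDiff htr a
    rw [AddMonoidHom.mem_ker, formDiffClass_eq htr hd ht h, map_formDiff]⟩) (by
    intro a b
    obtain ⟨-, n, d, hd, ht, h, -⟩ := exists_formDiff htr a
    obtain ⟨-, m, e, he, ht', h', -⟩ := exists_formDiff htr b
    have hd' := hd.mono (le_max_left n m)
    have he' := he.mono (le_max_right n m)
    refine Subtype.ext ?_
    change formDiffClass htr (a + b) = formDiffClass htr a + formDiffClass htr b
    rw [formDiffClass_eq htr hd' ht h, formDiffClass_eq htr he' ht' h', ← formDiff_sum]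
    exact formDiffClass_eq htr _ _ (by rw [H1.mk_sum, h, h']; rfl))

theorem kernelHom_bijective : Function.Bijective (kernelHom (G := G) (S := S) htr) := by
  constructor
  · intro a b hab
    obtain ⟨-, n, d, hd, ht, h, -⟩ := exists_formDiff htr a
    obtain ⟨-, m, e, he, ht', h', -⟩ := exists_formDiff htr b
    have := congrArg Subtype.val hab
    change formDiffClass htr a = formDiffClass htr b at this
    rw [formDiffClass_eq htr hd ht h, formDiffClass_eq htr he ht' h',
      formDiff_eq_formDiff_iff, h, h'] at this
    exact Subtype.ext this
  · rintro ⟨y, hy⟩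
    obtain ⟨n, d, hd, ht, h⟩ := exists_formDiff_eq htr hy
    exact ⟨⟨H1.mk d, mk_mem_mker_rho_iff.2 ht⟩,
      Subtype.ext ((formDiffClass_eq htr hd ht rfl).trans h)⟩

/-- `Ker K₀(f) ≅ Ker ρ`. -/
def kernelEquiv : (KZero.map (FixedPoints.subring S G) S).ker ≃+ AddMonoidHom.mker (rho G S) :=
  (AddEquiv.ofBijective (kernelHom htr) (kernelHom_bijective htr)).symm

end KernelKZero

/-! ### Invertible `S^G`-submodules of `S` and cocycles with values in `Sˣ` -/

section Units

open SemilinearAction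

variable {S : Type u} [CommRing S] {G : Type v} [Group G] [MulSemiringAction G S]

/-- The action `v ↦ g (d(g) v)` of `G` on `S` that is given by a cocycle `d` with values in
`Sˣ`. -/
def rankOneAction (d : Cocycle G Sˣ) : SemilinearAction G S S where
  toEnd :=
    { toFun := fun g => (MulSemiringAction.toRingHom G S g : S →+ S).comp
        (AddMonoidHom.mulLeft (d g : S))
      map_one' := AddMonoidHom.ext fun v => by
        change (1 : G) • (((d 1 : Sˣ) : S) * v) = v
        rw [d.apply_one, one_smul, Units.val_one, one_mul]
      map_mul' := fun g h => AddMonoidHom.ext fun v => by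
        change (g * h) • (((d (g * h) : Sˣ) : S) * v) = g • ((d g : S) * h • ((d h : S) * v))
        rw [d.map_mul', Units.val_mul, coe_unitsAction, mul_smul, mul_assoc, smul_mul',
          smul_inv_smul] }
  map_smul' g s v := by
    change g • ((d g : S) * (s * v)) = (g • s) * g • ((d g : S) * v)
    rw [← smul_mul', mul_left_comm]

theorem rankOneAction_apply (d : Cocycle G Sˣ) (g : G) (v : S) :
    rankOneAction d g v = g • ((d g : S) * v) := rfl

theorem UnitsInertiallyTrivial.rankOneAction {d : Cocycle G Sˣ} (hd : UnitsInertiallyTrivial d) :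
    (rankOneAction d).InertiallyTrivial := by
  intro M hM g hg v
  rw [smul_eq_mul, Ideal.mul_top, rankOneAction_apply, ← sub_add_sub_cancel _ ((d g : S) * v) v]
  refine M.add_mem (hg _) ?_
  rw [← sub_one_mul]
  exact M.mul_mem_right _ (hd M hM g hg)

/-- The `S^G`-submodule of all `v` in `S` with `d(g) v = v ^ g`. -/
def unitsForm (d : Cocycle G Sˣ) : Submodule (FixedPoints.subring S G) S :=
  (rankOneAction d).invariants

theorem mem_unitsForm {d : Cocycle G Sˣ} {v : S} :
    v ∈ unitsForm d ↔ ∀ g : G, (d g : S) * v = g⁻¹ • v :=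
  forall_congr' fun g => by rw [rankOneAction_apply, ← eq_inv_smul_iff]

theorem mem_unitsForm_inv {d : Cocycle G Sˣ} {v : S} :
    v ∈ unitsForm d⁻¹ ↔ ∀ g : G, (d g : S) * g⁻¹ • v = v := by
  rw [mem_unitsForm]
  refine forall_congr' fun g => ?_
  rw [Cocycle.inv_apply, Units.inv_mul_eq_iff_eq_mul, eq_comm]

theorem unitsForm_one : unitsForm (1 : Cocycle G Sˣ) = 1 := by
  ext v
  rw [mem_unitsForm, Submodule.mem_one]
  constructor
  · intro h
    refine ⟨⟨v, fun g => ?_⟩, rfl⟩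
    have := h g⁻¹
    rw [Cocycle.one_apply, Units.val_one, one_mul, inv_inv] at this
    exact this.symm
  · rintro ⟨r, rfl⟩ g
    rw [Cocycle.one_apply, Units.val_one, one_mul]
    exact (r.2 g⁻¹).symm

theorem unitsForm_mul_le (d e : Cocycle G Sˣ) : unitsForm d * unitsForm e ≤ unitsForm (d * e) := by
  rw [Submodule.mul_le]
  intro v hv w hw
  rw [mem_unitsForm] at hv hw ⊢
  intro g
  rw [Cocycle.mul_apply, Units.val_mul, smul_mul', ← hv g, ← hw g, mul_mul_mul_comm]

theorem mul_unitsForm_inv_le (d : Cocycle G Sˣ) : unitsForm d * unitsForm d⁻¹ ≤ 1 := by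
  rw [← unitsForm_one, ← mul_inv_cancel d]
  exact unitsForm_mul_le d d⁻¹

/-- A dual basis `p i`, `l i` of `S` for the action given by `d` satisfies `∑ i, l i 1 * p i = 1`
with `p i` in the form of `d` and `l i 1` in the form of `d⁻¹`. -/
theorem UnitsInertiallyTrivial.unitsForm_mul_inv [Fintype G] (htr : ∃ x : S, ∑ g : G, g • x = 1)
    {d : Cocycle G Sˣ} (hd : UnitsInertiallyTrivial d) : unitsForm d * unitsForm d⁻¹ = 1 := by
  refine le_antisymm (mul_unitsForm_inv_le d) ?_
  obtain ⟨m, p, l, hpl, hl⟩ := exists_dualBasis htr hd.rankOneAction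
  have hl1 : ∀ i v, l i v = v * l i 1 := fun i v => by
    rw [← smul_eq_mul, ← map_smul, smul_eq_mul, mul_one]
  have h1 := hpl 1
  have hmem : ∀ i, l i 1 ∈ unitsForm d⁻¹ := by
    intro i
    rw [mem_unitsForm_inv]
    intro g
    have key : ∀ v ∈ (InvariantK0.rankOneAction d).invariants,
        v * ((d g : S) * g⁻¹ • l i 1) = v * l i 1 := by
      intro v hv
      have h2 : g⁻¹ • (v * l i 1) = v * l i 1 := by
        rw [← hl1]
        exact hl i v hv g⁻¹
      rw [smul_mul', ← mem_unitsForm.1 hv g] at h2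
      rw [mul_left_comm, ← mul_assoc, h2]
    have expand : ∀ t : S, t = ∑ j, l j 1 * ((p j : S) * t) := fun t => by
      simp_rw [← mul_assoc]
      rw [← Finset.sum_mul]
      exact ((congrArg (· * t) h1).trans (one_mul t)).symm
    rw [expand (_ * _), expand (l i 1)]
    exact Finset.sum_congr rfl fun j _ => by rw [← expand, key _ (p j).2]
  rw [Submodule.one_le, ← h1]
  refine sum_mem fun i _ => ?_
  rw [smul_eq_mul, mul_comm (l i 1)]
  exact Submodule.mul_mem_mul (p i).2 (hmem i)

theorem UnitsInertiallyTrivial.unitsForm_mul [Fintype G] (htr : ∃ x : S, ∑ g : G, g • x = 1)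
    {d : Cocycle G Sˣ} (hd : UnitsInertiallyTrivial d) (e : Cocycle G Sˣ) :
    unitsForm (d * e) = unitsForm d * unitsForm e := by
  refine le_antisymm ?_ (unitsForm_mul_le d e)
  calc unitsForm (d * e) = unitsForm d * (unitsForm d⁻¹ * unitsForm (d * e)) := by
        rw [← mul_assoc, hd.unitsForm_mul_inv htr, one_mul]
    _ ≤ unitsForm d * unitsForm (d⁻¹ * (d * e)) :=
        mul_le_mul_right (unitsForm_mul_le _ _) _
    _ = unitsForm d * unitsForm e := by rw [inv_mul_cancel_left]

/-- The form of `d` is free if and only if `d` is a coboundary. -/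
theorem unitsForm_eq_span_iff {d : Cocycle G Sˣ} {x : Sˣ} :
    Submodule.span (FixedPoints.subring S G) {(x : S)} = unitsForm d ↔
      ∀ g, d g = (g⁻¹ • x) * x⁻¹ := by
  have hx : (x : S) ∈ unitsForm d ↔ ∀ g, d g = (g⁻¹ • x) * x⁻¹ := by
    rw [mem_unitsForm]
    refine forall_congr' fun g => ?_
    rw [eq_mul_inv_iff_mul_eq, Units.ext_iff, Units.val_mul, coe_unitsAction]
  constructor
  · intro h
    rw [← hx, ← h]
    exact Submodule.mem_span_singleton_self _
  · intro h
    refine le_antisymm ((Submodule.span_singleton_le_iff_mem _ _).2 (hx.2 h)) fun v hv => ?_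
    have hxi : ((x⁻¹ : Sˣ) : S) ∈ unitsForm d⁻¹ := by
      rw [mem_unitsForm_inv]
      intro g
      rw [h g, ← coe_unitsAction, ← Units.val_mul, smul_inv', mul_right_comm, mul_inv_cancel,
        one_mul]
    obtain ⟨r, hr⟩ := Submodule.mem_one.1 (mul_unitsForm_inv_le d (Submodule.mul_mem_mul hv hxi))
    refine Submodule.mem_span_singleton.2 ⟨r, ?_⟩
    rw [Algebra.smul_def, hr, Units.inv_mul_cancel_right]

/-- On an invertible submodule `I` of `S`, each `g` acts as the multiplication with an element
`d(g)` of `S`; if `1 = ∑ aᵢ bᵢ` with `aᵢ` in `I` and `bᵢ` in `I⁻¹`, then `d(g) = ∑ aᵢ^g bᵢ`. -/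
theorem exists_unitsForm_eq (I : (Submodule (FixedPoints.subring S G) S)ˣ) :
    ∃ d : Cocycle G Sˣ, UnitsInertiallyTrivial d ∧ unitsForm d = I := by
  have hIJ : (I : Submodule (FixedPoints.subring S G) S) * (I⁻¹ : _ˣ) = 1 := I.mul_inv
  have hone : (1 : S) ∈ (I : Submodule (FixedPoints.subring S G) S) *
      ((I⁻¹ : _ˣ) : Submodule (FixedPoints.subring S G) S) := by
    rw [hIJ]; exact Submodule.one_le.1 le_rfl
  have hfix : ∀ a ∈ (I : Submodule (FixedPoints.subring S G) S),
      ∀ b ∈ ((I⁻¹ : _ˣ) : Submodule (FixedPoints.subring S G) S), ∀ g : G,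
      g • (a * b) = a * b := by
    intro a ha b hb g
    obtain ⟨r, hr⟩ := Submodule.mem_one.1 (hIJ.le (Submodule.mul_mem_mul ha hb))
    rw [← hr]
    exact r.2 g
  have hfaith : ∀ (M : Ideal S) (c : S),
      (∀ v ∈ (I : Submodule (FixedPoints.subring S G) S), c * v ∈ M) → c ∈ M := by
    intro M c hc
    rw [← mul_one c]
    refine Submodule.mul_induction_on hone (fun a ha b _ => ?_) fun a b ha hb => ?_
    · rw [← mul_assoc]
      exact M.mul_mem_right _ (hc a ha)
    · rw [mul_add]
      exact M.add_mem ha hb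
  have hcancel : ∀ c c' : S,
      (∀ v ∈ (I : Submodule (FixedPoints.subring S G) S), c * v = c' * v) → c = c' := by
    intro c c' h
    have := hfaith ⊥ (c - c') fun v hv => by rw [sub_mul, h v hv, sub_self]; exact zero_mem _
    exact sub_eq_zero.1 this
  have hex : ∀ g : G, ∃ c : S,
      ∀ v ∈ (I : Submodule (FixedPoints.subring S G) S), g⁻¹ • v = c * v := by
    intro g
    have : ∃ c : S, ∀ v ∈ (I : Submodule (FixedPoints.subring S G) S),
        g⁻¹ • ((1 : S) * v) = c * v := by
      refine Submodule.mul_induction_on (C := fun z => ∃ c : S,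
        ∀ v ∈ (I : Submodule (FixedPoints.subring S G) S), g⁻¹ • (z * v) = c * v) hone
        (fun a _ b hb => ⟨g⁻¹ • a * b, fun v hv => ?_⟩) ?_
      · rw [mul_assoc, mul_comm b, smul_mul', hfix v hv b hb, mul_comm v, mul_assoc]
      · rintro z z' ⟨c, hc⟩ ⟨c', hc'⟩
        refine ⟨c + c', fun v hv => ?_⟩
        rw [add_mul, smul_add, hc v hv, hc' v hv, add_mul]
    simpa only [one_mul] using this
  choose c hc using hex
  have hmul : ∀ g h : G, c (g * h) = (h⁻¹ • c g) * c h := fun g h => hcancel _ _ fun v hv => by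
    rw [← hc _ v hv, mul_inv_rev, mul_smul, hc g v hv, smul_mul', hc h v hv, mul_assoc]
  have hc1 : c 1 = 1 := hcancel _ _ fun v hv => by rw [← hc 1 v hv, inv_one, one_smul, one_mul]
  let d : Cocycle G Sˣ :=
    { toFun := fun g =>
        { val := c g
          inv := g⁻¹ • c g⁻¹
          val_inv := by rw [mul_comm, ← hmul, inv_mul_cancel, hc1]
          inv_val := by rw [← hmul, inv_mul_cancel, hc1] }
      map_mul' := fun g h => Units.ext (hmul g h) }
  have hd : ∀ g, (d g : S) = c g := fun g => rfl
  refine ⟨d, fun M hM g hg => ?_, ?_⟩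
  · refine hfaith M _ fun v hv => ?_
    rw [hd, sub_one_mul, ← hc g v hv]
    exact inv_mem hg v
  · have hI : (I : Submodule (FixedPoints.subring S G) S) ≤ unitsForm d := fun v hv =>
      mem_unitsForm.2 fun g => (hc g v hv).symm
    have hJ : ((I⁻¹ : _ˣ) : Submodule (FixedPoints.subring S G) S) ≤ unitsForm d⁻¹ := by
      intro b hb
      rw [mem_unitsForm_inv]
      refine fun g => hcancel _ _ fun v hv => ?_
      rw [hd, mul_right_comm, ← hc g v hv, ← smul_mul', hfix v hv b hb, mul_comm]
    refine le_antisymm ?_ hI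
    calc unitsForm d =
          I * (((I⁻¹ : _ˣ) : Submodule (FixedPoints.subring S G) S) * unitsForm d) := by
          rw [← mul_assoc, hIJ, one_mul]
      _ ≤ I * 1 := by
          refine mul_le_mul_right ((mul_le_mul_left hJ _).trans ?_) _
          rw [mul_comm]
          exact mul_unitsForm_inv_le d
      _ = I := mul_one _

/-- The class of a cocycle, as a homomorphism. -/
def H1.mkHom (G X : Type*) [Group G] [CommGroup X] [MulDistribMulAction G X] :
    Cocycle G X →* H1 G X where
  toFun := H1.mk
  map_one' := H1.mk_one
  map_mul' := H1.mk_mul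

variable (S G) in
/-- The cocycles with values in `Sˣ` whose classes are in the kernels of restriction and
reduction. -/
def trivialCocycles : Subgroup (Cocycle G Sˣ) :=
  (⨅ C : CyclicSubgroups G, (resRedUnits S C.1).ker : Subgroup (H1 G Sˣ)).comap (H1.mkHom G Sˣ)

theorem mem_trivialCocycles {d : Cocycle G Sˣ} :
    d ∈ trivialCocycles S G ↔ UnitsInertiallyTrivial d := mk_mem_iInf_ker_cyclic_iff

/-- The class of a cocycle, as an element of the kernels of restriction and reduction. -/
def trivialCocyclesMk : trivialCocycles S G →*
    (⨅ C : CyclicSubgroups G, (resRedUnits S C.1).ker : Subgroup (H1 G Sˣ)) :=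
  ((H1.mkHom G Sˣ).comp (trivialCocycles S G).subtype).codRestrict _ fun d => d.2

theorem trivialCocyclesMk_surjective :
    Function.Surjective (trivialCocyclesMk (G := G) (S := S)) := by
  rintro ⟨a, ha⟩
  induction a using H1.ind with | _ d =>
  exact ⟨⟨d, ha⟩, rfl⟩

variable [Fintype G] (htr : ∃ x : S, ∑ g : G, g • x = 1)

/-- The form of a cocycle, as an invertible submodule of `S`. -/
def unitsFormHom : trivialCocycles S G →* (Submodule (FixedPoints.subring S G) S)ˣ :=
  MonoidHom.toHomUnits
    { toFun := fun d => unitsForm d.1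
      map_one' := unitsForm_one
      map_mul' := fun d e => (mem_trivialCocycles.1 d.2).unitsForm_mul htr e.1 }

theorem unitsFormHom_surjective : Function.Surjective (unitsFormHom (G := G) (S := S) htr) := by
  intro I
  obtain ⟨d, hd, h⟩ := exists_unitsForm_eq I
  exact ⟨⟨d, mem_trivialCocycles.2 hd⟩, Units.ext h⟩

instance : FaithfulSMul (FixedPoints.subring S G) S :=
  (faithfulSMul_iff_algebraMap_injective _ _).2 Subtype.val_injective

/-- The class in `Pic(S^G)` of the form of a cocycle. -/
def unitsFormPic : trivialCocycles S G →*
    (CommRing.Pic.mapAlgebra (FixedPoints.subring S G) S).ker :=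
  ((Submodule.unitsToPic (FixedPoints.subring S G) S).comp (unitsFormHom htr)).codRestrict _
    fun d => by
      have := Submodule.range_unitsToPic (FixedPoints.subring S G) S
      rw [CommRing.relPic] at this
      rw [← this]
      exact ⟨_, rfl⟩

theorem unitsFormPic_surjective : Function.Surjective (unitsFormPic (G := G) (S := S) htr) := by
  rintro ⟨y, hy⟩
  have := Submodule.range_unitsToPic (FixedPoints.subring S G) S
  rw [CommRing.relPic] at this
  rw [← this] at hy
  obtain ⟨I, rfl⟩ := hy
  obtain ⟨d, rfl⟩ := unitsFormHom_surjective htr I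
  exact ⟨d, rfl⟩

theorem ker_unitsFormPic :
    (unitsFormPic (G := G) (S := S) htr).ker = (trivialCocyclesMk (G := G) (S := S)).ker := by
  ext d
  have h1 : d ∈ (unitsFormPic (G := G) (S := S) htr).ker ↔
      unitsFormHom htr d ∈ (Submodule.unitsToPic (FixedPoints.subring S G) S).ker := by
    rw [MonoidHom.mem_ker, MonoidHom.mem_ker, Subtype.ext_iff]
    rfl
  have h2 : d ∈ (trivialCocyclesMk (G := G) (S := S)).ker ↔ H1.mk d.1 = H1.mk 1 := by
    rw [MonoidHom.mem_ker, Subtype.ext_iff]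
    rfl
  rw [h1, h2, Submodule.ker_unitsToPic, H1.mk_eq_mk]
  refine exists_congr fun x => ?_
  rw [Units.ext_iff]
  refine Iff.trans ?_ (unitsForm_eq_span_iff (d := d.1) (x := x)) |>.trans ?_
  · rfl
  · refine forall_congr' fun g => ?_
    rw [Cocycle.one_apply, mul_one]

/-- The kernel of `Pic(S^G) → Pic(S)` in terms of cocycles. -/
def picKernelEquiv : (CommRing.Pic.mapAlgebra (FixedPoints.subring S G) S).ker ≃*
    (⨅ C : CyclicSubgroups G, (resRedUnits S C.1).ker : Subgroup (H1 G Sˣ)) :=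
  (QuotientGroup.quotientKerEquivOfSurjective _ (unitsFormPic_surjective htr)).symm.trans
    ((QuotientGroup.quotientMulEquivOfEq (ker_unitsFormPic htr)).trans
      (QuotientGroup.quotientKerEquivOfSurjective _ trivialCocyclesMk_surjective))

end Units

/-! ### Diagonal matrices with one nontrivial entry -/

section Scale

variable {S : Type*} [CommRing S]

/-- The endomorphism of `S^(ℕ)` that multiplies the basis vector `e_N` with `a`. -/
def scaleEnd (N : ℕ) : S →* Module.End S (ℕ →₀ S) where
  toFun a := 1 + (a - 1) • (Finsupp.lsingle N ∘ₗ Finsupp.lapply N)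
  map_one' := by rw [sub_self, zero_smul, add_zero]
  map_mul' a b := by
    ext j i
    by_cases h : j = N
    · subst h
      simp [Finsupp.single_apply]
      split_ifs <;> ring
    · simp [Finsupp.single_apply, h]

/-- The diagonal matrix with the entry `a` at the index `N` and all other diagonal entries `1`. -/
def scaleAt (N : ℕ) : Sˣ →* AutInf S := Units.map (scaleEnd N)

theorem entry_scaleAt (N : ℕ) (a : Sˣ) (i j : ℕ) :
    (scaleAt N a).entry i j = if i = j then (if j = N then (a : S) else 1) else 0 := by
  have : (scaleAt N a).entry i j = ((1 + ((a : S) - 1) • (Finsupp.lsingle N ∘ₗ Finsupp.lapply N) :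
      Module.End S (ℕ →₀ S)) (Finsupp.single j 1)) i := rfl
  rw [this]
  by_cases h : j = N
  · subst h
    by_cases hi : i = j
    · simp [hi]
    · simp [hi]
  · by_cases hi : i = j
    · simp [hi, h]
    · simp [hi, h]

theorem isBlock_scaleAt {N n : ℕ} (h : N < n) (a : Sˣ) : (scaleAt N a).IsBlock n := by
  intro i j hij
  rw [entry_scaleAt]
  split_ifs with h1 h2
  · omega
  · rfl
  · rfl

theorem scaleAt_mem_GLInf (N : ℕ) (a : Sˣ) : scaleAt N a ∈ GLInf S :=
  mem_GLInf_of_isBlock (isBlock_scaleAt N.lt_succ_self a)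

theorem map_scaleAt {S' : Type*} [CommRing S'] (φ : S →+* S') (N : ℕ) (a : Sˣ) :
    AutInf.map φ (scaleAt N a) = scaleAt N (Units.map (φ : S →* S') a) := by
  refine AutInf.ext_entry fun i j => ?_
  rw [AutInf.entry_map, entry_scaleAt, entry_scaleAt]
  split_ifs <;> simp

theorem smul_scaleAt {G : Type*} [Group G] [MulSemiringAction G S] (g : G) (N : ℕ) (a : Sˣ) :
    g • scaleAt N a = scaleAt N (g • a) := by
  refine AutInf.ext_entry fun i j => ?_
  rw [AutInf.entry_smul, entry_scaleAt, entry_scaleAt]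
  split_ifs <;> simp

theorem scaleAt_commute {n N : ℕ} (h : n ≤ N) (a : Sˣ) {u : AutInf S} (hu : u.IsBlock n) :
    Commute (scaleAt N a) u := by
  have happly : ∀ v : ℕ →₀ S, (scaleAt N a).toEnd v =
      v + ((a : S) - 1) • Finsupp.single N (v N) := fun v => rfl
  refine AutInf.toEnd_injective ?_
  refine Finsupp.lhom_ext' fun j => LinearMap.ext_ring ?_
  change (scaleAt N a).toEnd (u.toEnd (Finsupp.single j 1)) =
    u.toEnd ((scaleAt N a).toEnd (Finsupp.single j 1))
  rw [happly, happly, map_add, map_smul]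
  have h1 : u.toEnd (Finsupp.single j 1) N = (Finsupp.single j (1 : S)) N := by
    rw [Finsupp.single_apply]
    have := hu N j (Or.inl h)
    rw [AutInf.entry] at this
    simpa [eq_comm] using this
  rw [h1, hu.apply_eq (v := Finsupp.single N _)]
  intro i hi
  rw [Finsupp.single_eq_of_ne (by omega)]

theorem detInf_scaleAt (N : ℕ) (a : Sˣ) : detInf S ⟨scaleAt N a, scaleAt_mem_GLInf N a⟩ = a := by
  ext
  rw [coe_detInf _ (isBlock_scaleAt N.lt_succ_self a)]
  have : (scaleAt N a).block (N + 1) =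
      Matrix.diagonal fun i : Fin (N + 1) => if i = Fin.last N then (a : S) else 1 := by
    ext i j
    simp only [AutInf.block, Matrix.of_apply, entry_scaleAt, Matrix.diagonal_apply, Fin.ext_iff,
      Fin.val_last]
    split_ifs <;> first | rfl | omega
  rw [this, Matrix.det_diagonal, Finset.prod_ite_eq' Finset.univ (Fin.last N) fun _ => (a : S)]
  simp

end Scale

/-! ### The determinant and the inclusion of `SL(S)` on the kernels -/

section Kernels

variable {S : Type*} [CommRing S] {G : Type*} [Group G] [MulSemiringAction G S]

/-- On the block of `u`, placing along `ι` is the conjugation by a permutation matrix. -/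
theorem detInf_place (ι : ℕ ↪ ℕ) {u : AutInf S} (hu : u ∈ GLInf S)
    (h : AutInf.place ι u ∈ GLInf S) :
    detInf S ⟨AutInf.place ι u, h⟩ = detInf S ⟨u, hu⟩ := by
  obtain ⟨n, hn⟩ := GLInf.exists_isBlock ⟨u, hu⟩
  obtain ⟨σ, τ, hσ, hτ, hι⟩ := exists_commutator ι n
  have hP : permMat S (σ * τ * σ⁻¹ * τ⁻¹) ∈ GLInf S := by
    simp only [map_mul, map_inv]
    exact mul_mem (mul_mem (mul_mem (permMat_mem_GLInf hσ) (permMat_mem_GLInf hτ))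
      (inv_mem (permMat_mem_GLInf hσ))) (inv_mem (permMat_mem_GLInf hτ))
  have h1 : AutInf.place ι u = permMat S (σ * τ * σ⁻¹ * τ⁻¹) * u *
      (permMat S (σ * τ * σ⁻¹ * τ⁻¹))⁻¹ := by
    rw [permMat_conj]
    exact AutInf.place_congr hn fun i hi => (hι i hi).symm
  have h2 : (⟨AutInf.place ι u, h⟩ : GLInf S) = ⟨_, hP⟩ * ⟨u, hu⟩ * ⟨_, hP⟩⁻¹ := Subtype.ext h1
  rw [h2, map_mul, map_mul, map_inv, mul_right_comm, mul_inv_cancel, one_mul]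

theorem detH1_mk (d : Cocycle G (GLInf S)) :
    detH1 (H1.mk d) = H1.mk (d.map (MonoidHom.id G) (detInf S) detInf_smul) := rfl

theorem inclH1_mk (d : Cocycle G (SLInf S)) : inclH1 (H1.mk d) = H1.mk
    (d.map (MonoidHom.id G) (Subgroup.inclusion SLInf_le_GLInf) (fun _ _ => rfl)) := rfl

theorem detH1_add (a b : H1 G (GLInf S)) : detH1 (a + b) = detH1 a * detH1 b := by
  induction a using H1.ind with | _ d =>
  induction b using H1.ind with | _ e =>
  rw [← H1.mk_sum, detH1_mk, detH1_mk, detH1_mk, ← H1.mk_mul]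
  congr 1
  refine Cocycle.ext (funext fun g => ?_)
  change detInf S (d.sum e g) = detInf S (d g) * detInf S (e g)
  have : d.sum e g = d.place evenEmb g * e.place oddEmb g := Subtype.ext (Cocycle.coe_sum d e g)
  rw [this, map_mul]
  congr 1
  · exact detInf_place evenEmb (d g).2 _
  · exact detInf_place oddEmb (e g).2 _

theorem inclH1_add (a b : H1 G (SLInf S)) : inclH1 (a + b) = inclH1 a + inclH1 b := by
  induction a using H1.ind with | _ d =>
  induction b using H1.ind with | _ e =>
  rw [← H1.mk_sum, inclH1_mk, inclH1_mk, inclH1_mk, ← H1.mk_sum]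
  congr 1

theorem detH1_inclH1 (a : H1 G (SLInf S)) : detH1 (inclH1 a) = 1 := by
  induction a using H1.ind with | _ d =>
  rw [inclH1_mk, detH1_mk, ← H1.mk_one]
  congr 1
  exact Cocycle.ext (funext fun g => (mem_SLInf.1 (d g).2).2)

/-- If the determinant of a cocycle is the coboundary of a unit `a`, conjugation with a diagonal
matrix of determinant `a⁻¹` yields a cocycle with values in `SL(S)`. -/
theorem exists_inclH1_eq {a : H1 G (GLInf S)} (ha : detH1 a = 1) : ∃ b, inclH1 b = a := by
  induction a using H1.ind with | _ d =>
  rw [detH1_mk, ← H1.mk_one, H1.mk_eq_mk] at ha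
  obtain ⟨a, ha⟩ := ha
  replace ha : ∀ g, detInf S (d g) = (g⁻¹ • a) * a⁻¹ := fun g => by
    have := ha g
    rw [Cocycle.one_apply, mul_one] at this
    exact this
  let s : GLInf S := ⟨scaleAt 0 a⁻¹, scaleAt_mem_GLInf 0 a⁻¹⟩
  have hs : detInf S s = a⁻¹ := detInf_scaleAt 0 a⁻¹
  have hf : ∀ g, (((g⁻¹ • s) * d g * s⁻¹ : GLInf S) : AutInf S) ∈ SLInf S := by
    refine fun g => mem_SLInf.2 ⟨Subtype.property _, ?_⟩
    change detInf S ((g⁻¹ • s) * d g * s⁻¹) = 1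
    rw [map_mul, map_mul, map_inv, detInf_smul, hs, ha, smul_inv', inv_mul_cancel_left, inv_inv,
      inv_mul_cancel]
  refine ⟨H1.mk ⟨fun g => ⟨_, hf g⟩, fun g h => Subtype.ext ?_⟩, H1.mk_eq_mk.2 ⟨s, fun g => rfl⟩⟩
  change ((((g * h)⁻¹ • s) * d (g * h) * s⁻¹ : GLInf S) : AutInf S) =
    (((h⁻¹ • ((g⁻¹ • s) * d g * s⁻¹)) * ((h⁻¹ • s) * d h * s⁻¹) : GLInf S) : AutInf S)
  congr 1
  rw [d.map_mul', smul_mul', smul_mul', smul_inv', mul_inv_rev, mul_smul]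
  group

variable [Finite G]

theorem inclH1_mem_mker_rho_iff {a : H1 G (SLInf S)} :
    inclH1 a ∈ AddMonoidHom.mker (rho G S) ↔ a ∈ AddMonoidHom.mker (sigma G S) := by
  induction a using H1.ind with | _ d =>
  rw [inclH1_mk, mk_mem_mker_rho_iff, mk_mem_mker_sigma_iff]
  rfl

theorem detH1_mem_of_mem_mker_rho {a : H1 G (GLInf S)} (ha : a ∈ AddMonoidHom.mker (rho G S)) :
    detH1 a ∈ (⨅ C : CyclicSubgroups G, (resRedUnits S C.1).ker : Subgroup (H1 G Sˣ)) := by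
  induction a using H1.ind with | _ d =>
  rw [mk_mem_mker_rho_iff] at ha
  rw [detH1_mk, mk_mem_iInf_ker_cyclic_iff]
  intro M hM g hg
  rw [← Ideal.Quotient.eq, map_one]
  have h := detInf_map (Ideal.Quotient.mk M) (d g).2
  have h1 : (⟨_, GLInf.map_mem (Ideal.Quotient.mk M) (d g).2⟩ : GLInf (S ⧸ M)) = 1 :=
    Subtype.ext (ha M hM g hg)
  rw [h1, map_one] at h
  exact (congrArg Units.val h).symm

/-- If `x` in `GL(S)` makes two cocycles with values in `SL(S)` cohomologous, then `det x` is
invariant, and so the product of `x` and of a diagonal matrix with the entry `(det x)⁻¹` far down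
is an element of `SL(S)` that does the same. -/
theorem inclH1_injective : Function.Injective (inclH1 (S := S) (G := G)) := by
  intro a b hab
  induction a using H1.ind with | _ d =>
  induction b using H1.ind with | _ e =>
  rw [inclH1_mk, inclH1_mk, H1.mk_eq_mk] at hab
  obtain ⟨x, hx⟩ := hab
  obtain ⟨n, hn⟩ := e.exists_isBlock
  have hx' : ∀ g, (d g : AutInf S) = (g⁻¹ • (x : AutInf S)) * e g * (x : AutInf S)⁻¹ :=
    fun g => congrArg Subtype.val (hx g)
  have hdet : ∀ g : G, g⁻¹ • detInf S x = detInf S x := by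
    intro g
    have h1 := congrArg (detInf S) (hx g)
    have h2 : ∀ f : Cocycle G (SLInf S), detInf S (f.map (MonoidHom.id G)
        (Subgroup.inclusion SLInf_le_GLInf) (fun _ _ => rfl) g) = 1 := fun f =>
      (mem_SLInf.1 (f g).2).2
    rw [map_mul, map_mul, h2, h2, mul_one, map_inv, detInf_smul, eq_comm, mul_inv_eq_one] at h1
    exact h1
  have hs : (x : AutInf S) * scaleAt n (detInf S x)⁻¹ ∈ SLInf S := by
    refine mem_SLInf.2 ⟨mul_mem x.2 (scaleAt_mem_GLInf _ _), ?_⟩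
    have : (⟨_, mul_mem x.2 (scaleAt_mem_GLInf n (detInf S x)⁻¹)⟩ : GLInf S) =
      x * ⟨_, scaleAt_mem_GLInf n (detInf S x)⁻¹⟩ := rfl
    rw [this, map_mul, detInf_scaleAt, mul_inv_cancel]
  refine H1.mk_eq_mk.2 ⟨⟨_, hs⟩, fun g => Subtype.ext ?_⟩
  change (d g : AutInf S) = (g⁻¹ • ((x : AutInf S) * scaleAt n (detInf S x)⁻¹)) * e g *
    ((x : AutInf S) * scaleAt n (detInf S x)⁻¹)⁻¹
  rw [hx', smul_mul', smul_scaleAt, smul_inv', hdet, mul_inv_rev, mul_assoc _ (scaleAt _ _),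
    (scaleAt_commute le_rfl _ (hn g)).eq, ← mul_assoc, ← mul_assoc, mul_inv_cancel_right]

theorem exists_detH1_eq {a : H1 G Sˣ}
    (ha : a ∈ (⨅ C : CyclicSubgroups G, (resRedUnits S C.1).ker : Subgroup (H1 G Sˣ))) :
    ∃ b ∈ AddMonoidHom.mker (rho G S), detH1 b = a := by
  induction a using H1.ind with | _ d =>
  rw [mk_mem_iInf_ker_cyclic_iff] at ha
  refine ⟨H1.mk ⟨fun g => ⟨scaleAt 0 (d g), scaleAt_mem_GLInf 0 (d g)⟩, fun g h =>
    Subtype.ext ?_⟩, mk_mem_mker_rho_iff.2 fun M hM g hg => ?_, ?_⟩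
  · change scaleAt 0 (d (g * h)) = (h⁻¹ • scaleAt 0 (d g)) * scaleAt 0 (d h)
    rw [d.map_mul', map_mul, smul_scaleAt]
  · change AutInf.map _ (scaleAt 0 (d g)) = 1
    rw [map_scaleAt]
    have : Units.map (Ideal.Quotient.mk M : S →* S ⧸ M) (d g) = 1 :=
      Units.ext (Ideal.Quotient.eq.2 (ha M hM g hg))
    rw [this, map_one]
  · rw [detH1_mk]
    congr 1
    exact Cocycle.ext (funext fun g => detInf_scaleAt 0 (d g))

variable (S G) in
/-- The map `Ker σ → Ker ρ` induced by the inclusion of `SL(S)` in `GL(S)`. -/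
def inclKer : AddMonoidHom.mker (sigma G S) →+ AddMonoidHom.mker (rho G S) where
  toFun a := ⟨inclH1 a.1, inclH1_mem_mker_rho_iff.2 a.2⟩
  map_zero' := Subtype.ext rfl
  map_add' a b := Subtype.ext (inclH1_add a.1 b.1)

variable (S G) in
/-- The map on `Ker ρ` induced by the determinant. -/
def detKer : AddMonoidHom.mker (rho G S) →+ Additive
    (⨅ C : CyclicSubgroups G, (resRedUnits S C.1).ker : Subgroup (H1 G Sˣ)) where
  toFun a := Additive.ofMul ⟨detH1 a.1, detH1_mem_of_mem_mker_rho a.2⟩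
  map_zero' := congrArg Additive.ofMul (Subtype.ext (detH1_inclH1 (0 : H1 G (SLInf S))))
  map_add' a b := congrArg Additive.ofMul (Subtype.ext (detH1_add a.1 b.1))

theorem inclKer_injective : Function.Injective (inclKer S G) := fun _ _ h =>
  Subtype.ext (inclH1_injective (congrArg Subtype.val h))

theorem detKer_surjective : Function.Surjective (detKer S G) := by
  intro a
  obtain ⟨b, hb, h⟩ := exists_detH1_eq a.toMul.2
  exact ⟨⟨b, hb⟩, congrArg Additive.ofMul (Subtype.ext h)⟩

theorem exact_inclKer_detKer : Function.Exact (inclKer S G) (detKer S G) := by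
  intro a
  constructor
  · intro h
    have h1 : detH1 a.1 = 1 := congrArg Subtype.val (congrArg Additive.toMul h)
    obtain ⟨b, hb⟩ := exists_inclH1_eq h1
    refine ⟨⟨b, inclH1_mem_mker_rho_iff.1 ?_⟩, Subtype.ext hb⟩
    rw [hb]
    exact a.2
  · rintro ⟨b, rfl⟩
    exact congrArg Additive.ofMul (Subtype.ext (detH1_inclH1 b.1))

end Kernels
end InvariantK0

end

theorem proposition3p3 {S : Type u} [CommRing S] {G : Type v} [Group G] [Fintype G]
    [MulSemiringAction G S] (htr : ∃ x : S, ∑ g : G, g • x = 1) :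
    ∃ ψ : (CommRing.Pic.mapAlgebra (FixedPoints.subring S G) S).ker ≃*
        (⨅ C : CyclicSubgroups G, (resRedUnits S C.1).ker : Subgroup (H1 G Sˣ)),
      (⨅ C : CyclicSubgroups G, (resRedUnits S C.1).ker : Subgroup (H1 G Sˣ)) =
        ⨅ H : Subgroup G, (resRedUnits S H).ker ∧
      ∃ (φ : (KZero.map (FixedPoints.subring S G) S).ker ≃+ AddMonoidHom.mker (rho G S))
        (ι : AddMonoidHom.mker (sigma G S) →+ (KZero.map (FixedPoints.subring S G) S).ker)
        (π : (KZero.map (FixedPoints.subring S G) S).ker →+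
          Additive (CommRing.Pic.mapAlgebra (FixedPoints.subring S G) S).ker),
        (Function.Injective ι ∧ Function.Exact ι π ∧ Function.Surjective π) ∧
        (∀ a : AddMonoidHom.mker (sigma G S), (φ (ι a) : H1 G (GLInf S)) = inclH1 a) ∧
        (∀ y, (ψ (π y).toMul : H1 G Sˣ) = detH1 (φ y : H1 G (GLInf S))) := by
  -- `ι` and `π` are the maps of the sequence `Ker σ → Ker ρ → ⋂ Ker` transported along `φ` and `ψ`.
  let ψ := picKernelEquiv (G := G) (S := S) htr
  let φ := kernelEquiv (G := G) (S := S) htr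
  let ι := φ.symm.toAddMonoidHom.comp (inclKer S G)
  let π := (MulEquiv.toAdditive ψ.symm).toAddMonoidHom.comp
    ((detKer S G).comp φ.toAddMonoidHom)
  have hφι : ∀ a, φ (ι a) = inclKer S G a := fun a => φ.apply_symm_apply _
  have hψπ : ∀ y, ψ (π y).toMul = (detKer S G (φ y)).toMul := fun y => ψ.apply_symm_apply _
  have hπ : ∀ y, π y = 0 ↔ detKer S G (φ y) = 0 := fun y =>
    map_eq_zero_iff (MulEquiv.toAdditive ψ.symm) (MulEquiv.toAdditive ψ.symm).injective
  refine ⟨ψ, iInf_ker_cyclic_eq, φ, ι, π, ⟨?_, fun y => ?_, ?_⟩, fun a => ?_, fun y => ?_⟩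
  · exact φ.symm.injective.comp inclKer_injective
  · rw [hπ, exact_inclKer_detKer (φ y)]
    refine exists_congr fun a => ?_
    rw [← hφι, φ.injective.eq_iff]
  · exact (MulEquiv.toAdditive ψ.symm).surjective.comp (detKer_surjective.comp φ.surjective)
  · rw [hφι]
    rfl
  · rw [hψπ]
    rfl
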